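/- Let $\mathbb H$ be the quaternions, let $\mathbb H^3$ be the right $\mathbb H$-space with the Hermitian form $\langle z,w\rangle=\bar w_3z_1+\bar w_2z_2+\bar w_1z_3$ of signature $(2,1)$, let $\mathrm{Sp}(2,1)$ be its isometry group, acting on the quaternionic hyperbolic plane $\mathbf H^2_{\mathbb H}$ (negative lines) and on its boundary (null lines). An element is hyperbolic if it fixes exactly two boundary points, and loxodromic if moreover none of its (right) eigenvalues is real. For a loxodromic $A$ let $a_A,r_A$ be its boundary fixed points for the eigenvalues of modulus $<1$ and $>1$, and $x_A$ the point polar to them. A pair $(A,B)$ is irreducible if it neither fixes a point of $\mathbf H^2_{\mathbb H}\cup\partial\mathbf H^2_{\mathbb H}$ nor preserves a proper totally geodesic subspace. Parameters of a pair $(A,B)$ of loxodromic elements: * the real traces of $A$ and $B$: the coefficients $(a,b,c)\in\mathbb R^3$ of the characteristic polynomial $x^6-ax^5+bx^4-cx^3+bx^2-ax+1$ of the associated complex $6\times 6$ matrix; * for $(z_1,z_2,z_3,z_4)=(a_A,r_A,a_B,r_B)$, the similarity classes of the cross ratios $\mathbb X(z_1,z_2,z_3,z_4)$, $\mathbb X(z_1,z_4,z_3,z_2)$,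 $\mathbb X(z_2,z_4,z_3,z_1)$, where $\mathbb X(z_1,z_2,z_3,z_4)=\langle z_3,z_1\rangle\langle z_3,z_2\rangle^{-1}\langle z_4,z_2\rangle\langle z_4,z_1\rangle^{-1}$, and the Cartan angular invariants $\mathbb A$ of the triples $(z_1,z_2,z_3)$, $(z_1,z_2,z_4)$, $(z_2,z_3,z_4)$, $(z_1,z_3,z_4)$, where $\mathbb A(z_1,z_2,z_3)=\arccos(-\Re t/|t|)$, $t=\langle z_3,z_1\rangle\langle z_2,z_3\rangle\langle z_1,z_2\rangle$ (computed with lifts); * the projective points: for each value of the cross ratios and angular invariants fix a reference quadruple of boundary points with lifts, and lifts of the two polar points. Move the quadruple $(a_A,r_A,a_B,r_B)$ to the reference quadruple by an element of $\mathrm{Sp}(2,1)$; on the lines $a_A$, $x_A$, $a_B$, $x_B$, identified with $\mathbb H=\mathbb C^2$ by the reference lifts, the eigenvectors for the complex eigenvalue with positive imaginary part form a complex line. These four points of $\mathbb{CP}^1$, modulo the stabilizer of the reference quadruple, are the projective points of $(A,B)$. Let $\Sigma_g$ be a closed connected orientable surface of genus $g\ge 2$ with a curve system of $3g-3$ curves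 $\gamma_j$ that cut it into $2g-2$ three-holed spheres $P_v$; fix loops $c_{v,1},c_{v,2},c_{v,3}\in\pi_1(\Sigma_g)$ around the boundary components of $P_v$ with $c_{v,1}c_{v,2}c_{v,3}=1$, and for each $j$ an element $t_j$ conjugating the loop $c$ on one side of $\gamma_j$ (in $P_v$) to the inverse of the loop on the other side (in $P_{v'}$), with $t_j=1$ for the curves in a spanning tree of the dual graph. A representation $\rho:\pi_1(\Sigma_g)\to\mathrm{Sp}(2,1)$ is geometric if it is discrete and faithful, each $\rho(\gamma_j)$ is loxodromic, and each pair $(\rho(c_{v,1}),\rho(c_{v,2}))$ is irreducible. The $(0,3)$ parameters of $\rho$ are the parameters of these $2g-2$ pairs. Put $E(s,\psi,\xi)=\mathrm{diag}(se^{i\psi},e^{i\xi},s^{-1}e^{i\psi})$. Given a geometric representation $\rho_0$ (the reference), a geometric $\rho$ has twist-bend parameters $\kappa_j=(s_j,\psi_j,\xi_j)\in\mathbb R_{>0}\times(\mathbb R/2\pi)^2$, $1\le j\le 3g-3$, relative to $\rho_0$ if there are $k_v\in\mathrm{Sp}(2,1)$ with $k_v\rho(c_{v,i})k_v^{-1}=\rho_0(c_{v,i})$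 for all $v,i$ and $k_{v'}\rho(t_j)k_v^{-1}=\rho_0(t_j)K_j$ for all $j$, where $K_j=Q_jE(s_j,\psi_j,\xi_j)Q_j^{-1}$, $\rho_0(\gamma_j)=Q_jE(r_j,\theta_j,\phi_j)Q_j^{-1}$ with $0<r_j<1$, $\theta_j,\phi_j\in(0,\pi)$, $Q_j\in \mathrm{Sp}(2,1)$ (so $K_j$ commutes with $\rho_0(\gamma_j)$ and has the same projective points). Then: 1. Conjugate geometric representations have the same $(0,3)$ parameters. 2. If the geometric representations $\rho_0$ and $\rho$ have the same $(0,3)$ parameters, then $\rho$ has twist-bend parameters relative to $\rho_0$. 3. If the geometric representations $\rho,\rho'$ have twist-bend parameters $\kappa,\kappa'$ relative to the geometric representation $\rho_0$, then $\rho$ and $\rho'$ are conjugate in $\mathrm{Sp}(2,1)$ if and only if $\kappa=\kappa'$ up to signs, i.e. there are $\varepsilon_v\in\{0,\pi\}$ with $s_j'=s_j$, $\psi_j'=\psi_j+\varepsilon_v+\varepsilon_{v'}$, $\xi_j'=\xi_j+\varepsilon_v+\varepsilon_{v'}$ for each curve $\gamma_j$ between $P_v$ and $P_{v'}$. 4.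 The number of real parameters is $42g-42$: for every geometric $\rho$, the class of $\rho$ has an open neighbourhood in the deformation space $\mathrm{Hom}(\pi_1(\Sigma_g),\mathrm{Sp}(2,1))/\mathrm{Sp}(2,1)$ that is homeomorphic to an open subset of $\mathbb R^{42g-42}$. Thus a geometric representation is determined up to conjugation by its Fenchel–Nielsen parameters (the $(0,3)$ parameters and the twist-bend parameters), and it depends locally on $42g-42$ real parameters. -/

import Mathlib

noncomputable section

namespace FN

open scoped Quaternion RightActions Matrix LinearAlgebra.Projectivization

/-! ### The group `Sp(2,1)` and quaternionic hyperbolic space -/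

/-- `ℍ³`, a right vector space over `ℍ`; `z <• q` is right multiplication by a scalar. -/
abbrev V : Type := Fin 3 → ℍ[ℝ]

/-- The matrix of the Hermitian form of signature `(2,1)`. -/
def H₁ : Matrix (Fin 3) (Fin 3) ℍ[ℝ] := !![0, 0, 1; 0, 1, 0; 1, 0, 0]

/-- `⟨z, w⟩ = w* H₁ z`. -/
def herm (z w : V) : ℍ[ℝ] := star (w 2) * z 0 + star (w 1) * z 1 + star (w 0) * z 2

/-- `Sp(2,1)`: the invertible matrices with `A* H₁ A = H₁`. -/
def Sp21 : Subgroup (Matrix (Fin 3) (Fin 3) ℍ[ℝ])ˣ where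
  carrier := {A | (A : Matrix (Fin 3) (Fin 3) ℍ[ℝ])ᴴ * H₁ * A.val = H₁}
  one_mem' := by simp
  mul_mem' := by
    intro A B hA hB
    simp only [Set.mem_ofPred_eq] at *
    rw [Units.val_mul, Matrix.conjTranspose_mul]
    calc _ = B.valᴴ * (A.valᴴ * H₁ * A.val) * B.val := by simp only [mul_assoc]
      _ = H₁ := by rw [hA, hB]
  inv_mem' := by
    intro A hA
    simp only [Set.mem_ofPred_eq] at *
    have h1 : A.val * (A⁻¹).val = 1 := by simp
    have h2 : ((A⁻¹).val)ᴴ * A.valᴴ = 1 := by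
      rw [← Matrix.conjTranspose_mul, h1, Matrix.conjTranspose_one]
    calc _ = ((A⁻¹).val)ᴴ * (A.valᴴ * H₁ * A.val) * (A⁻¹).val := by rw [hA]
      _ = (((A⁻¹).val)ᴴ * A.valᴴ) * H₁ * (A.val * (A⁻¹).val) := by simp only [mul_assoc]
      _ = H₁ := by rw [h1, h2, one_mul, mul_one]

/-- The quaternionic matrix of an element of `Sp(2,1)`. -/
def mat (A : Sp21) : Matrix (Fin 3) (Fin 3) ℍ[ℝ] := A.1.1

/-- An element of `Sp(2,1)` as a right-linear map of `ℍ³`. -/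
def toLin (A : Sp21) : V →ₗ[ℍ[ℝ]ᵐᵒᵖ] V where
  toFun v := mat A *ᵥ v
  map_add' := Matrix.mulVec_add _
  map_smul' q v := Matrix.mulVec_smul _ q v

theorem toLin_injective (A : Sp21) : Function.Injective (toLin A) := by
  intro v w h
  have h' : A.1⁻¹.val *ᵥ (A.1.val *ᵥ v) = A.1⁻¹.val *ᵥ (A.1.val *ᵥ w) :=
    congrArg _ h
  simpa [Matrix.mulVec_mulVec] using h'

/-- The quaternionic projective plane. -/
abbrev HP2 : Type := ℙ ℍ[ℝ]ᵐᵒᵖ V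

/-- The action of `Sp(2,1)` on the quaternionic projective plane. -/
def act (A : Sp21) : HP2 → HP2 := Projectivization.map (toLin A) (toLin_injective A)

/-- The quaternionic hyperbolic plane (negative lines). -/
def hypPlane : Set HP2 := {p | (herm p.rep p.rep).re < 0}

/-- The ideal boundary of the quaternionic hyperbolic plane (null lines). -/
def idealBoundary : Set HP2 := {p | herm p.rep p.rep = 0}

/-- `r` lies on the complete geodesic through `p` and `q` (all in `hypPlane`): such a geodesic
consists of the negative lines in the real span of lifts `z`, `w` of `p`, `q` with `⟨z, w⟩` real. -/
def OnGeodesic (p q r : HP2) : Prop :=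
  ∃ z ∈ p.submodule, ∃ w ∈ q.submodule, z ≠ 0 ∧ w ≠ 0 ∧ (herm z w).im = 0 ∧
    ∃ a b : ℝ, a • z + b • w ≠ 0 ∧ a • z + b • w ∈ r.submodule

/-- (Complete) totally geodesic subspaces: nonempty sets of points of the hyperbolic plane that
contain with any two points the complete geodesic through them. -/
def IsTotallyGeodesic (S : Set HP2) : Prop :=
  S.Nonempty ∧ S ⊆ hypPlane ∧
    ∀ p ∈ S, ∀ q ∈ S, ∀ r ∈ hypPlane, OnGeodesic p q r → r ∈ S

/-- The pair `(A, B)` neither fixes a point of the closed hyperbolic plane nor preserves a proper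
totally geodesic subspace. -/
def IsIrreducible (A B : Sp21) : Prop :=
  (¬ ∃ p ∈ hypPlane ∪ idealBoundary, act A p = p ∧ act B p = p) ∧
  ¬ ∃ S : Set HP2, IsTotallyGeodesic S ∧ S ≠ hypPlane ∧
      Set.MapsTo (act A) S S ∧ Set.MapsTo (act B) S S

/-- `v` is an eigenvector of `A` for the right eigenvalue `q`. -/
def IsEigenvector (A : Sp21) (q : ℍ[ℝ]) (v : V) : Prop :=
  v ≠ 0 ∧ mat A *ᵥ v = v <• q

/-- Exactly two fixed points on the ideal boundary. -/
def IsHyperbolic (A : Sp21) : Prop :=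
  {p | p ∈ idealBoundary ∧ act A p = p}.ncard = 2

/-- Hyperbolic, and no eigenvalue is real. -/
def IsLoxodromic (A : Sp21) : Prop :=
  IsHyperbolic A ∧ ∀ q v, IsEigenvector A q v → q.im ≠ 0

/-! ### Real trace -/

/-- For `A = A₁ + j A₂` with `A₁`, `A₂` complex, the complex `6 × 6` matrix
`[[A₁, -conj A₂], [A₂, conj A₁]]`. -/
def complexify (A : Sp21) : Matrix (Fin 3 ⊕ Fin 3) (Fin 3 ⊕ Fin 3) ℂ :=
  let A₁ : Matrix (Fin 3) (Fin 3) ℂ := (mat A).map fun q => ⟨q.re, q.imI⟩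
  let A₂ : Matrix (Fin 3) (Fin 3) ℂ := (mat A).map fun q => ⟨q.imJ, -q.imK⟩
  Matrix.fromBlocks A₁ (-(A₂.map star)) A₂ (A₁.map star)

/-- The real trace `(a, b, c)`, where the characteristic polynomial of `complexify A` is
`x⁶ - a x⁵ + b x⁴ - c x³ + b x² - a x + 1` with `a, b, c` real. -/
def realTrace (A : Sp21) : ℝ × ℝ × ℝ :=
  let χ := (complexify A).charpoly
  (-(χ.coeff 5).re, (χ.coeff 4).re, -(χ.coeff 3).re)

/-! ### Cross ratios and angular invariants -/

/-- The cross ratio of four null vectors; its similarity class depends only on the four points. -/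
def crossRatio (z₁ z₂ z₃ z₄ : V) : ℍ[ℝ] :=
  herm z₃ z₁ * (herm z₃ z₂)⁻¹ * herm z₄ z₂ * (herm z₄ z₁)⁻¹

/-- The quaternionic Cartan angular invariant. With the convention `⟨z, w⟩ = w* H₁ z` this order
of the three factors makes it independent of the lifts. -/
def angular (z₁ z₂ z₃ : V) : ℝ :=
  let t := herm z₃ z₁ * herm z₂ z₃ * herm z₁ z₂
  Real.arccos (-t.re / ‖t‖)

/-- The invariants of an ordered quadruple of boundary points: the similarity classes of the three
cross ratios, and the angular invariants of the triples
`(1,2,3)`, `(1,2,4)`, `(2,3,4)` and `(1,3,4)`. -/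
def quadInvariants (z : Fin 4 → V) : (Fin 3 → ConjClasses ℍ[ℝ]) × (Fin 4 → ℝ) :=
  (![ConjClasses.mk (crossRatio (z 0) (z 1) (z 2) (z 3)),
     ConjClasses.mk (crossRatio (z 0) (z 3) (z 2) (z 1)),
     ConjClasses.mk (crossRatio (z 1) (z 3) (z 2) (z 0))],
   ![angular (z 0) (z 1) (z 2), angular (z 0) (z 1) (z 3), angular (z 1) (z 2) (z 3),
     angular (z 0) (z 2) (z 3)])

/-- A lift of the attracting fixed point of a hyperbolic element (eigenvalue of modulus `< 1`). -/
def attracting (A : Sp21) : V :=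
  Classical.epsilon fun v => ∃ q : ℍ[ℝ], ‖q‖ < 1 ∧ IsEigenvector A q v

/-- A lift of the repelling fixed point of a hyperbolic element (eigenvalue of modulus `> 1`). -/
def repelling (A : Sp21) : V :=
  Classical.epsilon fun v => ∃ q : ℍ[ℝ], 1 < ‖q‖ ∧ IsEigenvector A q v

/-- Lifts of the ordered quadruple of fixed points `(a_A, r_A, a_B, r_B)`. -/
def fixedQuad (A B : Sp21) : Fin 4 → V :=
  ![attracting A, repelling A, attracting B, repelling B]

/-! ### Projective points -/

/-- The projective point of `T` on the eigenline `z ℍ`, the line being identified with `ℍ` by means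
of the lift `z`. It is the set of the `q` for which `z q` lies in the eigenset of the representative
`l ∈ ℂ`, `Im l > 0`, of the eigenvalue class: a complex line `q₀ ℂ` in `ℍ`, that is, a point of the
complex projective line of `ℍ = ℂ²`. -/
def projPoint (T : Sp21) (z : V) : Set ℍ[ℝ] :=
  {q | ∃ l : ℂ, 0 < l.im ∧ mat T *ᵥ (z <• q) = (z <• q) <• (l : ℍ[ℝ])}

/-- A reference configuration for a value `τ` of the invariants of quadruples: lifts `z` of four
distinct boundary points with these invariants, and lifts `x 0`, `x 1` of the points polar to
`(z 0, z 1)` and to `(z 2, z 3)`. -/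
structure IsRefFrame (τ : (Fin 3 → ConjClasses ℍ[ℝ]) × (Fin 4 → ℝ))
    (z : Fin 4 → V) (x : Fin 2 → V) : Prop where
  null : ∀ i, z i ≠ 0 ∧ herm (z i) (z i) = 0
  distinct : ∀ i j, i ≠ j → herm (z i) (z j) ≠ 0
  inv : quadInvariants z = τ
  polar_ne : ∀ k, x k ≠ 0
  polar_left : herm (x 0) (z 0) = 0 ∧ herm (x 0) (z 1) = 0
  polar_right : herm (x 1) (z 2) = 0 ∧ herm (x 1) (z 3) = 0

/-- For every value of the invariants, a reference configuration, chosen once and for all. -/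
def refFrame (τ : (Fin 3 → ConjClasses ℍ[ℝ]) × (Fin 4 → ℝ)) : (Fin 4 → V) × (Fin 2 → V) :=
  Classical.epsilon fun F => IsRefFrame τ F.1 F.2

/-- The projective points `(p₁(A), p₂(A), p₁(B), p₂(B))` of the pair `(A, B)`: an element `h` of
`Sp(2,1)` moves the quadruple of fixed points to the reference quadruple with the same invariants,
and the projective points of `h A h⁻¹` and `h B h⁻¹` are read off relative to the reference lifts.
As `h` is unique only up to the stabilizer of the reference quadruple, the value is an orbit of
this stabilizer (a single point when the stabilizer is `±1`). -/
def projectivePoints (A B : Sp21) : Set (Fin 4 → Set ℍ[ℝ]) :=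
  let F := refFrame (quadInvariants (fixedQuad A B))
  {p | ∃ h : Sp21, (∀ i, ∃ q : ℍ[ℝ], mat h *ᵥ fixedQuad A B i = F.1 i <• q) ∧
    p = ![projPoint (h * A * h⁻¹) (F.1 0), projPoint (h * A * h⁻¹) (F.2 0),
          projPoint (h * B * h⁻¹) (F.1 2), projPoint (h * B * h⁻¹) (F.2 1)]}

/-- The parameters of the `(0,3)` group generated by `A` and `B`. -/
structure PantsParameters where
  traceA : ℝ × ℝ × ℝ
  traceB : ℝ × ℝ × ℝ
  crossRatios : Fin 3 → ConjClasses ℍ[ℝ]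
  angles : Fin 4 → ℝ
  projPoints : Set (Fin 4 → Set ℍ[ℝ])

/-- Real traces, cross ratios, angular invariants and projective points of `(A, B)`. -/
def pairParameters (A B : Sp21) : PantsParameters where
  traceA := realTrace A
  traceB := realTrace B
  crossRatios := (quadInvariants (fixedQuad A B)).1
  angles := (quadInvariants (fixedQuad A B)).2
  projPoints := projectivePoints A B

/-! ### Surface groups and curve systems -/

/-- The fundamental group of the closed orientable surface of genus `g`,
`⟨a₁, b₁, …, a_g, b_g | [a₁, b₁] ⋯ [a_g, b_g]⟩`. -/
abbrev SurfaceGroup (g : ℕ) : Type :=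
  PresentedGroup {(List.ofFn fun i : Fin g =>
    let a : FreeGroup (Fin g ⊕ Fin g) := FreeGroup.of (Sum.inl i)
    let b : FreeGroup (Fin g ⊕ Fin g) := FreeGroup.of (Sum.inr i)
    a * b * a⁻¹ * b⁻¹).prod}

/-- Generators for a surface glued from `2g-2` three-holed spheres along `3g-3` curves: the
boundary loops of the three-holed spheres, and one connecting loop for each curve. -/
abbrev GluingGen (g : ℕ) : Type := (Fin (2 * g - 2) × Fin 3) ⊕ Fin (3 * g - 3)

/-- The relations of the fundamental group of the glued surface (van Kampen's theorem): in each
three-holed sphere the product of the three boundary loops is trivial; across each curve the two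
boundary loops on its sides are conjugate, with opposite orientations, by the connecting loop; the
connecting loops of the curves in a spanning tree are trivial. -/
inductive GluingRel {g : ℕ} (side : Fin (3 * g - 3) × Bool ≃ Fin (2 * g - 2) × Fin 3)
    (tree : Finset (Fin (3 * g - 3))) : FreeGroup (GluingGen g) → Prop
  | pants (v : Fin (2 * g - 2)) : GluingRel side tree
      (FreeGroup.of (Sum.inl (v, 0)) * FreeGroup.of (Sum.inl (v, 1)) *
        FreeGroup.of (Sum.inl (v, 2)))
  | glue (j : Fin (3 * g - 3)) : GluingRel side tree
      (FreeGroup.of (Sum.inr j) * FreeGroup.of (Sum.inl (side (j, false))) *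
        (FreeGroup.of (Sum.inr j))⁻¹ * FreeGroup.of (Sum.inl (side (j, true))))
  | tree (j : Fin (3 * g - 3)) (hj : j ∈ tree) : GluingRel side tree (FreeGroup.of (Sum.inr j))

/-- A curve system on the closed orientable surface of genus `g`: a pattern by which the surface is
glued from `2g-2` three-holed spheres along `3g-3` curves, with an identification of the fundamental
group of the glued surface with that of the surface. `side (j, false)` and `side (j, true)` are the
boundary components on the two sides of the `j`-th curve. The spanning tree of the dual graph only
serves to name base paths. -/
structure CurveSystem (g : ℕ) where
  side : Fin (3 * g - 3) × Bool ≃ Fin (2 * g - 2) × Fin 3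
  tree : Finset (Fin (3 * g - 3))
  tree_card : tree.card + 1 = 2 * g - 2
  tree_connected : ∀ v w : Fin (2 * g - 2), Relation.ReflTransGen
    (fun v w => ∃ j ∈ tree, ∃ b : Bool, (side (j, b)).1 = v ∧ (side (j, !b)).1 = w) v w
  marking : PresentedGroup {w | GluingRel side tree w} ≃* SurfaceGroup g

namespace CurveSystem

variable {g : ℕ} (C : CurveSystem g)

/-- The `i`-th boundary loop of the three-holed sphere `v`. -/
def boundary (v : Fin (2 * g - 2)) (i : Fin 3) : SurfaceGroup g :=
  C.marking (PresentedGroup.of (Sum.inl (v, i)))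

/-- The `j`-th curve `γ_j` (up to conjugacy), as a boundary loop on one of its sides. -/
def curve (j : Fin (3 * g - 3)) : SurfaceGroup g :=
  C.boundary (C.side (j, false)).1 (C.side (j, false)).2

/-- The connecting loop of the `j`-th curve. -/
def connector (j : Fin (3 * g - 3)) : SurfaceGroup g :=
  C.marking (PresentedGroup.of (Sum.inr j))

/-- The three-holed sphere on the side `b` of the `j`-th curve. -/
def pants (j : Fin (3 * g - 3)) (b : Bool) : Fin (2 * g - 2) := (C.side (j, b)).1

end CurveSystem

/-! ### Representations and the deformation space -/

/-- `Hom(π₁(Σ_g), Sp(2,1))`. -/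
def Rep (g : ℕ) : Type := SurfaceGroup g →* Sp21

/-- The topology of pointwise convergence. -/
instance (g : ℕ) : TopologicalSpace (Rep g) :=
  TopologicalSpace.induced (fun (ρ : SurfaceGroup g →* Sp21) (x : SurfaceGroup g) => ρ x)
    inferInstance

instance (g : ℕ) : FunLike (Rep g) (SurfaceGroup g) Sp21 :=
  inferInstanceAs (FunLike (SurfaceGroup g →* Sp21) (SurfaceGroup g) Sp21)

/-- Conjugacy of representations under `Sp(2,1)`. -/
def Conjugate {g : ℕ} (ρ ρ' : Rep g) : Prop := ∃ h : Sp21, ∀ x, ρ' x = h * ρ x * h⁻¹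

/-- Conjugacy of representations as an equivalence relation. -/
def conjSetoid (g : ℕ) : Setoid (Rep g) where
  r := Conjugate
  iseqv :=
    { refl := fun ρ => ⟨1, fun x => by simp⟩
      symm := by
        rintro ρ ρ' ⟨h, hh⟩
        exact ⟨h⁻¹, fun x => by rw [hh x]; group⟩
      trans := by
        rintro ρ ρ' ρ'' ⟨h, hh⟩ ⟨k, hk⟩
        exact ⟨k * h, fun x => by rw [hk x, hh x]; group⟩ }

/-- The deformation space `Hom(π₁(Σ_g), Sp(2,1)) / Sp(2,1)`, with the quotient topology. -/
abbrev Deformation (g : ℕ) : Type := Quotient (conjSetoid g)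

/-- Geometric representations: discrete and faithful, with loxodromic images of the curves and
irreducible `(0,3)` subgroups. -/
structure IsGeometric {g : ℕ} (C : CurveSystem g) (ρ : Rep g) : Prop where
  faithful : Function.Injective ρ
  discrete : DiscreteTopology (Set.range ρ)
  loxodromic : ∀ j, IsLoxodromic (ρ (C.curve j))
  irreducible : ∀ v, IsIrreducible (ρ (C.boundary v 0)) (ρ (C.boundary v 1))

/-- The parameters of the `(0,3)` group of the three-holed sphere `v`. -/
def pantsParameters {g : ℕ} (C : CurveSystem g) (ρ : Rep g) (v : Fin (2 * g - 2)) :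
    PantsParameters :=
  pairParameters (ρ (C.boundary v 0)) (ρ (C.boundary v 1))

/-! ### Twist-bends -/

/-- `E(s, ψ, ξ) = diag(s e^{iψ}, e^{iξ}, s⁻¹ e^{iψ})`. -/
def E (s : ℝ) (ψ ξ : Real.Angle) : Matrix (Fin 3) (Fin 3) ℍ[ℝ] :=
  Matrix.diagonal ![((s * (ψ.toCircle : ℂ) : ℂ) : ℍ[ℝ]), ((ξ.toCircle : ℂ) : ℍ[ℝ]),
    ((s⁻¹ * (ψ.toCircle : ℂ) : ℂ) : ℍ[ℝ])]

/-- Twist-bend parameters. -/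
structure TwistBend where
  s : ℝ
  s_pos : 0 < s
  ψ : Real.Angle
  ξ : Real.Angle

/-- `K` is the twist-bend with parameters `κ`, oriented consistently with the loxodromic `A`:
`A = Q E(r, θ, φ) Q⁻¹` and `K = Q E(s, ψ, ξ) Q⁻¹`. In particular `K` commutes with `A` and its
projective points are those of `A`. -/
def IsTwist (A : Sp21) (κ : TwistBend) (K : Sp21) : Prop :=
  ∃ (Q : Sp21) (r θ φ : ℝ), r ∈ Set.Ioo 0 1 ∧ θ ∈ Set.Ioo 0 Real.pi ∧ φ ∈ Set.Ioo 0 Real.pi ∧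
    mat A * mat Q = mat Q * E r θ φ ∧ mat K * mat Q = mat Q * E κ.s κ.ψ κ.ξ

/-- `ρ` is obtained from the reference representation `ρ₀` by twist-bends with parameters `κ j`
along the curves: the `(0,3)` groups of `ρ` are conjugate (by `k v`) to those of `ρ₀`, and across
the `j`-th curve they are attached by the attaching element of `ρ₀` followed by the twist-bend. -/
def HasTwistBends {g : ℕ} (C : CurveSystem g) (ρ₀ ρ : Rep g)
    (κ : Fin (3 * g - 3) → TwistBend) : Prop :=
  ∃ k : Fin (2 * g - 2) → Sp21,
    (∀ v i, k v * ρ (C.boundary v i) * (k v)⁻¹ = ρ₀ (C.boundary v i)) ∧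
    ∀ j, ∃ K : Sp21, IsTwist (ρ₀ (C.curve j)) (κ j) K ∧
      k (C.pants j true) * ρ (C.connector j) * (k (C.pants j false))⁻¹ = ρ₀ (C.connector j) * K

/-- Equality of twist-bend parameters, up to the indeterminacy caused by the centre `±1` of
`Sp(2,1)`: the conjugating elements of the `(0,3)` groups are determined only up to sign. -/
def SameTwistBends {g : ℕ} (C : CurveSystem g) (κ κ' : Fin (3 * g - 3) → TwistBend) : Prop :=
  ∃ ε : Fin (2 * g - 2) → Real.Angle, (∀ v, ε v = 0 ∨ ε v = (Real.pi : Real.Angle)) ∧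
    ∀ j, (κ' j).s = (κ j).s ∧
      (κ' j).ψ = (κ j).ψ + (ε (C.pants j false) + ε (C.pants j true)) ∧
      (κ' j).ξ = (κ j).ξ + (ε (C.pants j false) + ε (C.pants j true))

end FN

end

noncomputable section

namespace FN

open scoped Quaternion RightActions Matrix LinearAlgebra.Projectivization

section

/-! ### The Hermitian form -/

/-! Normal form. A loxodromic element is conjugate in Sp(2,1) to some E(r, θ, φ) with 0 < r < 1 and
θ, φ in (0, π) (`IsLoxodromic.exists_normal_form`). Its eigenvalues are non-real with distinct
moduli r, 1, 1/r, so its centralizer, written in the eigenframe, consists of complex diagonal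
isometries, that is, of the matrices E(s, ψ, ξ) (`commute_E`, `exists_E_of_diagonal`). These are the
twist-bends. The real trace determines the eigenvalues: they are the roots of the characteristic
polynomial in the upper half plane, told apart by their moduli (`eig_eq_of_realTrace`).

Parameters of pairs. The parameters are natural under conjugation, which gives statement 1.
Conversely, a quadruple of boundary points is normalized to (1,0,0), (0,0,1), (α,μ,1), (β,ν,1). With
c = ⟨z₄,z₃⟩, the cross ratios and angular invariants fix, up to a common scale, the norms and real
parts of α, β, c and the real parts of certain products. Their imaginary parts then have prescribed
inner products and triple product, which determine a triple of vectors of ℝ³ up to rotation, so α,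
β, c are determined up to simultaneous similarity and scaling, and the quadruple up to isometry
(`IsNullQuad.congruent`). In a common position, the real trace and the projective points on the
attracting and polar lines determine a loxodromic element, the action on the repelling line being
dual to that on the attracting one (`eq_of_projPoint`). Hence pairs with equal parameters are
conjugate (`exists_conj_of_pairParameters`). Across each curve the chosen conjugators differ by an
element commuting with ρ₀(γ_j), a twist-bend; this is statement 2.

Signs. The centralizer of an irreducible pair with a loxodromic member is ±1
(`IsIrreducible.centralizer`): a commuting T either has an attracting or repelling point that the
pair would fix, or fixes a point of the plane, and then its fixed set is an invariant totally
geodesic subspace, hence everything. So the conjugators of the three-holed spheres are unique up to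
sign, which is the indeterminacy in statement 3.

Local dimension. Replacing inverses by adjoints makes the surface relation a polynomial map on
2g-tuples of matrices. By duality for the trace form, a direction missed by its differential
centralizes the representation, and the Lie algebra centralizer vanishes by the Cayley transform
(`IsIrreducible.infCentralizer`). Unitarity, the relation and a linear slice condition therefore
form a submersion, whose kernel has dimension 72g − 30g − 21 − 21 = 42g − 42. Near the base point
the slice meets every orbit once: the inverse function theorem handles conjugators near 1, and
properness of the action (`IsIrreducible.proper`) shows that every conjugator between nearby
representations is near ±1. This gives `exists_chart`. -/

@[simp] theorem rsmul_apply (z : V) (q : ℍ[ℝ]) (i : Fin 3) : (z <• q) i = z i * q := rfl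

theorem rsmul_rsmul (z : V) (p q : ℍ[ℝ]) : (z <• p) <• q = z <• (p * q) := by
  ext1 i; simp [mul_assoc]

theorem rsmul_one (z : V) : z <• (1 : ℍ[ℝ]) = z := by
  ext1 i; simp

theorem rsmul_zero (z : V) : z <• (0 : ℍ[ℝ]) = 0 := by
  ext1 i; simp

theorem rsmul_ne_zero {z : V} (hz : z ≠ 0) {q : ℍ[ℝ]} (hq : q ≠ 0) : z <• q ≠ 0 := by
  intro h
  apply hz
  ext1 i
  have := congrFun h i
  simpa [hq] using this

theorem rsmul_injective {z : V} (hz : z ≠ 0) {p q : ℍ[ℝ]} (h : z <• p = z <• q) : p = q := by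
  by_contra hpq
  refine rsmul_ne_zero hz (sub_ne_zero.2 hpq) ?_
  ext1 i
  have := congrFun h i
  simp only [rsmul_apply] at this
  simp [mul_sub, this]

theorem real_smul_eq (a : ℝ) (z : V) : a • z = z <• (a : ℍ[ℝ]) := by
  ext1 i
  simp [Quaternion.coe_commutes, ← Quaternion.coe_mul_eq_smul]

theorem mulVec_rsmul (M : Matrix (Fin 3) (Fin 3) ℍ[ℝ]) (z : V) (q : ℍ[ℝ]) :
    M *ᵥ (z <• q) = (M *ᵥ z) <• q := Matrix.mulVec_smul _ _ _

theorem herm_rsmul_left (z w : V) (a : ℍ[ℝ]) : herm (z <• a) w = herm z w * a := by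
  simp [herm, add_mul, mul_assoc]

theorem herm_rsmul_right (z w : V) (b : ℍ[ℝ]) : herm z (w <• b) = star b * herm z w := by
  simp [herm, mul_add, mul_assoc]

theorem herm_add_left (z z' w : V) : herm (z + z') w = herm z w + herm z' w := by
  simp only [herm, Pi.add_apply, mul_add]; abel

theorem herm_add_right (z w w' : V) : herm z (w + w') = herm z w + herm z w' := by
  simp only [herm, Pi.add_apply, star_add, add_mul]; abel

theorem herm_sub_left (z z' w : V) : herm (z - z') w = herm z w - herm z' w := by
  simp only [herm, Pi.sub_apply, mul_sub]; abel

theorem herm_sub_right (z w w' : V) : herm z (w - w') = herm z w - herm z w' := by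
  simp only [herm, Pi.sub_apply, star_sub, sub_mul]; abel

@[simp] theorem herm_zero_left (w : V) : herm 0 w = 0 := by simp [herm]

@[simp] theorem herm_zero_right (w : V) : herm w 0 = 0 := by simp [herm]

theorem star_herm (z w : V) : star (herm z w) = herm w z := by
  simp only [herm, star_add, star_mul, star_star]; abel

theorem herm_comm_eq_zero {z w : V} (h : herm z w = 0) : herm w z = 0 := by
  rw [← star_herm, h, star_zero]

theorem herm_self_real (z : V) : herm z z = ((herm z z).re : ℍ[ℝ]) :=
  Quaternion.star_eq_self.1 (star_herm z z)

theorem herm_self_eq_zero_iff (z : V) : herm z z = 0 ↔ (herm z z).re = 0 := by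
  constructor
  · intro h; rw [h]; rfl
  · intro h; rw [herm_self_real, h]; rfl

theorem herm_self_rsmul (z : V) (q : ℍ[ℝ]) :
    (herm (z <• q) (z <• q)).re = ‖q‖ ^ 2 * (herm z z).re := by
  rw [herm_rsmul_left, herm_rsmul_right, herm_self_real z, ← Quaternion.coe_commutes, mul_assoc,
    Quaternion.star_mul_self, ← Quaternion.coe_mul, Quaternion.re_coe, Quaternion.re_coe,
    Quaternion.normSq_eq_norm_mul_self]
  ring

theorem herm_eq_dotProduct (z w : V) : herm z w = star w ⬝ᵥ (H₁ *ᵥ z) := by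
  simp [herm, H₁, dotProduct, Fin.sum_univ_three, Matrix.mulVec]
  abel

@[simp] theorem H₁_mul_H₁ : H₁ * H₁ = 1 := by
  refine Matrix.ext fun i j => ?_
  fin_cases i <;> fin_cases j <;> simp [H₁, Matrix.mul_apply, Fin.sum_univ_three]

@[simp] theorem H₁_conjTranspose : H₁ᴴ = H₁ := by
  refine Matrix.ext fun i j => ?_
  fin_cases i <;> fin_cases j <;> simp [H₁, Matrix.conjTranspose_apply]

theorem herm_mulVec (M : Matrix (Fin 3) (Fin 3) ℍ[ℝ]) (z w : V) :
    herm (M *ᵥ z) (M *ᵥ w) = star w ⬝ᵥ ((Mᴴ * H₁ * M) *ᵥ z) := by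
  rw [herm_eq_dotProduct, Matrix.star_mulVec, ← Matrix.dotProduct_mulVec]
  simp [Matrix.mulVec_mulVec, mul_assoc]

/-! ### Elements of `Sp(2,1)` -/

theorem mat_rel (A : Sp21) : (mat A)ᴴ * H₁ * mat A = H₁ := A.2

theorem mat_injective : Function.Injective mat := fun _ _ h => Subtype.ext (Units.ext h)

@[simp] theorem mat_mul (A B : Sp21) : mat (A * B) = mat A * mat B := rfl

@[simp] theorem mat_one : mat 1 = 1 := rfl

@[simp] theorem mat_mul_inv (A : Sp21) : mat A * mat A⁻¹ = 1 := by rw [← mat_mul]; simp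

@[simp] theorem mat_inv_mul (A : Sp21) : mat A⁻¹ * mat A = 1 := by rw [← mat_mul]; simp

theorem mat_inv (A : Sp21) : mat A⁻¹ = H₁ * (mat A)ᴴ * H₁ := by
  have h : (H₁ * (mat A)ᴴ * H₁) * mat A = 1 := by
    rw [mul_assoc, mul_assoc, ← mul_assoc (mat A)ᴴ, mat_rel, H₁_mul_H₁]
  calc mat A⁻¹ = ((H₁ * (mat A)ᴴ * H₁) * mat A) * mat A⁻¹ := by rw [h, one_mul]
    _ = _ := by rw [mul_assoc _ (mat A), mat_mul_inv, mul_one]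

@[simp] theorem herm_mat (A : Sp21) (z w : V) : herm (mat A *ᵥ z) (mat A *ᵥ w) = herm z w := by
  rw [herm_mulVec, mat_rel, herm_eq_dotProduct]

/-- The element of `Sp(2,1)` with a given matrix. -/
def mkSp (M : Matrix (Fin 3) (Fin 3) ℍ[ℝ]) (h : Mᴴ * H₁ * M = H₁) : Sp21 :=
  have h' : (H₁ * Mᴴ * H₁) * M = 1 := by
    rw [mul_assoc, mul_assoc, ← mul_assoc Mᴴ, h, H₁_mul_H₁]
  ⟨⟨M, H₁ * Mᴴ * H₁, mul_eq_one_comm.1 h', h'⟩, h⟩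

@[simp] theorem mat_mkSp (M : Matrix (Fin 3) (Fin 3) ℍ[ℝ]) (h : Mᴴ * H₁ * M = H₁) :
    mat (mkSp M h) = M := rfl

@[simp] theorem mat_mulVec_inv (A : Sp21) (v : V) : mat A *ᵥ (mat A⁻¹ *ᵥ v) = v := by
  simp [Matrix.mulVec_mulVec]

@[simp] theorem mat_inv_mulVec (A : Sp21) (v : V) : mat A⁻¹ *ᵥ (mat A *ᵥ v) = v := by
  simp [Matrix.mulVec_mulVec]

theorem mat_mulVec_ne_zero (A : Sp21) {v : V} (hv : v ≠ 0) : mat A *ᵥ v ≠ 0 := by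
  intro h
  apply hv
  rw [← mat_inv_mulVec A v, h, Matrix.mulVec_zero]

/-- The matrix with columns `z`, `x`, `w`. -/
def cols (z x w : V) : Matrix (Fin 3) (Fin 3) ℍ[ℝ] := Matrix.of fun i => ![z i, x i, w i]

theorem cols_mulVec (z x w v : V) :
    cols z x w *ᵥ v = z <• v 0 + x <• v 1 + w <• v 2 := by
  ext1 i
  simp [cols, Matrix.mulVec, dotProduct, Fin.sum_univ_three]

theorem cols_eq_iff (z x w z' x' w' : V) :
    cols z x w = cols z' x' w' ↔ z = z' ∧ x = x' ∧ w = w' := by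
  constructor
  · intro h
    refine ⟨?_, ?_, ?_⟩ <;> ext1 i
    · simpa [cols] using congrFun (congrFun h i) 0
    · simpa [cols] using congrFun (congrFun h i) 1
    · simpa [cols] using congrFun (congrFun h i) 2
  · rintro ⟨rfl, rfl, rfl⟩; rfl

theorem mul_cols (M : Matrix (Fin 3) (Fin 3) ℍ[ℝ]) (z x w : V) :
    M * cols z x w = cols (M *ᵥ z) (M *ᵥ x) (M *ᵥ w) := by
  refine Matrix.ext fun i j => ?_
  fin_cases j <;> simp [cols, Matrix.mul_apply, Matrix.mulVec, dotProduct]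

theorem cols_mul_diagonal (z x w : V) (d : Fin 3 → ℍ[ℝ]) :
    cols z x w * Matrix.diagonal d = cols (z <• d 0) (x <• d 1) (w <• d 2) := by
  refine Matrix.ext fun i j => ?_
  fin_cases j <;> simp [cols]

/-- The Gram conditions under which three columns form an element of `Sp(2,1)`. -/
theorem cols_rel {z x w : V} (hz : herm z z = 0) (hw : herm w w = 0) (hzw : herm z w = 1)
    (hx : herm x x = 1) (hxz : herm x z = 0) (hxw : herm x w = 0) :
    (cols z x w)ᴴ * H₁ * cols z x w = H₁ := by
  have hwz : herm w z = 1 := by rw [← star_herm, hzw, star_one]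
  have hzx := herm_comm_eq_zero hxz
  have hwx := herm_comm_eq_zero hxw
  have key : ∀ i j, ((cols z x w)ᴴ * H₁ * cols z x w) i j =
      herm (![z, x, w] j) (![z, x, w] i) := by
    intro i j
    fin_cases i <;> fin_cases j <;>
      simp [cols, herm, H₁, Matrix.mul_apply, Fin.sum_univ_three]
  refine Matrix.ext fun i j => ?_
  rw [key]
  fin_cases i <;> fin_cases j <;> simp [H₁, *]

/-! ### Signature -/

theorem herm_self_of_two_eq_zero {v : V} (h : v 2 = 0) : (herm v v).re = ‖v 1‖ ^ 2 := by
  simp only [herm, h, star_zero, zero_mul, mul_zero, zero_add, add_zero, Quaternion.star_mul_self,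
    Quaternion.re_coe, Quaternion.normSq_eq_norm_mul_self]
  ring

/-- Vectors orthogonal to a null vector `z` are non-negative, and null only on the line of `z`. -/
theorem orthogonal_null {z x : V} (hz0 : z ≠ 0) (hz : herm z z = 0) (hxz : herm x z = 0) :
    0 ≤ (herm x x).re ∧ (herm x x = 0 → ∃ q : ℍ[ℝ], x = z <• q) := by
  by_cases h2 : z 2 = 0
  · have h1 : z 1 = 0 := by
      have := herm_self_of_two_eq_zero h2
      rw [hz] at this
      have : ‖z 1‖ ^ 2 = 0 := this.symm
      simpa using this
    have h0 : z 0 ≠ 0 := by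
      intro h0
      apply hz0
      ext1 i; fin_cases i <;> simp [h0, h1, h2]
    have hx2 : x 2 = 0 := by
      simp only [herm, h1, h2, star_zero, zero_mul, zero_add] at hxz
      simpa [h0] using hxz
    rw [herm_self_of_two_eq_zero hx2]
    refine ⟨by positivity, fun h => ⟨(z 0)⁻¹ * x 0, ?_⟩⟩
    rw [herm_self_eq_zero_iff, herm_self_of_two_eq_zero hx2] at h
    have hx1 : x 1 = 0 := by simpa using h
    ext1 i; fin_cases i <;> simp [h0, h1, h2, hx1, hx2]
  -- Subtracting a multiple of z preserves ⟨x,x⟩ and the orthogonality to z, and the last coordinate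
  -- can be made 0; on vectors with last coordinate 0 the form is |x₁|².
  · set x' := x - z <• ((z 2)⁻¹ * x 2) with hx'
    have hx'2 : x' 2 = 0 := by simp [hx', h2]
    have hx'z : herm x' z = 0 := by rw [hx', herm_sub_left, herm_rsmul_left, hxz, hz]; simp
    have hxx : herm x x = herm x' x' := by
      have : x = x' + z <• ((z 2)⁻¹ * x 2) := by rw [hx']; abel
      rw [this, herm_add_left, herm_add_right, herm_add_right, herm_rsmul_left, herm_rsmul_left,
        herm_rsmul_right, herm_rsmul_right, hz, hx'z, herm_comm_eq_zero hx'z]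
      simp
    rw [hxx]
    rw [herm_self_of_two_eq_zero hx'2]
    refine ⟨by positivity, fun h => ⟨(z 2)⁻¹ * x 2, ?_⟩⟩
    rw [herm_self_eq_zero_iff, herm_self_of_two_eq_zero hx'2] at h
    have hx'1 : x' 1 = 0 := by simpa using h
    have hx'0 : x' 0 = 0 := by
      simp only [herm, hx'1, hx'2, mul_zero, add_zero] at hx'z
      simpa [h2] using hx'z
    have : x' = 0 := by ext1 i; fin_cases i <;> simp [hx'0, hx'1, hx'2]
    rw [hx', sub_eq_zero] at this
    exact this

/-- Two negative vectors are never orthogonal. -/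
theorem herm_ne_zero_of_neg {z w : V} (hz : (herm z z).re < 0) (hw : (herm w w).re < 0) :
    herm z w ≠ 0 := by
  intro h
  have h2 : z 2 ≠ 0 := by
    intro h2
    rw [herm_self_of_two_eq_zero h2] at hz
    exact absurd hz (not_lt.2 (by positivity))
  -- This vector has last coordinate 0, so its norm is non-negative; if z ⊥ w, its norm would be the
  -- norm of w plus a non-positive multiple, hence negative.
  have hv2 : (w - z <• ((z 2)⁻¹ * w 2)) 2 = 0 := by simp [h2]
  have hv := herm_self_of_two_eq_zero hv2
  have hvv : (herm (w - z <• ((z 2)⁻¹ * w 2)) (w - z <• ((z 2)⁻¹ * w 2))).re =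
      (herm w w).re + ‖(z 2)⁻¹ * w 2‖ ^ 2 * (herm z z).re := by
    rw [herm_sub_left, herm_sub_right, herm_sub_right, ← herm_self_rsmul]
    simp only [herm_rsmul_left, herm_rsmul_right w z, h,
      herm_comm_eq_zero h]
    simp
  nlinarith [sq_nonneg ‖(w - z <• ((z 2)⁻¹ * w 2)) 1‖, sq_nonneg ‖(z 2)⁻¹ * w 2‖]

theorem herm_ne_zero_of_null {z w : V} (hz0 : z ≠ 0) (hz : herm z z = 0) (hw : herm w w = 0)
    (h : ¬ ∃ q : ℍ[ℝ], w = z <• q) : herm z w ≠ 0 := fun h' =>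
  h ((orthogonal_null hz0 hz (herm_comm_eq_zero h')).2 hw)

/-- A hyperbolic pair of null vectors has a unit polar vector. -/
theorem exists_polar {z w : V} (hz : herm z z = 0) (hw : herm w w = 0) (hzw : herm z w = 1) :
    ∃ x : V, herm x x = 1 ∧ herm x z = 0 ∧ herm x w = 0 := by
  have hwz : herm w z = 1 := by rw [← star_herm, hzw, star_one]
  have hz0 : z ≠ 0 := by rintro rfl; simp at hzw
  let p : V → V := fun v => v - z <• herm v w - w <• herm v z
  have hpw : ∀ v, herm (p v) w = 0 := fun v => by
    simp [p, herm_sub_left, herm_rsmul_left, hzw, hw]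
  have hpz : ∀ v, herm (p v) z = 0 := fun v => by
    simp [p, herm_sub_left, herm_rsmul_left, hwz, hz]
  -- The real part of the trace of the projection p is 3 − 2 Re⟨z,w⟩ = 1, so p is not zero.
  obtain ⟨v, hv⟩ : ∃ v, p v ≠ 0 := by
    by_contra! hall
    have h0 := congrArg (fun u : V => (u 0).re) (hall (Pi.single 0 1))
    have h1 := congrArg (fun u : V => (u 1).re) (hall (Pi.single 1 1))
    have h2 := congrArg (fun u : V => (u 2).re) (hall (Pi.single 2 1))
    have h3 := congrArg (fun q : ℍ[ℝ] => q.re) hzw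
    simp [p, herm] at h0 h1 h2 h3
    linarith
  have hpos : 0 < (herm (p v) (p v)).re := by
    obtain ⟨h, h'⟩ := orthogonal_null hz0 hz (hpz v)
    refine lt_of_le_of_ne h fun h0 => hv ?_
    obtain ⟨q, hq⟩ := h' ((herm_self_eq_zero_iff _).2 h0.symm)
    have := hpw v
    rw [hq, herm_rsmul_left, hzw, one_mul] at this
    rw [hq, this, rsmul_zero]
  refine ⟨p v <• (((Real.sqrt (herm (p v) (p v)).re)⁻¹ : ℝ) : ℍ[ℝ]), ?_, ?_, ?_⟩
  · rw [herm_self_real, herm_self_rsmul, Quaternion.norm_coe, Real.norm_eq_abs, sq_abs, inv_pow,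
      Real.sq_sqrt hpos.le, inv_mul_cancel₀ hpos.ne']
    rfl
  · rw [herm_rsmul_left, hpz, zero_mul]
  · rw [herm_rsmul_left, hpw, zero_mul]

/-- A hyperbolic pair of null vectors is the image of the standard one. -/
theorem exists_frame {z w : V} (hz : herm z z = 0) (hw : herm w w = 0) (hzw : herm z w = 1) :
    ∃ (Q : Sp21) (x : V), mat Q = cols z x w ∧ herm x x = 1 ∧ herm x z = 0 ∧ herm x w = 0 := by
  obtain ⟨x, hx, hxz, hxw⟩ := exists_polar hz hw hzw
  exact ⟨mkSp _ (cols_rel hz hw hzw hx hxz hxw), x, rfl, hx, hxz, hxw⟩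

/-! ### Points of the projective plane -/

theorem mk_eq_mk_iff_rsmul {v w : V} (hv : v ≠ 0) (hw : w ≠ 0) :
    Projectivization.mk ℍ[ℝ]ᵐᵒᵖ v hv = Projectivization.mk ℍ[ℝ]ᵐᵒᵖ w hw ↔
      ∃ q : ℍ[ℝ], v = w <• q := by
  rw [Projectivization.mk_eq_mk_iff']
  constructor
  · rintro ⟨a, ha⟩
    exact ⟨a.unop, by rw [← ha]; rfl⟩
  · rintro ⟨q, hq⟩
    exact ⟨MulOpposite.op q, hq.symm⟩

theorem act_mk (A : Sp21) {v : V} (hv : v ≠ 0) :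
    act A (Projectivization.mk ℍ[ℝ]ᵐᵒᵖ v hv) =
      Projectivization.mk ℍ[ℝ]ᵐᵒᵖ (mat A *ᵥ v) (mat_mulVec_ne_zero A hv) := rfl

theorem act_mk_eq_iff (A : Sp21) {v : V} (hv : v ≠ 0) :
    act A (Projectivization.mk ℍ[ℝ]ᵐᵒᵖ v hv) = Projectivization.mk ℍ[ℝ]ᵐᵒᵖ v hv ↔
      ∃ q : ℍ[ℝ], mat A *ᵥ v = v <• q := by
  rw [act_mk, mk_eq_mk_iff_rsmul]

theorem exists_rep_mk {v : V} (hv : v ≠ 0) :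
    ∃ q : ℍ[ℝ], q ≠ 0 ∧ (Projectivization.mk ℍ[ℝ]ᵐᵒᵖ v hv).rep = v <• q := by
  obtain ⟨a, ha⟩ := Projectivization.exists_smul_eq_mk_rep ℍ[ℝ]ᵐᵒᵖ v hv
  exact ⟨a.1.unop, by simp, ha.symm⟩

theorem mk_mem_idealBoundary {v : V} (hv : v ≠ 0) :
    Projectivization.mk ℍ[ℝ]ᵐᵒᵖ v hv ∈ idealBoundary ↔ herm v v = 0 := by
  obtain ⟨q, hq, h⟩ := exists_rep_mk hv
  rw [idealBoundary, Set.mem_ofPred_eq, h, herm_self_eq_zero_iff, herm_self_rsmul,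
    herm_self_eq_zero_iff]
  simp [hq]

theorem mk_mem_hypPlane {v : V} (hv : v ≠ 0) :
    Projectivization.mk ℍ[ℝ]ᵐᵒᵖ v hv ∈ hypPlane ↔ (herm v v).re < 0 := by
  obtain ⟨q, hq, h⟩ := exists_rep_mk hv
  rw [hypPlane, Set.mem_ofPred_eq, h, herm_self_rsmul]
  have : 0 < ‖q‖ ^ 2 := by positivity
  constructor
  · intro h; by_contra! h'; nlinarith [mul_nonneg this.le h']
  · intro h; nlinarith

theorem act_mul (A B : Sp21) (p : HP2) : act (A * B) p = act A (act B p) := by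
  induction p using Projectivization.ind with
  | h v hv =>
    simp only [act_mk, mat_mul, Matrix.mulVec_mulVec]

theorem mem_submodule_mk {v w : V} (hv : v ≠ 0) :
    w ∈ (Projectivization.mk ℍ[ℝ]ᵐᵒᵖ v hv).submodule ↔ ∃ q : ℍ[ℝ], w = v <• q := by
  rw [Projectivization.submodule_mk, Submodule.mem_span_singleton]
  constructor
  · rintro ⟨a, rfl⟩; exact ⟨a.unop, rfl⟩
  · rintro ⟨q, rfl⟩; exact ⟨MulOpposite.op q, rfl⟩

end

section

/-! ### Similarity of quaternions -/

theorem pure_mul_self {p : ℍ[ℝ]} (hp : p.re = 0) : p * p = -((Quaternion.normSq p : ℝ) : ℍ[ℝ]) := by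
  have : star p = -p := by ext <;> simp [hp]
  rw [← Quaternion.self_mul_star, this, mul_neg, neg_neg]

theorem exists_quaternion (a b c d : ℝ) :
    ∃ q : ℍ[ℝ], q.re = a ∧ q.imI = b ∧ q.imJ = c ∧ q.imK = d := ⟨⟨a, b, c, d⟩, rfl, rfl, rfl, rfl⟩

/-- Purely imaginary quaternions of the same norm are similar. -/
theorem exists_conj_pure {p p' : ℍ[ℝ]} (hp : p.re = 0) (hp' : p'.re = 0)
    (h : Quaternion.normSq p = Quaternion.normSq p') : ∃ u : ℍ[ℝ], u ≠ 0 ∧ u * p = p' * u := by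
  by_cases h0 : p' = -p
  -- Any nonzero imaginary quaternion orthogonal to p anticommutes with it: i when p lies along k,
  -- and −p_J i + p_I j otherwise.
  · by_cases h1 : p.imI = 0 ∧ p.imJ = 0
    · obtain ⟨u, hu0, hu1, hu2, hu3⟩ := exists_quaternion 0 1 0 0
      refine ⟨u, ?_, ?_⟩
      · rintro rfl; simp at hu1
      · ext <;> simp [h0, hp, h1.1, h1.2, hu0, hu1, hu2, hu3]
    · obtain ⟨u, hu0, hu1, hu2, hu3⟩ := exists_quaternion 0 (-p.imJ) p.imI 0
      refine ⟨u, ?_, ?_⟩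
      · rintro rfl
        simp at hu1 hu2
        exact h1 ⟨hu2.symm, hu1⟩
      · ext <;> simp [h0, hp, hu0, hu1, hu2, hu3] <;> ring
  · by_cases hp0 : p = 0
    · rw [hp0, map_zero, eq_comm, Quaternion.normSq_eq_zero] at h
      exact ⟨1, one_ne_zero, by simp [h, hp0]⟩
    -- With N = |p|², p² = p'² = −N gives (N − p'p)p = N(p + p') = p'(N − p'p).
    refine ⟨((Quaternion.normSq p : ℝ) : ℍ[ℝ]) - p' * p, ?_, ?_⟩
    · intro h1
      apply h0
      rw [sub_eq_zero] at h1
      have h2 : (p' + p) * p = 0 := by rw [add_mul, pure_mul_self hp, h1]; simp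
      rcases mul_eq_zero.1 h2 with h3 | h3
      · exact eq_neg_of_add_eq_zero_left h3
      · exact absurd h3 hp0
    · rw [sub_mul, mul_sub, mul_assoc, pure_mul_self hp, ← mul_assoc, pure_mul_self hp', ← h,
        ← Quaternion.coe_commutes _ p']
      simp only [mul_neg, neg_mul, sub_neg_eq_add, ← Quaternion.coe_commutes]
      abel

/-- Dividing by the norm, a central real, keeps all intertwining relations, so similarities can be
taken with unit quaternions. -/
theorem exists_unit_of_conj {u : ℍ[ℝ]} (hu : u ≠ 0) : ∃ v : ℍ[ℝ],
    star v * v = 1 ∧ v * star v = 1 ∧ ∀ p p' : ℍ[ℝ], u * p = p' * u → v * p = p' * v := by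
  have hn : ‖u‖ ≠ 0 := norm_ne_zero_iff.2 hu
  have h1 : Quaternion.normSq (((‖u‖⁻¹ : ℝ) : ℍ[ℝ]) * u) = 1 := by
    rw [map_mul, Quaternion.normSq_coe, Quaternion.normSq_eq_norm_mul_self]
    field_simp
  refine ⟨((‖u‖⁻¹ : ℝ) : ℍ[ℝ]) * u, ?_, ?_, fun p p' h => ?_⟩
  · rw [Quaternion.star_mul_self, h1]; rfl
  · rw [Quaternion.self_mul_star, h1]; rfl
  · rw [mul_assoc, h, ← mul_assoc, ← mul_assoc, Quaternion.coe_commutes]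

theorem norm_of_star_mul_self {u : ℍ[ℝ]} (h : star u * u = 1) : ‖u‖ = 1 := by
  have h1 : ‖u‖ * ‖u‖ = 1 := by
    have := congrArg norm h
    rwa [norm_mul, Quaternion.norm_star, norm_one] at this
  nlinarith [norm_nonneg u]

theorem norm_coeComplex (z : ℂ) : ‖(z : ℍ[ℝ])‖ = ‖z‖ := by
  have h : ‖(z : ℍ[ℝ])‖ * ‖(z : ℍ[ℝ])‖ = ‖z‖ * ‖z‖ := by
    rw [← Quaternion.normSq_eq_norm_mul_self, Quaternion.normSq_def', ← pow_two ‖z‖,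
      ← Complex.normSq_eq_norm_sq, Complex.normSq_apply]
    simp; ring
  nlinarith [norm_nonneg z, norm_nonneg (z : ℍ[ℝ])]

theorem coeComplex_injective {z w : ℂ} (h : (z : ℍ[ℝ]) = w) : z = w :=
  Complex.ext (by simpa using congrArg (fun q : ℍ[ℝ] => q.re) h)
    (by simpa using congrArg (fun q : ℍ[ℝ] => q.imI) h)

theorem star_coeComplex (z : ℂ) : star (z : ℍ[ℝ]) = ((starRingEnd ℂ z : ℂ) : ℍ[ℝ]) := by
  ext <;> simp

/-- A non-real quaternion is similar to a complex number in the upper half plane. -/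
theorem exists_complex_conj {q : ℍ[ℝ]} (hq : q.im ≠ 0) :
    ∃ (u : ℍ[ℝ]) (l : ℂ), star u * u = 1 ∧ u * star u = 1 ∧ 0 < l.im ∧ q * u = u * (l : ℍ[ℝ]) := by
  have hn : 0 < ‖q.im‖ := norm_pos_iff.2 hq
  obtain ⟨u, hu, h⟩ := exists_conj_pure (p := ((⟨0, ‖q.im‖⟩ : ℂ) : ℍ[ℝ])) (p' := q.im) (by simp)
    (by simp) (by
      rw [Quaternion.normSq_eq_norm_mul_self, Quaternion.normSq_eq_norm_mul_self, norm_coeComplex]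
      congr 1 <;>
      · rw [Complex.norm_def, Complex.normSq_mk]
        simp)
  obtain ⟨v, hv, hv', hv''⟩ := exists_unit_of_conj hu
  replace h := hv'' _ _ h
  refine ⟨v, ⟨q.re, ‖q.im‖⟩, hv, hv', hn, ?_⟩
  have h1 : (((⟨q.re, ‖q.im‖⟩ : ℂ)) : ℍ[ℝ]) = (q.re : ℍ[ℝ]) + ((⟨0, ‖q.im‖⟩ : ℂ) : ℍ[ℝ]) := by
    ext <;> simp
  conv_lhs => rw [← Quaternion.re_add_im q]
  rw [h1, mul_add, add_mul, h, Quaternion.coe_commutes]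

/-- A quaternion commuting with a non-real complex number is complex. -/
theorem eq_coeComplex_of_commute {q : ℍ[ℝ]} {l : ℂ} (hl : l.im ≠ 0)
    (h : q * (l : ℍ[ℝ]) = (l : ℍ[ℝ]) * q) : q = ((⟨q.re, q.imI⟩ : ℂ) : ℍ[ℝ]) := by
  have hj := congrArg (fun q : ℍ[ℝ] => q.imJ) h
  have hk := congrArg (fun q : ℍ[ℝ] => q.imK) h
  simp at hj hk
  have h1 : q.imJ = 0 := by
    have : l.im * q.imJ = 0 := by linarith
    simpa [hl] using this
  have h2 : q.imK = 0 := by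
    have : l.im * q.imK = 0 := by linarith
    simpa [hl] using this
  ext <;> simp [h1, h2]

/-- Similar quaternions have equal norm. This is what kills the components of a vector, or the
off-diagonal entries of a matrix, between eigenvalues of different modulus. -/
theorem eq_zero_of_mul_eq_mul_of_norm_ne {a b q : ℍ[ℝ]} (hab : ‖a‖ ≠ ‖b‖) (h : a * q = q * b) :
    q = 0 := by
  by_contra hq
  apply hab
  have h1 := congrArg norm h
  rw [norm_mul, norm_mul, mul_comm] at h1
  exact mul_left_cancel₀ (norm_ne_zero_iff.2 hq) h1

/-- Complex numbers in the upper half plane that are similar as quaternions agree. -/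
theorem eq_of_conj_upper {l l' : ℂ} {q : ℍ[ℝ]} (hq : q ≠ 0) (hl : 0 < l.im) (hl' : 0 < l'.im)
    (h : (l : ℍ[ℝ]) * q = q * (l' : ℍ[ℝ])) : l = l' := by
  have h1 : (l : ℍ[ℝ]) = q * (l' : ℍ[ℝ]) * q⁻¹ := by rw [← h, mul_assoc, mul_inv_cancel₀ hq, mul_one]
  have hre : l.re = l'.re := by
    have h2 := congrArg (fun q : ℍ[ℝ] => q.re) h1
    have h3 : (q * (l' : ℍ[ℝ]) * q⁻¹).re = (l' : ℍ[ℝ]).re := by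
      have : ∀ a b : ℍ[ℝ], (a * b).re = (b * a).re := fun a b => by simp; ring
      rw [mul_assoc, this, mul_assoc, inv_mul_cancel₀ hq, mul_one]
    simpa [h3] using h2
  have hn : ‖l‖ = ‖l'‖ := by
    rw [← norm_coeComplex, ← norm_coeComplex, h1, norm_mul, norm_mul, norm_inv, mul_comm ‖q‖,
      mul_assoc, mul_inv_cancel₀ (norm_ne_zero_iff.2 hq), mul_one]
  have him : l.im ^ 2 = l'.im ^ 2 := by
    have h2 : ‖l‖ ^ 2 = ‖l'‖ ^ 2 := by rw [hn]
    rw [← Complex.normSq_eq_norm_sq, ← Complex.normSq_eq_norm_sq, Complex.normSq_apply,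
      Complex.normSq_apply, hre] at h2
    nlinarith
  exact Complex.ext hre (by nlinarith)

/-! ### The normal form of loxodromic elements -/

theorem exists_polar_form {l : ℂ} (hl : 0 < l.im) :
    ∃ θ ∈ Set.Ioo 0 Real.pi, l = (‖l‖ : ℂ) * (((θ : ℝ) : Real.Angle).toCircle : ℂ) := by
  refine ⟨l.arg, ⟨?_, ?_⟩, ?_⟩
  · refine lt_of_le_of_ne (Complex.arg_nonneg_iff.2 hl.le) fun h => ?_
    rw [eq_comm, Complex.arg_eq_zero_iff] at h
    exact hl.ne' h.2
  · rw [Complex.arg_lt_pi_iff]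
    exact Or.inr hl.ne'
  · rw [Real.Angle.toCircle_coe, Circle.coe_exp, Complex.norm_mul_exp_arg_mul_I]

theorem toCircle_im_pos {θ : ℝ} (h : θ ∈ Set.Ioo 0 Real.pi) :
    0 < (((θ : Real.Angle).toCircle : ℂ)).im := by
  rw [Real.Angle.toCircle_coe, Circle.coe_exp, Complex.exp_ofReal_mul_I_im]
  exact Real.sin_pos_of_mem_Ioo h

/-- The action of an isometry in a frame of eigenvectors. -/
theorem eigen_polar {A : Sp21} {z x w : V} {l m : ℍ[ℝ]} {Q : Sp21} (hQ : mat Q = cols z x w)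
    (hz : herm z z = 0) (hw : herm w w = 0) (hzw : herm z w = 1) (hx : herm x x = 1)
    (hxz : herm x z = 0) (hxw : herm x w = 0) (hAz : mat A *ᵥ z = z <• l)
    (hAw : mat A *ᵥ w = w <• m) : ∃ n : ℍ[ℝ], ‖n‖ = 1 ∧ mat A *ᵥ x = x <• n := by
  have hlm : star m * l = 1 := by
    have := herm_mat A z w
    rwa [hAz, hAw, herm_rsmul_left, herm_rsmul_right, hzw, mul_one] at this
  have hl : l ≠ 0 := by rintro rfl; simp at hlm
  have hm : m ≠ 0 := by rintro rfl; simp at hlm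
  have hwz : herm w z = 1 := by rw [← star_herm, hzw, star_one]
  have h1 : herm (mat A *ᵥ x) z = 0 := by
    have := herm_mat A x z
    rw [hAz, herm_rsmul_right, hxz, mul_eq_zero] at this
    simpa [hl] using this
  have h2 : herm (mat A *ᵥ x) w = 0 := by
    have := herm_mat A x w
    rw [hAw, herm_rsmul_right, hxw, mul_eq_zero] at this
    simpa [hm] using this
  have h3 := mat_mulVec_inv Q (mat A *ᵥ x)
  set c := mat Q⁻¹ *ᵥ (mat A *ᵥ x)
  rw [hQ, cols_mulVec] at h3
  have hc0 : c 0 = 0 := by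
    rw [← h3] at h2
    simpa [herm_add_left, herm_rsmul_left, hzw, hxw, hw] using h2
  have hc2 : c 2 = 0 := by
    rw [← h3] at h1
    simpa [herm_add_left, herm_rsmul_left, hwz, hxz, hz] using h1
  rw [hc0, hc2, rsmul_zero, rsmul_zero, zero_add, add_zero] at h3
  refine ⟨c 1, norm_of_star_mul_self ?_, h3.symm⟩
  have := herm_mat A x x
  rwa [← h3, herm_rsmul_left, herm_rsmul_right, hx, mul_one] at this

/-- The eigenvalue parameters that occur in normal forms of loxodromic elements. -/
def IsLoxParam (r θ φ : ℝ) : Prop :=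
  r ∈ Set.Ioo 0 1 ∧ θ ∈ Set.Ioo 0 Real.pi ∧ φ ∈ Set.Ioo 0 Real.pi

theorem rsmul_herm_one {z w : V} (h : herm z w = 1) {u : ℍ[ℝ]} (hu : star u * u = 1) :
    herm (z <• u) (w <• u) = 1 := by
  rw [herm_rsmul_left, herm_rsmul_right, h, mul_one, hu]

theorem rsmul_herm_zero {z w : V} (h : herm z w = 0) (u v : ℍ[ℝ]) :
    herm (z <• u) (w <• v) = 0 := by
  rw [herm_rsmul_left, herm_rsmul_right, h]; simp

/-- On the dual null line the eigenvalue is the inverse conjugate of l, so the unit u that makes l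
complex makes m complex too. One u thus serves both null columns, and their product remains 1. -/
theorem inv_star_of_conj {l m u : ℍ[ℝ]} {k : ℂ} (hlm : star m * l = 1) (hu : u * star u = 1)
    (hu' : star u * u = 1)
    (h : l * u = u * (k : ℍ[ℝ])) : m * u = u * (((starRingEnd ℂ k)⁻¹ : ℂ) : ℍ[ℝ]) := by
  have hl : l ≠ 0 := by rintro rfl; simp at hlm
  have hk : k ≠ 0 := by
    rintro rfl
    rw [Quaternion.coeComplex_zero, mul_zero, mul_eq_zero] at h
    rcases h with h | h
    · exact hl h
    · simp [h] at hu
  have hk' : starRingEnd ℂ k ≠ 0 := by simpa using hk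
  have h1 : (k : ℍ[ℝ]) = star u * l * u := by rw [mul_assoc, h, ← mul_assoc, hu', one_mul]
  have h2 : ((starRingEnd ℂ k : ℂ) : ℍ[ℝ]) = star u * star l * u := by
    rw [← star_coeComplex, h1]; simp [mul_assoc]
  have h3 : star l * m = 1 := by
    have := congrArg star hlm
    simpa using this
  have h4 : m * star l = 1 := mul_eq_one_comm.1 h3
  have h5 : m * u * ((starRingEnd ℂ k : ℂ) : ℍ[ℝ]) = u := by
    rw [h2]
    calc m * u * (star u * star l * u) = m * (u * star u) * star l * u := by simp only [mul_assoc]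
      _ = u := by rw [hu, mul_one, h4, one_mul]
  conv_rhs => rw [← h5]
  rw [mul_assoc _ _ ((_ : ℂ) : ℍ[ℝ]), ← Quaternion.coeComplex_mul, mul_inv_cancel₀ hk', Quaternion.coeComplex_one,
    mul_one]

theorem exists_normal_form_of_norm_lt {A : Sp21} (hA : ∀ q v, IsEigenvector A q v → q.im ≠ 0)
    {z w : V} {l m : ℍ[ℝ]} (hz : herm z z = 0) (hw : herm w w = 0) (hzw : herm z w = 1)
    (hAz : mat A *ᵥ z = z <• l) (hAw : mat A *ᵥ w = w <• m) (hl : ‖l‖ < 1) :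
    ∃ (Q : Sp21) (r θ φ : ℝ), IsLoxParam r θ φ ∧ mat A * mat Q = mat Q * E r θ φ := by
  obtain ⟨Q, x, hQ, hx, hxz, hxw⟩ := exists_frame hz hw hzw
  obtain ⟨n, hn, hAx⟩ := eigen_polar hQ hz hw hzw hx hxz hxw hAz hAw
  have hz0 : z ≠ 0 := by rintro rfl; simp at hzw
  have hx0 : x ≠ 0 := by rintro rfl; simp at hx
  have hlm : star m * l = 1 := by
    have := herm_mat A z w
    rwa [hAz, hAw, herm_rsmul_left, herm_rsmul_right, hzw, mul_one] at this
  obtain ⟨u, k, hu, hu', hk, hku⟩ := exists_complex_conj (hA l z ⟨hz0, hAz⟩)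
  obtain ⟨v, j, hv, hv', hj, hjv⟩ := exists_complex_conj (hA n x ⟨hx0, hAx⟩)
  have hmu := inv_star_of_conj hlm hu' hu hku
  have hkl : ‖k‖ = ‖l‖ := by
    have := congrArg norm hku
    rwa [norm_mul, norm_mul, norm_of_star_mul_self hu, mul_one, one_mul, norm_coeComplex,
      eq_comm] at this
  have hjn : ‖j‖ = 1 := by
    have := congrArg norm hjv
    rwa [norm_mul, norm_mul, norm_of_star_mul_self hv, mul_one, one_mul, norm_coeComplex, hn,
      eq_comm] at this
  obtain ⟨θ, hθ, hkθ⟩ := exists_polar_form hk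
  obtain ⟨φ, hφ, hjφ⟩ := exists_polar_form hj
  have hk0 : 0 < ‖k‖ := by
    rw [norm_pos_iff]; rintro rfl; simp at hk
  refine ⟨mkSp (cols (z <• u) (x <• v) (w <• u)) (cols_rel (rsmul_herm_zero hz _ _)
    (rsmul_herm_zero hw _ _) (rsmul_herm_one hzw hu) (rsmul_herm_one hx hv)
    (rsmul_herm_zero hxz _ _) (rsmul_herm_zero hxw _ _)), ‖k‖, θ, φ,
    ⟨⟨hk0, hkl ▸ hl⟩, hθ, hφ⟩, ?_⟩
  rw [mat_mkSp, mul_cols, E, cols_mul_diagonal, cols_eq_iff]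
  refine ⟨?_, ?_, ?_⟩
  · rw [mulVec_rsmul, hAz, rsmul_rsmul, rsmul_rsmul, hku, Matrix.cons_val_zero, ← hkθ]
  · rw [mulVec_rsmul, hAx, rsmul_rsmul, rsmul_rsmul, hjv, Matrix.cons_val_one,
      Matrix.cons_val_zero, hjφ, hjn, Complex.ofReal_one, one_mul]
  · rw [mulVec_rsmul, hAw, rsmul_rsmul, rsmul_rsmul, hmu]
    have hc : starRingEnd ℂ ((θ : Real.Angle).toCircle : ℂ) * ((θ : Real.Angle).toCircle : ℂ) = 1 := by
      rw [mul_comm, Complex.mul_conj, Complex.normSq_eq_norm_sq, Circle.norm_coe]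
      simp
    have hk1 : (‖k‖ : ℂ) ≠ 0 := by exact_mod_cast hk0.ne'
    have hk2 : (starRingEnd ℂ k)⁻¹ = (‖k‖ : ℂ)⁻¹ * ((θ : Real.Angle).toCircle : ℂ) := by
      refine inv_eq_of_mul_eq_one_left ?_
      conv_lhs => rw [hkθ]
      rw [map_mul, Complex.conj_ofReal]
      simp only [norm_mul, Complex.norm_real, norm_norm, Circle.norm_coe, mul_one]
      rw [mul_mul_mul_comm, inv_mul_cancel₀ hk1, one_mul, mul_comm, hc]
    rw [hk2]
    simp

/-- The eigenvalue moduli on a dual pair of null lines are inverse to each other; if the first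
exceeds 1, the roles of z and w are exchanged. -/
theorem exists_normal_form_or_norm_eq_one {A : Sp21}
    (hA : ∀ q v, IsEigenvector A q v → q.im ≠ 0)
    {z w : V} {l m : ℍ[ℝ]} (hz : herm z z = 0) (hw : herm w w = 0) (hzw : herm z w = 1)
    (hAz : mat A *ᵥ z = z <• l) (hAw : mat A *ᵥ w = w <• m) :
    (∃ (Q : Sp21) (r θ φ : ℝ), IsLoxParam r θ φ ∧ mat A * mat Q = mat Q * E r θ φ) ∨ ‖l‖ = 1 := by
  have hwz : herm w z = 1 := by rw [← star_herm, hzw, star_one]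
  have hlm : ‖m‖ * ‖l‖ = 1 := by
    have := herm_mat A z w
    rw [hAz, hAw, herm_rsmul_left, herm_rsmul_right, hzw, mul_one] at this
    simpa [Quaternion.norm_star] using congrArg norm this
  rcases lt_trichotomy ‖l‖ 1 with h | h | h
  · exact Or.inl (exists_normal_form_of_norm_lt hA hz hw hzw hAz hAw h)
  · exact Or.inr h
  · refine Or.inl (exists_normal_form_of_norm_lt hA hw hz hwz hAw hAz ?_)
    by_contra! h'
    nlinarith

/-- The normal form of a loxodromic element. -/
theorem IsLoxodromic.exists_normal_form {A : Sp21} (hA : IsLoxodromic A) :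
    ∃ (Q : Sp21) (r θ φ : ℝ), IsLoxParam r θ φ ∧ mat A * mat Q = mat Q * E r θ φ := by
  obtain ⟨hyp, hre⟩ := hA
  obtain ⟨p, p', hpp, hS⟩ := Set.ncard_eq_two.1 hyp
  have hp : p ∈ idealBoundary ∧ act A p = p := by
    have : p ∈ ({p, p'} : Set HP2) := by simp
    rwa [← hS] at this
  have hp' : p' ∈ idealBoundary ∧ act A p' = p' := by
    have : p' ∈ ({p, p'} : Set HP2) := by simp
    rwa [← hS] at this
  induction p using Projectivization.ind with
  | h z hz0 =>
  induction p' using Projectivization.ind with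
  | h w hw0 =>
  rw [mk_mem_idealBoundary, act_mk_eq_iff] at hp hp'
  obtain ⟨hz, l, hAz⟩ := hp
  obtain ⟨hw, m, hAw⟩ := hp'
  have hzw : herm z w ≠ 0 := by
    refine herm_ne_zero_of_null hz0 hz hw fun h => hpp ?_
    rw [eq_comm, mk_eq_mk_iff_rsmul]
    exact h
  obtain ⟨c, hc, hzw'⟩ : ∃ c : ℍ[ℝ], c ≠ 0 ∧ herm z (w <• c) = 1 := by
    refine ⟨star (herm z w)⁻¹, by simpa using hzw, ?_⟩
    rw [herm_rsmul_right, star_star, inv_mul_cancel₀ hzw]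
  have hw' := rsmul_herm_zero hw c c
  have hAw' : mat A *ᵥ (w <• c) = (w <• c) <• (c⁻¹ * m * c) := by
    rw [mulVec_rsmul, hAw, rsmul_rsmul, rsmul_rsmul, ← mul_assoc, ← mul_assoc, mul_inv_cancel₀ hc,
      one_mul]
  rcases exists_normal_form_or_norm_eq_one hre hz hw' hzw' hAz hAw' with h | h
  · exact h
  -- If the moduli are 1, both null lines have the same complex eigenvalue k, because the inverse
  -- conjugate of k is k. Then z₁ + w₁ i is an eigenvector, as i commutes with k, and is null, as i
  -- is imaginary: a third fixed boundary point.
  exfalso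
  obtain ⟨u, k, hu, hu', hk, hku⟩ := exists_complex_conj (hre l z ⟨hz0, hAz⟩)
  have hlm : star (c⁻¹ * m * c) * l = 1 := by
    have := herm_mat A z (w <• c)
    rwa [hAz, hAw', herm_rsmul_left, herm_rsmul_right _ (w <• c), hzw', mul_one] at this
  have hmu := inv_star_of_conj hlm hu' hu hku
  have hkl : ‖k‖ = 1 := by
    have := congrArg norm hku
    rwa [norm_mul, norm_mul, norm_of_star_mul_self hu, mul_one, one_mul, norm_coeComplex, h,
      eq_comm] at this
  have hkk : (starRingEnd ℂ k)⁻¹ = k := by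
    refine inv_eq_of_mul_eq_one_left ?_
    rw [Complex.mul_conj, Complex.normSq_eq_norm_sq, hkl]
    simp
  rw [hkk] at hmu
  obtain ⟨z₁, hz₁⟩ : ∃ z₁, z₁ = z <• u := ⟨_, rfl⟩
  obtain ⟨w₁, hw₁⟩ : ∃ w₁, w₁ = (w <• c) <• u := ⟨_, rfl⟩
  have hz₁z : herm z₁ z₁ = 0 := by rw [hz₁, rsmul_herm_zero hz]
  have hw₁w : herm w₁ w₁ = 0 := by rw [hw₁, rsmul_herm_zero hw']
  have hzw₁ : herm z₁ w₁ = 1 := by rw [hz₁, hw₁, rsmul_herm_one hzw' hu]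
  have hwz₁ : herm w₁ z₁ = 1 := by rw [← star_herm, hzw₁, star_one]
  have hAz₁ : mat A *ᵥ z₁ = z₁ <• (k : ℍ[ℝ]) := by
    rw [hz₁, mulVec_rsmul, hAz, rsmul_rsmul, rsmul_rsmul, hku]
  have hAw₁ : mat A *ᵥ w₁ = w₁ <• (k : ℍ[ℝ]) := by
    rw [hw₁, mulVec_rsmul, hAw', rsmul_rsmul _ _ u, hmu, ← rsmul_rsmul]
  obtain ⟨i, hi⟩ : ∃ i : ℍ[ℝ], i = ((Complex.I : ℂ) : ℍ[ℝ]) := ⟨_, rfl⟩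
  have hi0 : i ≠ 0 := by
    rw [hi]; intro h; simpa using congrArg (fun q : ℍ[ℝ] => q.imI) h
  have hsi : star i + i = 0 := by rw [hi]; ext <;> simp
  have hik : (k : ℍ[ℝ]) * i = i * (k : ℍ[ℝ]) := by
    rw [hi, ← Quaternion.coeComplex_mul, ← Quaternion.coeComplex_mul, mul_comm]
  have hv : herm (z₁ + w₁ <• i) (z₁ + w₁ <• i) = 0 := by
    simp only [herm_add_left, herm_add_right, herm_rsmul_left, herm_rsmul_right _ w₁, hzw₁, hwz₁, hz₁z, hw₁w]
    simpa [add_comm] using hsi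
  have hAv : mat A *ᵥ (z₁ + w₁ <• i) = (z₁ + w₁ <• i) <• (k : ℍ[ℝ]) := by
    rw [Matrix.mulVec_add, mulVec_rsmul, hAz₁, hAw₁, rsmul_rsmul, hik, smul_add, rsmul_rsmul]
  have hvz : herm (z₁ + w₁ <• i) z₁ = i := by
    rw [herm_add_left, herm_rsmul_left, hwz₁, hz₁z]; simp
  have hvw : herm (z₁ + w₁ <• i) w₁ = 1 := by
    rw [herm_add_left, herm_rsmul_left, hzw₁, hw₁w]; simp
  have hv0 : z₁ + w₁ <• i ≠ 0 := by
    intro h0; rw [h0] at hvw; simp at hvw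
  have hmem : Projectivization.mk ℍ[ℝ]ᵐᵒᵖ _ hv0 ∈ {p | p ∈ idealBoundary ∧ act A p = p} := by
    refine ⟨(mk_mem_idealBoundary hv0).2 hv, ?_⟩
    rw [act_mk_eq_iff]
    exact ⟨_, hAv⟩
  rw [hS, Set.mem_insert_iff, Set.mem_singleton_iff, mk_eq_mk_iff_rsmul, mk_eq_mk_iff_rsmul] at hmem
  rcases hmem with ⟨q, hq⟩ | ⟨q, hq⟩
  · rw [hq, hz₁, rsmul_herm_zero hz] at hvz
    exact hi0 hvz.symm
  · rw [hq, hw₁, rsmul_rsmul, rsmul_herm_zero hw] at hvw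
    exact zero_ne_one hvw

/-! ### Centralizers -/

theorem E_eq (s : ℝ) (ψ ξ : Real.Angle) : E s ψ ξ = Matrix.diagonal fun i =>
    ((![(s : ℂ) * (ψ.toCircle : ℂ), (ξ.toCircle : ℂ), (s : ℂ)⁻¹ * (ψ.toCircle : ℂ)] i : ℂ) : ℍ[ℝ]) := by
  rw [E]
  congr 1
  ext1 i
  fin_cases i
  · rfl
  · rfl
  · simp

/-- The eigenvalues in the normal form. -/
def eig (r θ φ : ℝ) : Fin 3 → ℂ :=
  ![(r : ℂ) * ((θ : Real.Angle).toCircle : ℂ), ((φ : Real.Angle).toCircle : ℂ),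
    (r : ℂ)⁻¹ * ((θ : Real.Angle).toCircle : ℂ)]

theorem E_eq_eig (r θ φ : ℝ) : E r θ φ = Matrix.diagonal fun i => ((eig r θ φ i : ℂ) : ℍ[ℝ]) :=
  E_eq r θ φ

theorem norm_eig {r θ φ : ℝ} (h : IsLoxParam r θ φ) (i : Fin 3) :
    ‖eig r θ φ i‖ = ![r, 1, r⁻¹] i := by
  fin_cases i <;> simp [eig, abs_of_pos h.1.1]

theorem eig_im_pos {r θ φ : ℝ} (h : IsLoxParam r θ φ) (i : Fin 3) : 0 < (eig r θ φ i).im := by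
  have h1 := toCircle_im_pos h.2.1
  have h2 := toCircle_im_pos h.2.2
  have h3 := h.1.1
  fin_cases i
  · simpa [eig] using mul_pos h3 h1
  · simpa [eig] using h2
  · have : eig r θ φ 2 = ((r⁻¹ : ℝ) : ℂ) * ((θ : Real.Angle).toCircle : ℂ) := by simp [eig]
    show 0 < (eig r θ φ 2).im
    rw [this, Complex.im_ofReal_mul]
    positivity

theorem norm_eig_injective {r θ φ : ℝ} (h : IsLoxParam r θ φ) {i j : Fin 3} (hij : i ≠ j) :
    ‖eig r θ φ i‖ ≠ ‖eig r θ φ j‖ := by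
  have h0 := h.1.1
  have h1 := h.1.2
  have h2 : 1 < r⁻¹ := (one_lt_inv₀ h0).2 h1
  rw [norm_eig h, norm_eig h]
  fin_cases i <;> fin_cases j <;> first | exact absurd rfl hij | skip
  all_goals simp only [Fin.zero_eta, Fin.mk_one, Fin.reduceFinMk, Matrix.cons_val]
  all_goals first | exact ne_of_lt (by linarith) | exact ne_of_gt (by linarith)

/-- The centralizer of a normal form consists of complex diagonal matrices. -/
theorem commute_E {r θ φ : ℝ} (h : IsLoxParam r θ φ) {M : Matrix (Fin 3) (Fin 3) ℍ[ℝ]}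
    (hM : E r θ φ * M = M * E r θ φ) : ∃ d : Fin 3 → ℂ, M = Matrix.diagonal fun i => (d i : ℍ[ℝ]) := by
  rw [E_eq_eig] at hM
  have key : ∀ i j, (eig r θ φ i : ℍ[ℝ]) * M i j = M i j * (eig r θ φ j : ℍ[ℝ]) := fun i j => by
    have := congrFun (congrFun hM i) j
    rwa [Matrix.diagonal_mul, Matrix.mul_diagonal] at this
  refine ⟨fun i => ⟨(M i i).re, (M i i).imI⟩, Matrix.ext fun i j => ?_⟩
  by_cases hij : i = j
  · subst hij
    rw [Matrix.diagonal_apply_eq]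
    exact eq_coeComplex_of_commute (eig_im_pos h i).ne' (key i i).symm
  · rw [Matrix.diagonal_apply_ne _ hij]
    refine eq_zero_of_mul_eq_mul_of_norm_ne ?_ (key i j)
    rw [norm_coeComplex, norm_coeComplex]
    exact norm_eig_injective h hij

theorem diagonal_complex_commute (d d' : Fin 3 → ℂ) :
    (Matrix.diagonal fun i => (d i : ℍ[ℝ])) * (Matrix.diagonal fun i => (d' i : ℍ[ℝ])) =
      (Matrix.diagonal fun i => (d' i : ℍ[ℝ])) * Matrix.diagonal fun i => (d i : ℍ[ℝ]) := by
  rw [Matrix.diagonal_mul_diagonal, Matrix.diagonal_mul_diagonal]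
  congr 1
  ext1 i
  rw [← Quaternion.coeComplex_mul, ← Quaternion.coeComplex_mul, mul_comm]

theorem exists_polar_angle (l : ℂ) : ∃ ψ : Real.Angle, l = (‖l‖ : ℂ) * (ψ.toCircle : ℂ) :=
  ⟨(l.arg : Real.Angle), by
    rw [Real.Angle.toCircle_coe, Circle.coe_exp, Complex.norm_mul_exp_arg_mul_I]⟩

/-- A complex diagonal matrix in `Sp(2,1)` is of the form `E(s, ψ, ξ)`. -/
theorem exists_E_of_diagonal {K : Sp21} {d : Fin 3 → ℂ}
    (hK : mat K = Matrix.diagonal fun i => (d i : ℍ[ℝ])) :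
    ∃ κ : TwistBend, mat K = E κ.s κ.ψ κ.ξ := by
  have h := mat_rel K
  rw [hK, Matrix.diagonal_conjTranspose] at h
  have h02 := congrFun (congrFun h 0) 2
  have h11 := congrFun (congrFun h 1) 1
  simp only [Matrix.mul_diagonal, Matrix.diagonal_mul, H₁] at h02 h11
  simp only [Matrix.of_apply, Matrix.cons_val, Pi.star_apply, mul_one, star_coeComplex,
    ← Quaternion.coeComplex_mul, ← Quaternion.coeComplex_one] at h02 h11
  have h02 := coeComplex_injective h02
  have h11 := coeComplex_injective h11
  have hd0 : d 0 ≠ 0 := by intro h0; simp [h0] at h02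
  have hn0 : 0 < ‖d 0‖ := norm_pos_iff.2 hd0
  have hd1 : ‖d 1‖ = 1 := by
    have := congrArg norm h11
    rw [norm_mul, RCLike.norm_conj, norm_one] at this
    nlinarith [norm_nonneg (d 1)]
  obtain ⟨ψ, hψ⟩ := exists_polar_angle (d 0)
  obtain ⟨ξ, hξ⟩ := exists_polar_angle (d 1)
  refine ⟨⟨‖d 0‖, hn0, ψ, ξ⟩, ?_⟩
  rw [hK, E_eq]
  congr 1
  ext1 i
  have hd2 : d 2 = (‖d 0‖ : ℂ)⁻¹ * (ψ.toCircle : ℂ) := by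
    have h2 : d 2 = (starRingEnd ℂ (d 0))⁻¹ := (inv_eq_of_mul_eq_one_right h02).symm
    have hc : (ψ.toCircle : ℂ) * starRingEnd ℂ (ψ.toCircle : ℂ) = 1 := by
      rw [Complex.mul_conj, Complex.normSq_eq_norm_sq, Circle.norm_coe]
      simp
    have hk1 : (‖d 0‖ : ℂ) ≠ 0 := by exact_mod_cast hn0.ne'
    rw [h2]
    refine inv_eq_of_mul_eq_one_left ?_
    have h3 : starRingEnd ℂ (d 0) = (‖d 0‖ : ℂ) * starRingEnd ℂ (ψ.toCircle : ℂ) := by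
      conv_lhs => rw [hψ]
      rw [map_mul, Complex.conj_ofReal]
    rw [h3, mul_mul_mul_comm, inv_mul_cancel₀ hk1, hc, one_mul]
  fin_cases i
  · exact congrArg _ hψ
  · refine congrArg _ (hξ.trans ?_)
    rw [hd1]; simp
  · exact congrArg _ hd2

end

section

/-! ### Real traces -/

/-- The complex `6 × 6` matrix of a quaternionic `3 × 3` matrix. -/
def complexMat (M : Matrix (Fin 3) (Fin 3) ℍ[ℝ]) : Matrix (Fin 3 ⊕ Fin 3) (Fin 3 ⊕ Fin 3) ℂ :=
  Matrix.fromBlocks (M.map fun q => ⟨q.re, q.imI⟩)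
    (-((M.map fun q => (⟨q.imJ, -q.imK⟩ : ℂ)).map star)) (M.map fun q => ⟨q.imJ, -q.imK⟩)
    ((M.map fun q => (⟨q.re, q.imI⟩ : ℂ)).map star)

theorem complexify_eq (A : Sp21) : complexify A = complexMat (mat A) := rfl

theorem complexMat_mul (M N : Matrix (Fin 3) (Fin 3) ℍ[ℝ]) :
    complexMat (M * N) = complexMat M * complexMat N := by
  refine Matrix.ext fun i j => ?_
  rcases i with i | i <;> rcases j with j | j <;>
    apply Complex.ext <;>
    simp [complexMat, Matrix.mul_apply, Fin.sum_univ_three] <;> ring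

theorem complexMat_one : complexMat 1 = 1 := by
  refine Matrix.ext fun i j => ?_
  rcases i with i | i <;> rcases j with j | j <;> by_cases h : i = j <;>
    apply Complex.ext <;> simp [complexMat, h, Matrix.one_apply]

theorem charpoly_complexify_eq {A Q : Sp21} {M : Matrix (Fin 3) (Fin 3) ℍ[ℝ]}
    (h : mat A * mat Q = mat Q * M) : (complexify A).charpoly = (complexMat M).charpoly := by
  let U : (Matrix (Fin 3 ⊕ Fin 3) (Fin 3 ⊕ Fin 3) ℂ)ˣ :=
    ⟨complexMat (mat Q), complexMat (mat Q⁻¹), by rw [← complexMat_mul, mat_mul_inv, complexMat_one],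
      by rw [← complexMat_mul, mat_inv_mul, complexMat_one]⟩
  have h1 : complexify A = U.val * complexMat M * U⁻¹.val := by
    change _ = complexMat (mat Q) * complexMat M * complexMat (mat Q⁻¹)
    rw [← complexMat_mul, ← complexMat_mul, ← h, mul_assoc, mat_mul_inv, mul_one, complexify_eq]
  rw [h1]
  simp

theorem realTrace_conj (h A : Sp21) : realTrace (h * A * h⁻¹) = realTrace A := by
  have : (complexify (h * A * h⁻¹)).charpoly = (complexify A).charpoly := by
    rw [complexify_eq A]
    refine charpoly_complexify_eq (Q := h) ?_
    rw [← mat_mul, ← mat_mul]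
    congr 1
    group
  rw [realTrace, realTrace, this]

open Polynomial in
theorem charpoly_complexMat_diagonal (d : Fin 3 → ℂ) :
    (complexMat (Matrix.diagonal fun i => (d i : ℍ[ℝ]))).charpoly =
      (∏ i, (X - C (d i))) * ∏ i, (X - C (starRingEnd ℂ (d i))) := by
  have : complexMat (Matrix.diagonal fun i => (d i : ℍ[ℝ])) =
      Matrix.fromBlocks (Matrix.diagonal d) 0 0 (Matrix.diagonal fun i => starRingEnd ℂ (d i)) := by
    refine Matrix.ext fun i j => ?_
    rcases i with i | i <;> rcases j with j | j <;> by_cases h : i = j <;>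
      apply Complex.ext <;> simp [complexMat, h]
  rw [this, Matrix.charpoly_fromBlocks_zero₂₁, Matrix.charpoly_diagonal, Matrix.charpoly_diagonal]

open Polynomial in
/-- The real polynomial with given real trace. -/
def tracePoly (t : ℝ × ℝ × ℝ) : ℂ[X] :=
  X ^ 6 - C (t.1 : ℂ) * X ^ 5 + C (t.2.1 : ℂ) * X ^ 4 - C (t.2.2 : ℂ) * X ^ 3 +
    C (t.2.1 : ℂ) * X ^ 2 - C (t.1 : ℂ) * X + C 1

open Polynomial in
theorem realTrace_of_charpoly {A : Sp21} {t : ℝ × ℝ × ℝ}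
    (h : (complexify A).charpoly = tracePoly t) : realTrace A = t := by
  have h5 : (tracePoly t).coeff 5 = -(t.1 : ℂ) := by
    simp [tracePoly, coeff_X_pow, coeff_one]
  have h4 : (tracePoly t).coeff 4 = (t.2.1 : ℂ) := by
    simp [tracePoly, coeff_X_pow, coeff_one]
  have h3 : (tracePoly t).coeff 3 = -(t.2.2 : ℂ) := by
    simp [tracePoly, coeff_X_pow, coeff_one]
  simp [realTrace, h, h3, h4, h5]

open Polynomial in
theorem quadratic_factor (l : ℂ) : (X - C l) * (X - C (starRingEnd ℂ l)) =
    X ^ 2 - C ((2 * l.re : ℝ) : ℂ) * X + C ((Complex.normSq l : ℝ) : ℂ) := by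
  rw [← Complex.mul_conj, ← Complex.add_conj, map_add, map_mul]
  ring

open Polynomial in
-- `realTrace` keeps only the real parts of three coefficients, so recovering the characteristic
-- polynomial requires its real palindromic shape. It is the product of X² − t₀X + r², X² − t₁X + 1
-- and X² − t₀mX + m, and r²m = 1 makes this palindromic.
theorem exists_tracePoly {r θ φ : ℝ} (h : IsLoxParam r θ φ) :
    ∃ t, (∏ i, (X - C (eig r θ φ i))) * ∏ i, (X - C (starRingEnd ℂ (eig r θ φ i))) =
      tracePoly t := by
  have hr : r ≠ 0 := h.1.1.ne'
  obtain ⟨m, hm⟩ : ∃ m : ℝ, m = (r ^ 2)⁻¹ := ⟨_, rfl⟩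
  have hnm : r ^ 2 * m = 1 := by rw [hm]; exact mul_inv_cancel₀ (pow_ne_zero 2 hr)
  have n0 : Complex.normSq (eig r θ φ 0) = r ^ 2 := by
    rw [Complex.normSq_eq_norm_sq, norm_eig h]; rfl
  have n1 : Complex.normSq (eig r θ φ 1) = 1 := by
    rw [Complex.normSq_eq_norm_sq, norm_eig h]; simp
  have n2 : Complex.normSq (eig r θ φ 2) = m := by
    rw [Complex.normSq_eq_norm_sq, norm_eig h, hm]; simp
  have t2 : 2 * (eig r θ φ 2).re = 2 * (eig r θ φ 0).re * m := by
    have : eig r θ φ 2 = (m : ℂ) * eig r θ φ 0 := by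
      have : (r : ℂ) ≠ 0 := by exact_mod_cast hr
      simp [eig, hm]; field_simp
    rw [this, Complex.re_ofReal_mul]; ring
  set t0 := 2 * (eig r θ φ 0).re with ht0
  set t1 := 2 * (eig r θ φ 1).re with ht1
  refine ⟨(t0 + t1 + t0 * m, t0 * t1 + t0 ^ 2 * m + t0 * t1 * m + r ^ 2 + 1 + m,
    t0 ^ 2 * t1 * m + t0 * (1 + m) + t1 * (r ^ 2 + m) + t0 * m * (r ^ 2 + 1)), ?_⟩
  have hnm' : (C (((r ^ 2 : ℝ) : ℂ)) : ℂ[X]) * C ((m : ℝ) : ℂ) = 1 := by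
    rw [← map_mul, ← Complex.ofReal_mul, hnm, Complex.ofReal_one, map_one]
  rw [← Finset.prod_mul_distrib, Fin.prod_univ_three, quadratic_factor, quadratic_factor,
    quadratic_factor, n0, n1, n2, t2, ← ht0, ← ht1]
  simp only [tracePoly, Complex.ofReal_add, Complex.ofReal_mul, Complex.ofReal_one, map_add,
    map_mul, map_one, Complex.ofReal_pow, map_pow] at hnm' ⊢
  linear_combination (1 - (C (t1 : ℂ) + C (t0 : ℂ)) * X + (1 + C (t0 : ℂ) * C (t1 : ℂ)) * X ^ 2) * hnm'

open Polynomial in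
-- The conjugate factors have their roots in the lower half plane, so they cannot account for an
-- eigenvalue in the upper one.
theorem eig_root {r θ φ r' θ' φ' : ℝ} (h : IsLoxParam r θ φ) (h' : IsLoxParam r' θ' φ')
    (hp : (∏ i, (X - C (eig r θ φ i))) * ∏ i, (X - C (starRingEnd ℂ (eig r θ φ i))) =
      (∏ i, (X - C (eig r' θ' φ' i))) * ∏ i, (X - C (starRingEnd ℂ (eig r' θ' φ' i)))) (i : Fin 3) :
    ∃ j, eig r θ φ i = eig r' θ' φ' j := by
  have h0 := congrArg (Polynomial.eval (eig r θ φ i)) hp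
  rw [eval_mul, eval_mul, eval_prod, eval_prod, eval_prod, eval_prod,
    Finset.prod_eq_zero (Finset.mem_univ i) (by simp), zero_mul, eq_comm, mul_eq_zero,
    Finset.prod_eq_zero_iff, Finset.prod_eq_zero_iff] at h0
  rcases h0 with ⟨j, -, hj⟩ | ⟨j, -, hj⟩
  · exact ⟨j, by simpa [sub_eq_zero] using hj⟩
  · exfalso
    have hj : eig r θ φ i = starRingEnd ℂ (eig r' θ' φ' j) := by simpa [sub_eq_zero] using hj
    have := congrArg Complex.im hj
    rw [Complex.conj_im] at this
    linarith [eig_im_pos h i, eig_im_pos h' j]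

/-- The real trace determines the eigenvalues. -/
theorem eig_eq_of_realTrace {A A' Q Q' : Sp21} {r θ φ r' θ' φ' : ℝ} (h : IsLoxParam r θ φ)
    (h' : IsLoxParam r' θ' φ') (hA : mat A * mat Q = mat Q * E r θ φ)
    (hA' : mat A' * mat Q' = mat Q' * E r' θ' φ') (ht : realTrace A = realTrace A') :
    eig r θ φ = eig r' θ' φ' := by
  have h1 := charpoly_complexify_eq hA
  have h1' := charpoly_complexify_eq hA'
  rw [E_eq_eig, charpoly_complexMat_diagonal] at h1 h1'
  obtain ⟨t, hT⟩ := exists_tracePoly h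
  obtain ⟨t', hT'⟩ := exists_tracePoly h'
  have htt : t = t' := by
    rw [← realTrace_of_charpoly (h1.trans hT), ← realTrace_of_charpoly (h1'.trans hT'), ht]
  have hp := hT.trans (htt ▸ hT'.symm)
  have hn := norm_eig h
  have hn' := norm_eig h'
  have hr1 : 1 < r'⁻¹ := (one_lt_inv₀ h'.1.1).2 h'.1.2
  -- The modulus pins the index: only the first eigenvalue has modulus below 1, and only the second
  -- has modulus 1.
  have e0 : eig r θ φ 0 = eig r' θ' φ' 0 := by
    obtain ⟨j, hj⟩ := eig_root h h' hp 0
    have h2 := hn 0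
    rw [hj, hn'] at h2
    have h3 := h.1.2
    fin_cases j
    · exact hj
    · simp at h2; linarith
    · simp at h2; linarith
  have hrr : r = r' := by
    have := hn 0
    rw [e0, hn'] at this
    exact this.symm
  have e1 : eig r θ φ 1 = eig r' θ' φ' 1 := by
    obtain ⟨j, hj⟩ := eig_root h h' hp 1
    have h2 := hn 1
    rw [hj, hn'] at h2
    have h3 := h'.1.2
    fin_cases j
    · simp at h2; linarith
    · exact hj
    · simp at h2; linarith
  have hr : (r : ℂ) ≠ 0 := by exact_mod_cast h.1.1.ne'
  have hc : ((θ : Real.Angle).toCircle : ℂ) = ((θ' : Real.Angle).toCircle : ℂ) := by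
    refine mul_left_cancel₀ hr ?_
    conv_rhs => rw [hrr]
    exact e0
  ext1 i
  fin_cases i
  · exact e0
  · exact e1
  · show (r : ℂ)⁻¹ * _ = (r' : ℂ)⁻¹ * _
    rw [hrr, hc]

/-! ### Uniqueness of twist-bends -/

theorem toCircle_injective : Function.Injective Real.Angle.toCircle := fun θ θ' h => by
  rw [← Real.Angle.arg_toCircle θ, h, Real.Angle.arg_toCircle]

theorem E_injective {s s' : ℝ} {ψ ξ ψ' ξ' : Real.Angle} (hs : 0 < s) (hs' : 0 < s')
    (h : E s ψ ξ = E s' ψ' ξ') : s = s' ∧ ψ = ψ' ∧ ξ = ξ' := by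
  rw [E_eq, E_eq] at h
  have h0 := coeComplex_injective (congrFun (Matrix.diagonal_injective h) 0)
  have h1 := coeComplex_injective (congrFun (Matrix.diagonal_injective h) 1)
  simp only [Matrix.cons_val] at h0 h1
  have hn := congrArg norm h0
  simp only [norm_mul, Circle.norm_coe, mul_one, Complex.norm_real, Real.norm_eq_abs,
    abs_of_pos hs, abs_of_pos hs'] at hn
  subst hn
  have hs0 : (s : ℂ) ≠ 0 := by exact_mod_cast hs.ne'
  exact ⟨rfl, toCircle_injective (Circle.ext (mul_left_cancel₀ hs0 h0)),
    toCircle_injective (Circle.ext h1)⟩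

theorem TwistBend.ext {κ κ' : TwistBend} (hs : κ.s = κ'.s) (hψ : κ.ψ = κ'.ψ) (hξ : κ.ξ = κ'.ξ) :
    κ = κ' := by
  cases κ; cases κ'; simp_all

/-- A twist-bend along a given loxodromic element and its parameters determine each other. -/
theorem IsTwist.eq_iff {A K K' : Sp21} {κ κ' : TwistBend} (h : IsTwist A κ K)
    (h' : IsTwist A κ' K') : K = K' ↔ κ = κ' := by
  obtain ⟨Q, r, θ, φ, hr, hθ, hφ, hA, hK⟩ := h
  obtain ⟨Q', r', θ', φ', hr', hθ', hφ', hA', hK'⟩ := h'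
  have hp : IsLoxParam r θ φ := ⟨hr, hθ, hφ⟩
  have he := eig_eq_of_realTrace hp ⟨hr', hθ', hφ'⟩ hA hA' rfl
  have hE : E r θ φ = E r' θ' φ' := by rw [E_eq_eig, E_eq_eig, he]
  rw [← hE] at hA'
  -- Two eigenframes of A differ by an element of the centralizer of E(r, θ, φ), hence by a complex
  -- diagonal matrix. This commutes with every E(s, ψ, ξ), so the parameters of a twist do not
  -- depend on the frame.
  have hN : E r θ φ * mat (Q⁻¹ * Q') = mat (Q⁻¹ * Q') * E r θ φ := by
    calc E r θ φ * mat (Q⁻¹ * Q') = mat Q⁻¹ * (mat Q * E r θ φ) * mat Q⁻¹ * mat Q' := by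
          rw [← mul_assoc, mat_inv_mul, one_mul, mul_assoc, mat_mul]
      _ = mat Q⁻¹ * (mat A * (mat Q * mat Q⁻¹) * mat Q') := by rw [← hA]; simp only [mul_assoc]
      _ = _ := by rw [mat_mul_inv, mul_one, hA', mat_mul, mul_assoc]
  obtain ⟨d, hd⟩ := commute_E hp hN
  have hQ' : mat Q' = mat Q * mat (Q⁻¹ * Q') := by rw [mat_mul, ← mul_assoc, mat_mul_inv, one_mul]
  have hK'' : mat K' * mat Q = mat Q * E κ'.s κ'.ψ κ'.ξ := by
    rw [hQ', mul_assoc, hd, E_eq, diagonal_complex_commute, ← E_eq, ← hd, ← mul_assoc, ← mul_assoc] at hK'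
    have := congrArg (· * mat (Q⁻¹ * Q')⁻¹) hK'
    simpa only [mul_assoc, mat_mul_inv, mul_one] using this
  constructor
  · rintro rfl
    rw [hK] at hK''
    have : E κ.s κ.ψ κ.ξ = E κ'.s κ'.ψ κ'.ξ := by
      have := congrArg (mat Q⁻¹ * ·) hK''
      simpa only [← mul_assoc, mat_inv_mul, one_mul] using this
    obtain ⟨h1, h2, h3⟩ := E_injective κ.s_pos κ'.s_pos this
    exact TwistBend.ext h1 h2 h3
  · rintro rfl
    apply mat_injective
    have := congrArg (· * mat Q⁻¹) (hK.trans hK''.symm)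
    simpa only [mul_assoc, mat_mul_inv, mul_one] using this

/-- Elements commuting with a loxodromic element are twist-bends. -/
theorem IsLoxodromic.exists_isTwist {A K : Sp21} (hA : IsLoxodromic A) (h : A * K = K * A) :
    ∃ κ, IsTwist A κ K := by
  obtain ⟨Q, r, θ, φ, hp, hQ⟩ := hA.exists_normal_form
  have hE : E r θ φ = mat (Q⁻¹ * A * Q) := by
    rw [mat_mul, mat_mul, mul_assoc, hQ, ← mul_assoc, mat_inv_mul, one_mul]
  obtain ⟨d, hd⟩ := commute_E hp (M := mat (Q⁻¹ * K * Q)) (by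
    rw [hE, ← mat_mul, ← mat_mul]
    congr 1
    calc Q⁻¹ * A * Q * (Q⁻¹ * K * Q) = Q⁻¹ * (A * K) * Q := by group
      _ = _ := by rw [h]; group)
  obtain ⟨κ, hκ⟩ := exists_E_of_diagonal hd
  refine ⟨κ, Q, r, θ, φ, hp.1, hp.2.1, hp.2.2, hQ, ?_⟩
  rw [← hκ, ← mat_mul, ← mat_mul]
  congr 1
  group

/-! ### Signs -/

/-- The central element `-1`. -/
def negOne : Sp21 := mkSp (-1) (by simp)

@[simp] theorem mat_negOne : mat negOne = -1 := rfl

open Classical in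
/-- The sign `e^{iε}` for `ε ∈ {0, π}`. -/
def sgn (ε : Real.Angle) : Sp21 := if ε = 0 then 1 else negOne

theorem sgn_cases (ε : Real.Angle) : mat (sgn ε) = 1 ∨ mat (sgn ε) = -1 := by
  unfold sgn; split_ifs
  · left; rfl
  · right; rfl

theorem sgn_comm (ε : Real.Angle) (K : Sp21) : sgn ε * K = K * sgn ε := by
  apply mat_injective
  rw [mat_mul, mat_mul]
  rcases sgn_cases ε with h | h <;> rw [h] <;> simp

theorem sgn_mul_self (ε : Real.Angle) : sgn ε * sgn ε = 1 := by
  apply mat_injective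
  rw [mat_mul]
  rcases sgn_cases ε with h | h <;> rw [h] <;> simp

theorem E_add {ε : Real.Angle} (hε : ε = 0 ∨ ε = (Real.pi : Real.Angle)) (s : ℝ)
    (ψ ξ : Real.Angle) : E s (ψ + ε) (ξ + ε) = mat (sgn ε) * E s ψ ξ := by
  rcases hε with rfl | rfl
  · simp [sgn]
  · rw [sgn, if_neg Real.Angle.pi_ne_zero, mat_negOne, neg_one_mul, E_eq, E_eq, Matrix.diagonal_neg]
    have hn : ∀ z : ℂ, ((-z : ℂ) : ℍ[ℝ]) = -(z : ℍ[ℝ]) := fun z => by ext <;> simp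
    congr 1
    ext1 i
    rw [← hn]
    congr 1
    fin_cases i <;> simp [Real.Angle.toCircle_add]

/-- The effect of a sign on the parameters of a twist-bend. -/
def TwistBend.shift (κ : TwistBend) (ε : Real.Angle) : TwistBend :=
  ⟨κ.s, κ.s_pos, κ.ψ + ε, κ.ξ + ε⟩

theorem IsTwist.shift {A K : Sp21} {κ : TwistBend} (h : IsTwist A κ K) {ε : Real.Angle}
    (hε : ε = 0 ∨ ε = (Real.pi : Real.Angle)) : IsTwist A (κ.shift ε) (sgn ε * K) := by
  obtain ⟨Q, r, θ, φ, hr, hθ, hφ, hA, hK⟩ := h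
  refine ⟨Q, r, θ, φ, hr, hθ, hφ, hA, ?_⟩
  show _ = mat Q * E κ.s (κ.ψ + ε) (κ.ξ + ε)
  rw [E_add hε, mat_mul, mul_assoc, hK, ← mul_assoc, ← mul_assoc, ← mat_mul, ← mat_mul, sgn_comm]

end

section

/-! ### Irreducible pairs -/

theorem eq_mk_of_mem_submodule {p : HP2} {z : V} (hz : z ∈ p.submodule) (hz0 : z ≠ 0) :
    p = Projectivization.mk ℍ[ℝ]ᵐᵒᵖ z hz0 := by
  induction p using Projectivization.ind with
  | h v hv =>
    rw [mem_submodule_mk] at hz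
    rw [eq_comm, mk_eq_mk_iff_rsmul]
    exact hz

theorem act_mem_hypPlane (A : Sp21) {p : HP2} (hp : p ∈ hypPlane) : act A p ∈ hypPlane := by
  induction p using Projectivization.ind with
  | h v hv =>
    rw [act_mk, mk_mem_hypPlane, herm_mat]
    exact (mk_mem_hypPlane hv).1 hp

/-- The fixed points of an isometry form a totally geodesic subspace. -/
theorem isTotallyGeodesic_fixed (T : Sp21) (hne : ∃ p ∈ hypPlane, act T p = p) :
    IsTotallyGeodesic {p | p ∈ hypPlane ∧ act T p = p} := by
  refine ⟨hne, fun p hp => hp.1, ?_⟩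
  rintro p ⟨hp, hTp⟩ q ⟨hq, hTq⟩ r hr ⟨z, hz, w, hw, hz0, hw0, him, a, b, hab, hmem⟩
  refine ⟨hr, ?_⟩
  obtain rfl := eq_mk_of_mem_submodule hz hz0
  obtain rfl := eq_mk_of_mem_submodule hw hw0
  obtain rfl := eq_mk_of_mem_submodule hmem hab
  rw [mk_mem_hypPlane] at hp hq
  rw [act_mk_eq_iff] at hTp hTq ⊢
  obtain ⟨l, hl⟩ := hTp
  obtain ⟨m, hm⟩ := hTq
  have h0 := herm_ne_zero_of_neg hp hq
  obtain ⟨c, hc⟩ : ∃ c : ℝ, herm z w = (c : ℍ[ℝ]) := ⟨_, by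
    rw [← Quaternion.re_add_im (herm z w), him, add_zero]⟩
  -- The product ⟨z,w⟩ is real and nonzero, hence can be moved past the multipliers and cancelled.
  -- Together with |m| = 1 this gives l = m, so real combinations of z and w are multiplied on the
  -- right by the same scalar.
  have hml : star m * l = 1 := by
    have h1 := herm_mat T z w
    rw [hl, hm, herm_rsmul_left, herm_rsmul_right, hc, mul_assoc, Quaternion.coe_commutes,
      ← mul_assoc] at h1
    rw [hc] at h0
    exact mul_right_cancel₀ h0 (by rw [h1, one_mul])
  have hmm : star m * m = 1 := by
    have h1 := herm_mat T w w
    rw [hm, herm_rsmul_left, herm_rsmul_right, herm_self_real, mul_assoc, Quaternion.coe_commutes,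
      ← mul_assoc] at h1
    have h2 : (((herm w w).re : ℝ) : ℍ[ℝ]) ≠ 0 := by
      intro h
      exact hq.ne (by simpa using congrArg (fun q : ℍ[ℝ] => q.re) h)
    exact mul_right_cancel₀ h2 (by rw [h1, one_mul])
  have hlm : l = m := by
    have hm0 : star m ≠ 0 := by intro h; simp [h] at hmm
    exact mul_left_cancel₀ hm0 (hml.trans hmm.symm)
  refine ⟨m, ?_⟩
  rw [Matrix.mulVec_add, real_smul_eq, real_smul_eq, mulVec_rsmul, mulVec_rsmul, hl, hm, hlm,
    smul_add, rsmul_rsmul, rsmul_rsmul, rsmul_rsmul, rsmul_rsmul, Quaternion.coe_commutes,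
    Quaternion.coe_commutes]

/-- An isometry that fixes all points of the hyperbolic plane is `±1`. -/
theorem eq_one_or_neg_one_of_fixes {T : Sp21}
    (h : ∀ v : V, (herm v v).re < 0 → ∃ q : ℍ[ℝ], mat T *ᵥ v = v <• q) :
    mat T = 1 ∨ mat T = -1 := by
  obtain ⟨u, hu⟩ : ∃ u : V, u = ![1, 0, -1] := ⟨_, rfl⟩
  obtain ⟨l, hl⟩ := h u (by rw [hu]; simp [herm])
  -- Both u + w and u + w/2 are negative, hence eigenvectors. Their multipliers m, n give two
  -- expressions for Tw; independence of u and w forces m = n and m − l = 2(n − l), so m = l.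
  have key : ∀ w : V, (herm (u + w) (u + w)).re < 0 →
      (herm (u + (1 / 2 : ℝ) • w) (u + (1 / 2 : ℝ) • w)).re < 0 →
      (∀ a b : ℍ[ℝ], u <• a + w <• b = 0 → a = 0 ∧ b = 0) → mat T *ᵥ w = w <• l := by
    intro w h1 h2 hind
    obtain ⟨m, hm⟩ := h _ h1
    obtain ⟨n, hn⟩ := h _ h2
    rw [Matrix.mulVec_add, hl] at hm hn
    rw [Matrix.mulVec_smul] at hn
    have e1 : mat T *ᵥ w = u <• (m - l) + w <• m := by
      rw [eq_sub_of_add_eq' hm]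
      ext1 i; simp [mul_sub]; abel
    have e2 : mat T *ᵥ w = u <• (2 * (n - l)) + w <• n := by
      ext1 i
      have := congrFun hn i
      simp only [Pi.add_apply, Pi.smul_apply, op_smul_eq_mul, add_mul] at this ⊢
      have h3 : (mat T *ᵥ w) i = (2 : ℝ) • ((1 / 2 : ℝ) • (mat T *ᵥ w) i) := by
        rw [smul_smul]; norm_num
      rw [h3, eq_sub_of_add_eq' this, two_mul, mul_add, two_smul]
      have h4 : w i * n = (1 / 2 : ℝ) • w i * n + (1 / 2 : ℝ) • w i * n := by
        rw [← add_mul, ← add_smul]; norm_num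
      rw [h4, mul_sub]
      abel
    obtain ⟨h3, h4⟩ := hind (m - l - 2 * (n - l)) (m - n) (by
      have := e1.symm.trans e2
      ext1 i
      have := congrFun this i
      simp only [Pi.add_apply, rsmul_apply, Pi.zero_apply] at this ⊢
      rw [mul_sub, mul_sub (w i)]
      rw [sub_add_sub_comm, this, sub_self])
    have hmn := sub_eq_zero.1 h4
    subst hmn
    have : m - l = 0 := by
      have : m - l - 2 * (m - l) = -(m - l) := by rw [two_mul]; abel
      rw [this] at h3
      exact neg_eq_zero.1 h3
    rw [e1, this, rsmul_zero, zero_add, sub_eq_zero.1 this]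
  have h1 : ∀ q : ℍ[ℝ], ‖q‖ = 1 → mat T *ᵥ ![0, q, 0] = ![0, q, 0] <• l := by
    intro q hq
    have hq' : Quaternion.normSq q = 1 := by rw [Quaternion.normSq_eq_norm_mul_self, hq, one_mul]
    have hq0 : q ≠ 0 := by rintro rfl; simp at hq
    have hs : (star q * q).re = 1 := by rw [Quaternion.star_mul_self, hq']; rfl
    refine key _ ?_ ?_ ?_
    · have : herm (u + ![0, q, 0]) (u + ![0, q, 0]) = -1 + star q * q + -1 := by
        rw [hu]; simp [herm]
      rw [this]
      simp only [Quaternion.re_add, hs]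
      norm_num
    · have : herm (u + (1 / 2 : ℝ) • ![0, q, 0]) (u + (1 / 2 : ℝ) • ![0, q, 0]) =
          -1 + (1 / 4 : ℝ) • (star q * q) + -1 := by
        rw [hu]; simp [herm, smul_smul]; norm_num
      rw [this]
      simp only [Quaternion.re_add, Quaternion.re_smul, hs]
      norm_num
    · intro a b hab
      have h0 := congrFun hab 0
      have h1 := congrFun hab 1
      simp [hu] at h0 h1
      exact ⟨h0, by simpa [hq0] using h1⟩
  have h0 : mat T *ᵥ ![1, 0, 0] = ![1, 0, 0] <• l := by
    refine key _ ?_ ?_ ?_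
    · rw [hu]; simp [herm]
    · rw [hu]; simp [herm]; norm_num
    · intro a b hab
      have h0 := congrFun hab 0
      have h2 := congrFun hab 2
      simp [hu] at h0 h2
      simp [h2] at h0
      exact ⟨h2, h0⟩
  -- The vectors (0, q, 0) with |q| = 1 span a single line and all have the multiplier l; so l
  -- commutes with all unit quaternions and is real.
  have hcomm : ∀ q : ℍ[ℝ], ‖q‖ = 1 → q * l = l * q := by
    intro q hq
    have e1 := h1 q hq
    have e2 := h1 1 norm_one
    have e3 : (![0, q, 0] : V) = ![0, 1, 0] <• q := by
      ext1 i; fin_cases i <;> simp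
    rw [e3, mulVec_rsmul, e2, rsmul_rsmul, rsmul_rsmul] at e1
    exact (rsmul_injective (by intro h; simpa using congrFun h 1) e1).symm
  obtain ⟨i, i0, i1, i2, i3⟩ := exists_quaternion 0 1 0 0
  obtain ⟨j, j0, j1, j2, j3⟩ := exists_quaternion 0 0 1 0
  have hn : ∀ q : ℍ[ℝ], Quaternion.normSq q = 1 → ‖q‖ = 1 := fun q hq => by
    rw [Quaternion.normSq_eq_norm_mul_self] at hq
    nlinarith [norm_nonneg q]
  have hi := hcomm i (hn i (by rw [Quaternion.normSq_def', i0, i1, i2, i3]; norm_num))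
  have hj := hcomm j (hn j (by rw [Quaternion.normSq_def', j0, j1, j2, j3]; norm_num))
  have hlr : l = (l.re : ℍ[ℝ]) := by
    have a1 := congrArg (fun q : ℍ[ℝ] => q.imJ) hi
    have a2 := congrArg (fun q : ℍ[ℝ] => q.imK) hi
    have a3 := congrArg (fun q : ℍ[ℝ] => q.imK) hj
    simp [i0, i1, i2, i3, j0, j1, j2, j3] at a1 a2 a3
    ext <;> simp <;> linarith
  have hT : mat T = ((l.re : ℝ) : ℍ[ℝ]) • (1 : Matrix (Fin 3) (Fin 3) ℍ[ℝ]) := by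
    have hc : ∀ v : V, mat T *ᵥ v = v <• l := by
      intro v
      have hv : v = ![1, 0, 0] <• (v 0 + v 2) + ![0, 1, 0] <• v 1 - u <• v 2 := by
        ext1 i; fin_cases i <;> simp [hu]
      have hlc : ∀ q : ℍ[ℝ], l * q = q * l := fun q => by rw [hlr]; exact Quaternion.coe_commutes _ _
      conv_lhs => rw [hv]
      rw [Matrix.mulVec_sub, Matrix.mulVec_add, mulVec_rsmul, mulVec_rsmul, mulVec_rsmul, h0,
        h1 1 norm_one, hl, rsmul_rsmul, rsmul_rsmul, rsmul_rsmul, hlc, hlc, hlc]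
      conv_rhs => rw [hv]
      rw [smul_sub, smul_add, rsmul_rsmul, rsmul_rsmul, rsmul_rsmul]
    refine Matrix.ext fun a b => ?_
    have := congrFun (hc (Pi.single b 1)) a
    rw [Matrix.mulVec_single_one] at this
    rw [← hlr, Matrix.smul_apply]
    by_cases hab : a = b
    · subst hab; simpa using this
    · simpa [hab, Pi.single_apply] using this
  have hl2 : l.re * l.re = 1 := by
    have e := congrArg (fun q : ℍ[ℝ] => q.re) (herm_mat T u u)
    rw [hl] at e
    have e' : herm u u = ((-2 : ℝ) : ℍ[ℝ]) := by
      rw [hu]; ext <;> simp [herm]; norm_num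
    rw [herm_rsmul_left, herm_rsmul_right, e', hlr] at e
    simp at e
    nlinarith
  rcases mul_self_eq_one_iff.1 hl2 with h | h
  · left; rw [hT, h]; simp
  · right; rw [hT, h]; simp

theorem IsIrreducible.no_common_null {A B : Sp21} (h : IsIrreducible A B) {v : V} (hv : v ≠ 0)
    (hvv : herm v v = 0) (hA : ∃ q : ℍ[ℝ], mat A *ᵥ v = v <• q)
    (hB : ∃ q : ℍ[ℝ], mat B *ᵥ v = v <• q) : False :=
  h.1 ⟨_, Or.inr ((mk_mem_idealBoundary hv).2 hvv), (act_mk_eq_iff A hv).2 hA,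
    (act_mk_eq_iff B hv).2 hB⟩

/-! ### Frames of columns and the centralizer of an irreducible pair -/

/-- The columns of an element of `Sp(2,1)`. -/
def col (Q : Sp21) (i : Fin 3) : V := mat Q *ᵥ Pi.single i 1

theorem col_ne_zero (Q : Sp21) (i : Fin 3) : col Q i ≠ 0 :=
  mat_mulVec_ne_zero Q (by intro h; simpa using congrFun h i)

theorem herm_col (Q : Sp21) (i j : Fin 3) : herm (col Q i) (col Q j) = H₁ j i := by
  rw [col, col, herm_mat]
  fin_cases i <;> fin_cases j <;> simp [herm, H₁]

theorem mulVec_col {A Q : Sp21} {d : Fin 3 → ℍ[ℝ]} (h : mat A * mat Q = mat Q * Matrix.diagonal d)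
    (i : Fin 3) : mat A *ᵥ col Q i = col Q i <• d i := by
  rw [col, Matrix.mulVec_mulVec, h, ← Matrix.mulVec_mulVec, ← mulVec_rsmul]
  congr 1
  ext1 j
  rw [Matrix.mulVec_diagonal]
  by_cases hj : j = i
  · subst hj; simp
  · simp [hj]

theorem expand_col (Q : Sp21) (v : V) :
    v = col Q 0 <• (mat Q⁻¹ *ᵥ v) 0 + col Q 1 <• (mat Q⁻¹ *ᵥ v) 1 + col Q 2 <• (mat Q⁻¹ *ᵥ v) 2 := by
  conv_lhs => rw [← mat_mulVec_inv Q v]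
  rw [col, col, col, ← mulVec_rsmul, ← mulVec_rsmul, ← mulVec_rsmul, ← Matrix.mulVec_add,
    ← Matrix.mulVec_add]
  congr 1
  ext1 i
  fin_cases i <;> simp

/-- Eigenvectors in a frame of eigenvectors. -/
theorem eigenvector_coords {A Q : Sp21} {d : Fin 3 → ℍ[ℝ]}
    (h : mat A * mat Q = mat Q * Matrix.diagonal d) {v : V} {q : ℍ[ℝ]} (hv : mat A *ᵥ v = v <• q)
    (i : Fin 3) : d i * (mat Q⁻¹ *ᵥ v) i = (mat Q⁻¹ *ᵥ v) i * q := by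
  have h1 : mat Q⁻¹ * mat A = Matrix.diagonal d * mat Q⁻¹ := by
    calc mat Q⁻¹ * mat A = mat Q⁻¹ * (mat A * mat Q) * mat Q⁻¹ := by
          rw [mul_assoc, mul_assoc, mat_mul_inv, mul_one]
      _ = _ := by rw [h, ← mul_assoc, mat_inv_mul, one_mul]
  have h2 := congrArg (fun w => mat Q⁻¹ *ᵥ w) hv
  simp only [Matrix.mulVec_mulVec, h1, mulVec_rsmul] at h2
  have := congrFun h2 i
  rw [← Matrix.mulVec_mulVec, Matrix.mulVec_diagonal] at this
  exact this

/-- The centralizer of an irreducible pair of isometries, one of them loxodromic, is `±1`. -/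
theorem IsIrreducible.centralizer {A B T : Sp21} (hirr : IsIrreducible A B) (hA : IsLoxodromic A)
    (hTA : A * T = T * A) (hTB : B * T = T * B) : mat T = 1 ∨ mat T = -1 := by
  obtain ⟨κ, Q, r, θ, φ, hr, hθ, hφ, hQ, hK⟩ := hA.exists_isTwist hTA
  rw [E] at hK hQ
  have hc0 := mulVec_col hK 0
  have hc2 := mulVec_col hK 2
  simp only [Matrix.cons_val] at hc0 hc2
  by_cases hs : κ.s = 1
  -- For s = 1, T fixes a point on the axis of A. Its fixed set in the plane is totally geodesic and
  -- preserved by A and B, so it is the whole plane.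
  · have hfix : ∃ p ∈ hypPlane, act T p = p := by
      have hneg : (herm (col Q 0 - col Q 2) (col Q 0 - col Q 2)).re < 0 := by
        rw [herm_sub_left, herm_sub_right, herm_sub_right]
        simp only [herm_col]
        simp [H₁]
      have h0 : col Q 0 - col Q 2 ≠ 0 := by intro h; rw [h] at hneg; simp at hneg
      refine ⟨Projectivization.mk _ _ h0, (mk_mem_hypPlane h0).2 hneg, (act_mk_eq_iff T h0).2
        ⟨((κ.ψ.toCircle : ℂ) : ℍ[ℝ]), ?_⟩⟩
      rw [Matrix.mulVec_sub, hc0, hc2, hs]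
      simp [smul_sub]
    have hpres : ∀ X : Sp21, X * T = T * X → Set.MapsTo (act X) {p | p ∈ hypPlane ∧ act T p = p}
        {p | p ∈ hypPlane ∧ act T p = p} := by
      rintro X hX p ⟨hp, hTp⟩
      refine ⟨act_mem_hypPlane X hp, ?_⟩
      rw [← act_mul, ← hX, act_mul, hTp]
    have hS : {p | p ∈ hypPlane ∧ act T p = p} = hypPlane := by
      by_contra hne
      exact hirr.2 ⟨_, isTotallyGeodesic_fixed T hfix, hne, hpres A hTA, hpres B hTB⟩
    refine eq_one_or_neg_one_of_fixes fun v hv => ?_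
    have hv0 : v ≠ 0 := by rintro rfl; simp at hv
    have hmem : Projectivization.mk ℍ[ℝ]ᵐᵒᵖ v hv0 ∈ hypPlane := (mk_mem_hypPlane hv0).2 hv
    rw [← hS] at hmem
    exact (act_mk_eq_iff T hv0).1 hmem.2
  -- For s ≠ 1 the moduli s, 1, 1/s differ, so the vectors with eigenvalue of modulus s form the
  -- line of the first column. B commutes with T and preserves this null line, as does A.
  · exfalso
    refine hirr.no_common_null (col_ne_zero Q 0) (by rw [herm_col]; simp [H₁])
      ⟨_, mulVec_col hQ 0⟩ ⟨(mat Q⁻¹ *ᵥ (mat B *ᵥ col Q 0)) 0, ?_⟩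
    have hs0 := κ.s_pos
    have hB : mat T *ᵥ (mat B *ᵥ col Q 0) =
        (mat B *ᵥ col Q 0) <• ((((κ.s : ℂ) * (κ.ψ.toCircle : ℂ)) : ℂ) : ℍ[ℝ]) := by
      rw [Matrix.mulVec_mulVec, ← mat_mul, ← hTB, mat_mul, ← Matrix.mulVec_mulVec, hc0, mulVec_rsmul]
    have e1 := eigenvector_coords hK hB 1
    have e2 := eigenvector_coords hK hB 2
    have z1 : (mat Q⁻¹ *ᵥ (mat B *ᵥ col Q 0)) 1 = 0 := by
      refine eq_zero_of_mul_eq_mul_of_norm_ne ?_ e1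
      simp only [Matrix.cons_val, norm_coeComplex, norm_mul, Circle.norm_coe, Complex.norm_real,
        Real.norm_eq_abs, abs_of_pos hs0, mul_one]
      exact fun h => hs h.symm
    have z2 : (mat Q⁻¹ *ᵥ (mat B *ᵥ col Q 0)) 2 = 0 := by
      refine eq_zero_of_mul_eq_mul_of_norm_ne ?_ e2
      simp only [Matrix.cons_val, norm_coeComplex, norm_mul, Circle.norm_coe, Complex.norm_real,
        Real.norm_eq_abs, abs_of_pos hs0, abs_of_pos (inv_pos.2 hs0), mul_one]
      intro h
      apply hs
      field_simp at h
      nlinarith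
    conv_lhs => rw [expand_col Q (mat B *ᵥ col Q 0)]
    rw [z1, z2, rsmul_zero, rsmul_zero, add_zero, add_zero]

end

section

/-! ### Simultaneous similarity of quaternions -/

theorem re_mul_comm (a b : ℍ[ℝ]) : (a * b).re = (b * a).re := by
  simp; ring

theorem re_conj_unit {v : ℍ[ℝ]} (hv : star v * v = 1) (a : ℍ[ℝ]) : (v * a * star v).re = a.re := by
  rw [re_mul_comm, ← mul_assoc, hv, one_mul]

theorem normSq_conj_unit {v : ℍ[ℝ]} (hv : star v * v = 1) (a : ℍ[ℝ]) :
    Quaternion.normSq (v * a * star v) = Quaternion.normSq a := by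
  have : Quaternion.normSq v = 1 := by
    rw [Quaternion.normSq_eq_norm_mul_self, norm_of_star_mul_self hv, one_mul]
  rw [map_mul, map_mul, Quaternion.normSq_star, this, one_mul, mul_one]

theorem eq_conj_unit {v p p' : ℍ[ℝ]} (hv : v * star v = 1) (h : v * p = p' * v) :
    v * p * star v = p' := by
  rw [h, mul_assoc, hv, mul_one]

theorem mul_eq_of_conj_unit {v p p' : ℍ[ℝ]} (hv : star v * v = 1) (h : v * p * star v = p') :
    v * p = p' * v := by
  rw [← h, mul_assoc, hv, mul_one]

theorem anticommute_of_orthogonal {p x : ℍ[ℝ]} (hp : p.re = 0) (hx : x.re = 0)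
    (h : (star p * x).re = 0) : p * x = -(x * p) := by
  simp [hp, hx] at h
  ext <;> simp [hp, hx] <;> linarith

theorem normSq_sub_smul (q p : ℍ[ℝ]) (s : ℝ) : Quaternion.normSq (q - s • p) =
    Quaternion.normSq q - 2 * s * (star p * q).re + s ^ 2 * Quaternion.normSq p := by
  simp only [Quaternion.normSq_def']; simp; ring

/-- A rotation about the axis `p` that moves `q` to `q'`. -/
theorem exists_conj_fixing {p q q' : ℍ[ℝ]} (hp0 : p ≠ 0) (hp : p.re = 0) (hq : q.re = 0)
    (hq' : q'.re = 0) (hd : (star p * q).re = (star p * q').re)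
    (hn : Quaternion.normSq q = Quaternion.normSq q') :
    ∃ v : ℍ[ℝ], v ≠ 0 ∧ v * p = p * v ∧ v * q = q' * v := by
  -- The multiple s p is the common component of q and q' along p; the remainders x, x' are
  -- orthogonal to p, hence anticommute with it.
  obtain ⟨s, hs⟩ : ∃ s, s = (star p * q).re / Quaternion.normSq p := ⟨_, rfl⟩
  have hnp : Quaternion.normSq p ≠ 0 := by simpa using hp0
  obtain ⟨x, hx⟩ : ∃ x, x = q - s • p := ⟨_, rfl⟩
  obtain ⟨x', hx'⟩ : ∃ x', x' = q' - s • p := ⟨_, rfl⟩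
  have hx0 : x.re = 0 := by rw [hx]; simp [hp, hq]
  have hx0' : x'.re = 0 := by rw [hx']; simp [hp, hq']
  have hpp : (star p * p).re = Quaternion.normSq p := by rw [Quaternion.star_mul_self]; rfl
  have hpx : p * x = -(x * p) := by
    refine anticommute_of_orthogonal hp hx0 ?_
    rw [hx, mul_sub, mul_smul_comm, Quaternion.re_sub, Quaternion.re_smul, hpp, hs, smul_eq_mul]
    field_simp; ring
  have hpx' : p * x' = -(x' * p) := by
    refine anticommute_of_orthogonal hp hx0' ?_
    rw [hx', mul_sub, mul_smul_comm, Quaternion.re_sub, Quaternion.re_smul, hpp, hs, smul_eq_mul, hd]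
    field_simp; ring
  have hnx : Quaternion.normSq x = Quaternion.normSq x' := by
    rw [hx, hx', normSq_sub_smul, normSq_sub_smul, hn, hd]
  have hqx : q = x + s • p := by rw [hx]; abel
  have hqx' : q' = x' + s • p := by rw [hx']; abel
  suffices h : ∃ v : ℍ[ℝ], v ≠ 0 ∧ v * p = p * v ∧ v * x = x' * v by
    obtain ⟨v, hv, hvp, hvx⟩ := h
    refine ⟨v, hv, hvp, ?_⟩
    rw [hqx, hqx', mul_add, add_mul, hvx, mul_smul_comm, hvp, smul_mul_assoc]
  by_cases hxx : x' = -x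
  · exact ⟨p, hp0, rfl, by rw [hpx, hxx, neg_mul]⟩
  -- The usual intertwiner of x and x'; it commutes with p because p anticommutes with both factors
  -- of x'x. It vanishes only if x' = −x, where p itself serves.
  refine ⟨((Quaternion.normSq x : ℝ) : ℍ[ℝ]) - x' * x, ?_, ?_, ?_⟩
  · intro h1
    apply hxx
    rw [sub_eq_zero] at h1
    have h2 : (x' + x) * x = 0 := by rw [add_mul, pure_mul_self hx0, h1]; simp
    rcases mul_eq_zero.1 h2 with h3 | h3
    · exact eq_neg_of_add_eq_zero_left h3
    · rw [h3, map_zero, eq_comm, Quaternion.normSq_eq_zero] at hnx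
      rw [h3, hnx, neg_zero]
  · rw [sub_mul, mul_sub, Quaternion.coe_commutes, ← mul_assoc p, hpx', neg_mul, mul_assoc x' p,
      hpx, mul_neg, neg_neg, mul_assoc]
  · rw [sub_mul, mul_sub, mul_assoc, pure_mul_self hx0, ← mul_assoc x', pure_mul_self hx0', ← hnx,
      ← Quaternion.coe_commutes _ x']
    simp only [mul_neg, neg_mul, sub_neg_eq_add, ← Quaternion.coe_commutes]
    abel

/-- Pairs of imaginary quaternions with the same inner products are simultaneously similar. -/
theorem exists_conj_pair {p q p' q' : ℍ[ℝ]} (hp : p.re = 0) (hq : q.re = 0) (hp' : p'.re = 0)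
    (hq' : q'.re = 0) (hnp : Quaternion.normSq p = Quaternion.normSq p')
    (hnq : Quaternion.normSq q = Quaternion.normSq q')
    (hd : (star p * q).re = (star p' * q').re) :
    ∃ v : ℍ[ℝ], star v * v = 1 ∧ v * star v = 1 ∧ v * p * star v = p' ∧ v * q * star v = q' := by
  by_cases hp0 : p = 0
  · subst hp0
    rw [map_zero, eq_comm, Quaternion.normSq_eq_zero] at hnp
    subst hnp
    obtain ⟨u, hu, h⟩ := exists_conj_pure hq hq' hnq
    obtain ⟨v, hv, hv', h'⟩ := exists_unit_of_conj hu
    exact ⟨v, hv, hv', by simp, eq_conj_unit hv' (h' _ _ h)⟩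
  have hp0' : p' ≠ 0 := by
    rintro rfl
    rw [map_zero, Quaternion.normSq_eq_zero] at hnp
    exact hp0 hnp
  obtain ⟨u, hu, h⟩ := exists_conj_pure hp hp' hnp
  obtain ⟨v, hv, hv', hv''⟩ := exists_unit_of_conj hu
  replace h := hv'' _ _ h
  have hvp := eq_conj_unit hv' h
  have hd' : (star p' * (v * q * star v)).re = (star p' * q').re := by
    rw [← hd, ← hvp]
    have : star (v * p * star v) * (v * q * star v) = v * (star p * q) * star v := by
      calc star (v * p * star v) * (v * q * star v)
          = v * star p * (star v * v) * q * star v := by simp [mul_assoc]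
        _ = _ := by rw [hv]; simp [mul_assoc]
    rw [this, re_conj_unit hv]
  obtain ⟨w, hw, hwp, hwq⟩ := exists_conj_fixing hp0' hp' (by rw [re_conj_unit hv, hq]) hq' hd'
    (by rw [normSq_conj_unit hv, hnq])
  have h1 : (w * v) * p = p' * (w * v) := by rw [mul_assoc, h, ← mul_assoc, hwp, mul_assoc]
  have h2 : (w * v) * q = q' * (w * v) := by
    rw [← mul_assoc, ← hwq]
    calc w * v * q = w * (v * q * (star v * v)) := by rw [hv, mul_one, mul_assoc]
      _ = _ := by simp only [mul_assoc]
  have hv0 : v ≠ 0 := by rintro rfl; simp at hv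
  obtain ⟨x, hx, hx', hc⟩ := exists_unit_of_conj (mul_ne_zero hw hv0)
  exact ⟨x, hx, hx', eq_conj_unit hx' (hc _ _ h1), eq_conj_unit hx' (hc _ _ h2)⟩

/-- When the Gram determinant of p, q is nonzero, p, q and p × q form a basis of the imaginary
quaternions, and the three hypotheses compare the inner products of r and r' with it. The linear
combinations are the dual basis formulas. -/
theorem eq_of_pairings {p q r r' : ℍ[ℝ]} (hp : p.re = 0) (hq : q.re = 0) (hr : r.re = 0)
    (hr' : r'.re = 0)
    (hG : Quaternion.normSq p * Quaternion.normSq q - (star p * q).re ^ 2 ≠ 0)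
    (h1 : (star p * r).re = (star p * r').re) (h2 : (star q * r).re = (star q * r').re)
    (h3 : (p * q * r).re = (p * q * r').re) : r = r' := by
  simp only [Quaternion.normSq_def'] at hG
  simp [hp, hq, hr, hr'] at hG h1 h2 h3
  ext
  · rw [hr, hr']
  · refine mul_left_cancel₀ hG ?_
    linear_combination -(p.imJ * q.imK - p.imK * q.imJ) * h3 +
      ((q.imI ^ 2 + q.imJ ^ 2 + q.imK ^ 2) * p.imI -
        (p.imI * q.imI + p.imJ * q.imJ + p.imK * q.imK) * q.imI) * h1 +
      ((p.imI ^ 2 + p.imJ ^ 2 + p.imK ^ 2) * q.imI -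
        (p.imI * q.imI + p.imJ * q.imJ + p.imK * q.imK) * p.imI) * h2
  · refine mul_left_cancel₀ hG ?_
    linear_combination -(p.imK * q.imI - p.imI * q.imK) * h3 +
      ((q.imI ^ 2 + q.imJ ^ 2 + q.imK ^ 2) * p.imJ -
        (p.imI * q.imI + p.imJ * q.imJ + p.imK * q.imK) * q.imJ) * h1 +
      ((p.imI ^ 2 + p.imJ ^ 2 + p.imK ^ 2) * q.imJ -
        (p.imI * q.imI + p.imJ * q.imJ + p.imK * q.imK) * p.imJ) * h2
  · refine mul_left_cancel₀ hG ?_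
    linear_combination -(p.imI * q.imJ - p.imJ * q.imI) * h3 +
      ((q.imI ^ 2 + q.imJ ^ 2 + q.imK ^ 2) * p.imK -
        (p.imI * q.imI + p.imJ * q.imJ + p.imK * q.imK) * q.imK) * h1 +
      ((p.imI ^ 2 + p.imJ ^ 2 + p.imK ^ 2) * q.imK -
        (p.imI * q.imI + p.imJ * q.imJ + p.imK * q.imK) * p.imK) * h2

/-- The equality case of Cauchy–Schwarz. -/
theorem eq_smul_of_gram_eq_zero {p q : ℍ[ℝ]} (hp0 : p ≠ 0)
    (hG : Quaternion.normSq p * Quaternion.normSq q - (star p * q).re ^ 2 = 0) :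
    q = ((star p * q).re / Quaternion.normSq p) • p := by
  have hnp : Quaternion.normSq p ≠ 0 := by simpa using hp0
  rw [← sub_eq_zero, ← Quaternion.normSq_eq_zero, normSq_sub_smul]
  field_simp
  linarith

/-- Triples of imaginary quaternions with the same inner products and the same triple product are
simultaneously similar. -/
theorem exists_conj_triple {p q r p' q' r' : ℍ[ℝ]} (hp : p.re = 0) (hq : q.re = 0) (hr : r.re = 0)
    (hp' : p'.re = 0) (hq' : q'.re = 0) (hr' : r'.re = 0)
    (hnp : Quaternion.normSq p = Quaternion.normSq p')
    (hnq : Quaternion.normSq q = Quaternion.normSq q')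
    (hnr : Quaternion.normSq r = Quaternion.normSq r')
    (hpq : (star p * q).re = (star p' * q').re) (hpr : (star p * r).re = (star p' * r').re)
    (hqr : (star q * r).re = (star q' * r').re)
    (ht : (p * q * r).re = (p' * q' * r').re) :
    ∃ v : ℍ[ℝ], star v * v = 1 ∧ v * star v = 1 ∧ v * p * star v = p' ∧ v * q * star v = q' ∧
      v * r * star v = r' := by
  by_cases hp0 : p = 0
  · subst hp0
    rw [map_zero, eq_comm, Quaternion.normSq_eq_zero] at hnp
    subst hnp
    obtain ⟨v, hv, hv', h1, h2⟩ := exists_conj_pair hq hr hq' hr' hnq hnr hqr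
    exact ⟨v, hv, hv', by simp, h1, h2⟩
  have hp0' : p' ≠ 0 := by
    rintro rfl
    rw [map_zero, Quaternion.normSq_eq_zero] at hnp
    exact hp0 hnp
  -- If p and q are dependent, q and q' are the same real multiple of p and p', and moving the pair
  -- (p, r) suffices.
  by_cases hG : Quaternion.normSq p * Quaternion.normSq q - (star p * q).re ^ 2 = 0
  · obtain ⟨v, hv, hv', h1, h2⟩ := exists_conj_pair hp hr hp' hr' hnp hnr hpr
    refine ⟨v, hv, hv', h1, ?_, h2⟩
    have e1 := eq_smul_of_gram_eq_zero hp0 hG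
    have e2 := eq_smul_of_gram_eq_zero (q := q') hp0' (by rw [← hnp, ← hnq, ← hpq]; exact hG)
    rw [← hpq, ← hnp] at e2
    rw [e2, ← h1, ← smul_mul_assoc, ← mul_smul_comm, ← e1]
  -- If they are independent, moving (p, q) leaves no choice for r. The triple product excludes the
  -- mirror image of r' in the plane of p' and q'.
  · obtain ⟨v, hv, hv', h1, h2⟩ := exists_conj_pair hp hq hp' hq' hnp hnq hpq
    refine ⟨v, hv, hv', h1, h2, ?_⟩
    refine eq_of_pairings (p := p') (q := q') hp' hq' (by rw [re_conj_unit hv, hr]) hr' ?_ ?_ ?_ ?_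
    · rw [← hnp, ← hnq, ← hpq]; exact hG
    · rw [← hpr, ← h1]
      have : star (v * p * star v) * (v * r * star v) = v * (star p * r) * star v := by
        calc star (v * p * star v) * (v * r * star v)
            = v * star p * (star v * v) * r * star v := by simp [mul_assoc]
          _ = _ := by rw [hv]; simp [mul_assoc]
      rw [this, re_conj_unit hv]
    · rw [← hqr, ← h2]
      have : star (v * q * star v) * (v * r * star v) = v * (star q * r) * star v := by
        calc star (v * q * star v) * (v * r * star v)
            = v * star q * (star v * v) * r * star v := by simp [mul_assoc]
          _ = _ := by rw [hv]; simp [mul_assoc]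
      rw [this, re_conj_unit hv]
    · rw [← ht, ← h1, ← h2]
      have : v * p * star v * (v * q * star v) * (v * r * star v) = v * (p * q * r) * star v := by
        calc v * p * star v * (v * q * star v) * (v * r * star v)
            = v * p * (star v * v) * q * (star v * v) * r * star v := by simp only [mul_assoc]
          _ = _ := by rw [hv]; simp [mul_assoc]
      rw [this, re_conj_unit hv]

/-- Triples of quaternions are simultaneously similar when their real parts, norms, and the real
parts of the products below agree. -/
theorem exists_conj_triple_of_re {a b c a' b' c' : ℍ[ℝ]} (ha : a.re = a'.re) (hb : b.re = b'.re)
    (hc : c.re = c'.re) (hna : Quaternion.normSq a = Quaternion.normSq a')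
    (hnb : Quaternion.normSq b = Quaternion.normSq b')
    (hnc : Quaternion.normSq c = Quaternion.normSq c')
    (hab : (star a * b).re = (star a' * b').re) (hcb : (c * star b).re = (c' * star b').re)
    (hac : (a * c).re = (a' * c').re)
    (ht : (b * star c * star a).re = (b' * star c' * star a').re) :
    ∃ v : ℍ[ℝ], star v * v = 1 ∧ v * star v = 1 ∧ v * a = a' * v ∧ v * b = b' * v ∧
      v * c = c' * v := by
  -- The real parts of the products differ from the inner products and the triple product of the
  -- imaginary parts only by terms already known to agree.
  have him : ∀ q : ℍ[ℝ], Quaternion.normSq q.im = Quaternion.normSq q - q.re ^ 2 := fun q => by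
    simp only [Quaternion.normSq_def']; simp; ring
  have hdot : ∀ p q : ℍ[ℝ], (star p.im * q.im).re = (star p * q).re - p.re * q.re := fun p q => by
    simp; ring
  have hdot' : ∀ p q : ℍ[ℝ], (star p.im * q.im).re = (q * star p).re - p.re * q.re := fun p q => by
    simp; ring
  have hdot'' : ∀ p q : ℍ[ℝ], (star p.im * q.im).re = -(p * q).re + p.re * q.re := fun p q => by
    simp; ring
  have htri : ∀ p q r : ℍ[ℝ], (p.im * q.im * r.im).re = (q * star r * star p).re
      - q.re * r.re * p.re + q.re * (star p.im * r.im).re - r.re * (star p.im * q.im).re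
      - p.re * (star q.im * r.im).re := fun p q r => by
    simp; ring
  have e1 : (star a.im * b.im).re = (star a'.im * b'.im).re := by
    rw [hdot, hdot, hab, ha, hb]
  have e2 : (star a.im * c.im).re = (star a'.im * c'.im).re := by
    rw [hdot'', hdot'', hac, ha, hc]
  have e3 : (star b.im * c.im).re = (star b'.im * c'.im).re := by
    rw [hdot', hdot', hcb, hb, hc]
  obtain ⟨v, hv, hv', h1, h2, h3⟩ := exists_conj_triple (p := a.im) (q := b.im) (r := c.im)
    (p' := a'.im) (q' := b'.im) (r' := c'.im) (by simp) (by simp) (by simp) (by simp) (by simp)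
    (by simp) (by rw [him, him, hna, ha]) (by rw [him, him, hnb, hb]) (by rw [him, him, hnc, hc])
    e1 e2 e3 (by rw [htri, htri, ht, ha, hb, hc, e1, e2, e3])
  have hfin : ∀ q q' : ℍ[ℝ], q.re = q'.re → v * q.im * star v = q'.im → v * q = q' * v := by
    intro q q' hre him
    have := mul_eq_of_conj_unit hv him
    rw [← Quaternion.re_add_im q, ← Quaternion.re_add_im q', mul_add, add_mul, this, hre,
      Quaternion.coe_commutes]
  exact ⟨v, hv, hv', hfin _ _ ha h1, hfin _ _ hb h2, hfin _ _ hc h3⟩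

end

section

/-! ### Quadruples of boundary points -/

theorem herm_of_congr {h : Sp21} {z z' w w' : V} {p q : ℍ[ℝ]} (hz : mat h *ᵥ z = w <• p)
    (hz' : mat h *ᵥ z' = w' <• q) : herm z z' = star q * herm w w' * p := by
  rw [← herm_mat h, hz, hz', herm_rsmul_left, herm_rsmul_right]

/-- The scalars of the second, third and fourth lifts cancel; that of the first remains as a
conjugation. -/
theorem crossRatio_congr {h : Sp21} {z w : Fin 4 → V} {q : Fin 4 → ℍ[ℝ]} (hq : ∀ i, q i ≠ 0)
    (hh : ∀ i, mat h *ᵥ z i = w i <• q i) (a b c d : Fin 4) :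
    ConjClasses.mk (crossRatio (z a) (z b) (z c) (z d)) =
      ConjClasses.mk (crossRatio (w a) (w b) (w c) (w d)) := by
  have hs : ∀ i, star (q i) ≠ 0 := fun i => star_ne_zero.2 (hq i)
  rw [ConjClasses.mk_eq_mk_iff_isConj, isConj_comm, GroupWithZero.isConj_iff₀]
  refine ⟨star (q a), hs a, ?_⟩
  simp only [crossRatio, herm_of_congr (hh _) (hh _), mul_inv_rev, mul_assoc]
  rw [mul_inv_cancel_left₀ (hq c), inv_mul_cancel_left₀ (hs b), mul_inv_cancel_left₀ (hq d)]

/-- The scalars of the second and third lifts contribute positive real factors. That of the first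
contributes |q|² to both the real part and the norm of the triple product. -/
theorem angular_congr {h : Sp21} {z w : Fin 4 → V} {q : Fin 4 → ℍ[ℝ]} (hq : ∀ i, q i ≠ 0)
    (hh : ∀ i, mat h *ᵥ z i = w i <• q i) (a b c : Fin 4) :
    angular (z a) (z b) (z c) = angular (w a) (w b) (w c) := by
  have ht : herm (z c) (z a) * herm (z b) (z c) * herm (z a) (z b) =
      ((Quaternion.normSq (q b) * Quaternion.normSq (q c) : ℝ) : ℍ[ℝ]) *
      (star (q a) * (herm (w c) (w a) * herm (w b) (w c) * herm (w a) (w b)) * q a) := by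
    simp only [herm_of_congr (hh _) (hh _)]
    calc star (q a) * herm (w c) (w a) * q c * (star (q c) * herm (w b) (w c) * q b) *
          (star (q b) * herm (w a) (w b) * q a)
        = star (q a) * herm (w c) (w a) * (q c * star (q c)) * herm (w b) (w c) *
            (q b * star (q b)) * herm (w a) (w b) * q a := by simp only [mul_assoc]
      _ = _ := by
        rw [Quaternion.self_mul_star, Quaternion.self_mul_star, Quaternion.coe_mul,
          ← Quaternion.coe_commutes (Quaternion.normSq (q b)),
          ← Quaternion.coe_commutes (Quaternion.normSq (q c))]
        simp only [mul_assoc]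
  have hre : ∀ t : ℍ[ℝ], (star (q a) * t * q a).re = Quaternion.normSq (q a) * t.re := fun t => by
    rw [re_mul_comm, ← mul_assoc, Quaternion.self_mul_star, Quaternion.coe_mul_eq_smul,
      Quaternion.re_smul, smul_eq_mul]
  have hpos : ∀ i, 0 < Quaternion.normSq (q i) := fun i => by
    rw [Quaternion.normSq_eq_norm_mul_self]
    have := norm_pos_iff.2 (hq i)
    positivity
  simp only [angular]
  rw [ht, Quaternion.coe_mul_eq_smul, Quaternion.re_smul, smul_eq_mul, hre, norm_smul,
    Real.norm_of_nonneg (mul_pos (hpos b) (hpos c)).le, norm_mul (_ * _) (q a),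
    norm_mul (star (q a)), Quaternion.norm_star]
  congr 1
  have ha := hpos a
  have hbc := mul_pos (hpos b) (hpos c)
  have hna : Quaternion.normSq (q a) = ‖q a‖ * ‖q a‖ := Quaternion.normSq_eq_norm_mul_self _
  generalize Quaternion.normSq (q b) * Quaternion.normSq (q c) = k at hbc ⊢
  generalize herm (w c) (w a) * herm (w b) (w c) * herm (w a) (w b) = t
  have e : k * (‖q a‖ * ‖t‖ * ‖q a‖) = k * Quaternion.normSq (q a) * ‖t‖ := by rw [hna]; ring
  rw [e, ← mul_assoc, ← mul_neg, mul_div_mul_left _ _ (mul_pos hbc ha).ne']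

/-- The invariants of a quadruple depend only on its congruence class. -/
theorem quadInvariants_congr {h : Sp21} {z w : Fin 4 → V} {q : Fin 4 → ℍ[ℝ]} (hq : ∀ i, q i ≠ 0)
    (hh : ∀ i, mat h *ᵥ z i = w i <• q i) : quadInvariants z = quadInvariants w := by
  simp only [quadInvariants]
  rw [crossRatio_congr hq hh, crossRatio_congr hq hh, crossRatio_congr hq hh,
    angular_congr hq hh, angular_congr hq hh, angular_congr hq hh, angular_congr hq hh]

/-! ### Normal forms and classification of quadruples -/

/-- Normalized quadruples. -/
def normalQuad (α μ β ν : ℍ[ℝ]) : Fin 4 → V :=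
  ![![1, 0, 0], ![0, 0, 1], ![α, μ, 1], ![β, ν, 1]]

/-- A quadruple of lifts of distinct boundary points. -/
structure IsNullQuad (z : Fin 4 → V) : Prop where
  null : ∀ i, z i ≠ 0 ∧ herm (z i) (z i) = 0
  distinct : ∀ i j, i ≠ j → herm (z i) (z j) ≠ 0

theorem IsNullQuad.congr {h : Sp21} {z w : Fin 4 → V} {q : Fin 4 → ℍ[ℝ]} (hz : IsNullQuad z)
    (hq : ∀ i, q i ≠ 0) (hh : ∀ i, mat h *ᵥ z i = w i <• q i) : IsNullQuad w := by
  have key : ∀ i j, herm (z i) (z j) = star (q j) * herm (w i) (w j) * q i := fun i j =>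
    herm_of_congr (hh i) (hh j)
  refine ⟨fun i => ⟨?_, ?_⟩, fun i j hij h0 => hz.distinct i j hij ?_⟩
  · intro h0
    apply mat_mulVec_ne_zero h (hz.null i).1
    rw [hh, h0, smul_zero]
  · have := (hz.null i).2
    rw [key] at this
    simpa [hq i] using this
  · rw [key, h0]; simp

/-- The first two points are moved to the two standard null lines; the others are not orthogonal to
(1,0,0), so their last coordinate is invertible and can be scaled to 1. -/
theorem IsNullQuad.exists_normal {z : Fin 4 → V} (hz : IsNullQuad z) :
    ∃ (h : Sp21) (q : Fin 4 → ℍ[ℝ]) (α μ β ν : ℍ[ℝ]), (∀ i, q i ≠ 0) ∧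
      ∀ i, mat h *ᵥ z i = normalQuad α μ β ν i <• q i := by
  have h01 := hz.distinct 0 1 (by decide)
  have hc : star (herm (z 0) (z 1))⁻¹ ≠ 0 := by simpa using h01
  obtain ⟨c, hcdef⟩ : ∃ c, c = star (herm (z 0) (z 1))⁻¹ := ⟨_, rfl⟩
  have hc : c ≠ 0 := hcdef ▸ hc
  have hzw : herm (z 0) (z 1 <• c) = 1 := by
    rw [herm_rsmul_right, hcdef, star_star, inv_mul_cancel₀ h01]
  obtain ⟨Q, x, hQ, -, -, -⟩ := exists_frame (hz.null 0).2
    (rsmul_herm_zero (hz.null 1).2 c c) hzw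
  have e0 : mat Q⁻¹ *ᵥ z 0 = ![1, 0, 0] := by
    have : z 0 = mat Q *ᵥ ![1, 0, 0] := by rw [hQ, cols_mulVec]; ext1 i; simp
    rw [this, mat_inv_mulVec]
  have e1 : mat Q⁻¹ *ᵥ z 1 = ![0, 0, 1] <• c⁻¹ := by
    have : z 1 = mat Q *ᵥ (![0, 0, 1] <• c⁻¹) := by
      rw [mulVec_rsmul, hQ, cols_mulVec]; ext1 i; simp [hc]
    rw [this, mat_inv_mulVec]
  have hlast : ∀ i, i ≠ 0 → (mat Q⁻¹ *ᵥ z i) 2 ≠ 0 := by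
    intro i hi h0
    apply hz.distinct i 0 hi
    rw [← herm_mat Q⁻¹, e0]
    simp [herm, h0]
  have hnorm : ∀ v : V, v 2 ≠ 0 → v = ![v 0 * (v 2)⁻¹, v 1 * (v 2)⁻¹, 1] <• v 2 := by
    intro v hv
    ext1 i; fin_cases i <;> simp [hv]
  refine ⟨Q⁻¹, ![1, c⁻¹, (mat Q⁻¹ *ᵥ z 2) 2, (mat Q⁻¹ *ᵥ z 3) 2],
    (mat Q⁻¹ *ᵥ z 2) 0 * ((mat Q⁻¹ *ᵥ z 2) 2)⁻¹, (mat Q⁻¹ *ᵥ z 2) 1 * ((mat Q⁻¹ *ᵥ z 2) 2)⁻¹,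
    (mat Q⁻¹ *ᵥ z 3) 0 * ((mat Q⁻¹ *ᵥ z 3) 2)⁻¹, (mat Q⁻¹ *ᵥ z 3) 1 * ((mat Q⁻¹ *ᵥ z 3) 2)⁻¹,
    ?_, ?_⟩
  rotate_left
  · intro i
    fin_cases i
    · exact e0.trans (rsmul_one _).symm
    · exact e1
    · exact hnorm _ (hlast 2 (by decide))
    · exact hnorm _ (hlast 3 (by decide))
  · intro i
    fin_cases i
    · exact one_ne_zero
    · exact inv_ne_zero hc
    · exact hlast 2 (by decide)
    · exact hlast 3 (by decide)

theorem re_eq_of_mk_eq {a b : ℍ[ℝ]} (h : ConjClasses.mk a = ConjClasses.mk b) :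
    a.re = b.re ∧ ‖a‖ = ‖b‖ := by
  rw [ConjClasses.mk_eq_mk_iff_isConj, GroupWithZero.isConj_iff₀] at h
  obtain ⟨c, hc, rfl⟩ := h
  constructor
  · rw [re_mul_comm (c * a), ← mul_assoc, inv_mul_cancel₀ hc, one_mul]
  · rw [norm_mul, norm_mul, norm_inv, mul_comm ‖c‖, mul_assoc,
      mul_inv_cancel₀ (norm_ne_zero_iff.2 hc), mul_one]

theorem abs_re_le_norm (t : ℍ[ℝ]) : |t.re| ≤ ‖t‖ := by
  refine abs_le_of_sq_le_sq ?_ (norm_nonneg t)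
  rw [pow_two ‖t‖, ← Quaternion.normSq_eq_norm_mul_self, Quaternion.normSq_def']
  nlinarith [sq_nonneg t.imI, sq_nonneg t.imJ, sq_nonneg t.imK]

theorem re_div_norm_of_arccos {t t' : ℍ[ℝ]}
    (h : Real.arccos (-t.re / ‖t‖) = Real.arccos (-t'.re / ‖t'‖)) :
    t.re / ‖t‖ = t'.re / ‖t'‖ := by
  have hb : ∀ t : ℍ[ℝ], -t.re / ‖t‖ ∈ Set.Icc (-1 : ℝ) 1 := fun t => by
    rw [Set.mem_Icc, ← abs_le, abs_div, abs_neg, abs_norm]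
    exact div_le_one_of_le₀ (abs_re_le_norm t) (norm_nonneg t)
  have := Real.arccos_injOn (hb t) (hb t') h
  rw [neg_div, neg_div] at this
  exact neg_injective this

theorem normalQuad_herm (α μ β ν : ℍ[ℝ]) (n : Fin 4 → V) (hn : n = normalQuad α μ β ν) :
    herm (n 0) (n 1) = 1 ∧ herm (n 1) (n 0) = 1 ∧ herm (n 2) (n 0) = 1 ∧ herm (n 2) (n 1) = α ∧
    herm (n 3) (n 0) = 1 ∧ herm (n 3) (n 1) = β ∧ herm (n 1) (n 2) = star α ∧
    herm (n 1) (n 3) = star β ∧ herm (n 0) (n 2) = 1 ∧ herm (n 0) (n 3) = 1 ∧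
    herm (n 3) (n 2) = star α + β + star μ * ν ∧
    herm (n 2) (n 3) = star (star α + β + star μ * ν) ∧
    (herm (n 2) (n 2)).re = 2 * α.re + Quaternion.normSq μ ∧
    (herm (n 3) (n 3)).re = 2 * β.re + Quaternion.normSq ν := by
  subst hn
  have hs : ∀ q : ℍ[ℝ], (star q * q).re = Quaternion.normSq q := fun q => by
    rw [Quaternion.star_mul_self]; rfl
  refine ⟨?_, ?_, ?_, ?_, ?_, ?_, ?_, ?_, ?_, ?_, ?_, ?_, ?_, ?_⟩ <;>
    simp only [normalQuad, herm, Matrix.cons_val, star_zero, star_one, star_add, star_mul,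
      star_star, zero_mul, mul_zero, one_mul, mul_one, zero_add, add_zero, Quaternion.re_add,
      Quaternion.re_star, hs]
  · abel
  · abel
  · ring
  · ring

theorem normalQuad_invariants (α μ β ν c : ℍ[ℝ]) (hc : c = star α + β + star μ * ν) :
    quadInvariants (normalQuad α μ β ν) =
      (![ConjClasses.mk (α⁻¹ * β), ConjClasses.mk ((star c)⁻¹ * star β),
         ConjClasses.mk (α * (star c)⁻¹)],
       ![Real.arccos (-(star α).re / ‖star α‖), Real.arccos (-(star β).re / ‖star β‖),
         Real.arccos (-(β * star c * star α).re / ‖β * star c * star α‖),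
         Real.arccos (-(star c).re / ‖star c‖)]) := by
  obtain ⟨h01, h10, h20, h21, h30, h31, h12, h13, h02, h03, h32, h23, -, -⟩ :=
    normalQuad_herm α μ β ν _ rfl
  rw [← hc] at h23
  simp only [quadInvariants, crossRatio, angular, h01, h10, h20, h21, h30, h31, h12, h13, h02,
    h03, h23, inv_one, mul_one, one_mul]

/-- The algebra behind the classification of quadruples: the invariants determine the entries of
the Gram matrix up to simultaneous similarity and scaling. -/
theorem exists_similarity {α β c α' β' c' : ℍ[ℝ]} (hα : α ≠ 0) (hβ : β ≠ 0) (hc : c ≠ 0)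
    (hα' : α' ≠ 0) (hβ' : β' ≠ 0) (hc' : c' ≠ 0)
    (h1 : ConjClasses.mk (α⁻¹ * β) = ConjClasses.mk (α'⁻¹ * β'))
    (h2 : ConjClasses.mk ((star c)⁻¹ * star β) = ConjClasses.mk ((star c')⁻¹ * star β'))
    (h3 : ConjClasses.mk (α * (star c)⁻¹) = ConjClasses.mk (α' * (star c')⁻¹))
    (a1 : Real.arccos (-(star α).re / ‖star α‖) = Real.arccos (-(star α').re / ‖star α'‖))
    (a2 : Real.arccos (-(star β).re / ‖star β‖) = Real.arccos (-(star β').re / ‖star β'‖))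
    (a3 : Real.arccos (-(β * star c * star α).re / ‖β * star c * star α‖) =
      Real.arccos (-(β' * star c' * star α').re / ‖β' * star c' * star α'‖))
    (a4 : Real.arccos (-(star c).re / ‖star c‖) = Real.arccos (-(star c').re / ‖star c'‖)) :
    ∃ (t : ℝ) (v : ℍ[ℝ]), 0 < t ∧ star v * v = 1 ∧ v * star v = 1 ∧ t • (v * α) = α' * v ∧
      t • (v * β) = β' * v ∧ t • (v * c) = c' * v := by
  have nα := norm_pos_iff.2 hα
  have nβ := norm_pos_iff.2 hβ
  have nc := norm_pos_iff.2 hc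
  have nα' := norm_pos_iff.2 hα'
  have nβ' := norm_pos_iff.2 hβ'
  have nc' := norm_pos_iff.2 hc'
  obtain ⟨r1, n1⟩ := re_eq_of_mk_eq h1
  obtain ⟨r2, n2⟩ := re_eq_of_mk_eq h2
  obtain ⟨r3, n3⟩ := re_eq_of_mk_eq h3
  have b1 := re_div_norm_of_arccos a1
  have b2 := re_div_norm_of_arccos a2
  have b3 := re_div_norm_of_arccos a3
  have b4 := re_div_norm_of_arccos a4
  simp only [norm_mul, norm_inv, Quaternion.norm_star, Quaternion.re_star] at n1 n2 n3 b1 b2 b3 b4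
  -- The scale left free by the dilations that fix the first two points; the norms of the cross
  -- ratios make it the same for α, β and c.
  obtain ⟨t, ht⟩ : ∃ t, t = ‖α'‖ / ‖α‖ := ⟨_, rfl⟩
  have htpos : 0 < t := by rw [ht]; positivity
  have eα : ‖α'‖ = t * ‖α‖ := by rw [ht]; field_simp
  have eβ : ‖β'‖ = t * ‖β‖ := by
    rw [ht]; field_simp at n1 ⊢; linarith
  have ec : ‖c'‖ = t * ‖c‖ := by
    rw [ht]; field_simp at n3 ⊢; linarith
  rw [eα] at b1
  rw [eβ] at b2
  rw [ec] at b4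
  rw [eα, eβ, ec] at b3
  have ra : t * α.re = α'.re := by field_simp at b1; linarith
  have rb : t * β.re = β'.re := by field_simp at b2; linarith
  have rc : t * c.re = c'.re := by field_simp at b4; linarith
  have rt : t ^ 3 * (β * star c * star α).re = (β' * star c' * star α').re := by
    field_simp at b3; linarith
  -- An inverse is a real multiple of the conjugate, so the real parts of the cross ratios give
  -- Re(ᾱβ), Re(cβ̄) and Re(αc).
  have hinv : ∀ q : ℍ[ℝ], q⁻¹ = ((‖q‖ * ‖q‖)⁻¹ : ℝ) • star q := fun q => by
    rw [Quaternion.inv_def, Quaternion.normSq_eq_norm_mul_self]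
  rw [hinv, hinv, smul_mul_assoc, smul_mul_assoc, Quaternion.re_smul, Quaternion.re_smul, eα] at r1
  rw [hinv, hinv, smul_mul_assoc, smul_mul_assoc, Quaternion.re_smul, Quaternion.re_smul,
    Quaternion.norm_star, Quaternion.norm_star, star_star, star_star, ec] at r2
  rw [hinv, hinv, mul_smul_comm, mul_smul_comm, Quaternion.re_smul, Quaternion.re_smul,
    Quaternion.norm_star, Quaternion.norm_star, star_star, star_star, ec] at r3
  simp only [smul_eq_mul] at r1 r2 r3
  have rab : t ^ 2 * (star α * β).re = (star α' * β').re := by field_simp at r1; linarith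
  have rcb : t ^ 2 * (c * star β).re = (c' * star β').re := by field_simp at r2; linarith
  have rac : t ^ 2 * (α * c).re = (α' * c').re := by field_simp at r3; linarith
  have hns : ∀ q : ℍ[ℝ], Quaternion.normSq (t • q) = t ^ 2 * (‖q‖ * ‖q‖) := fun q => by
    rw [Quaternion.normSq_smul, Quaternion.normSq_eq_norm_mul_self]
  obtain ⟨v, hv, hv', va, vb, vc⟩ := exists_conj_triple_of_re (a := t • α) (b := t • β)
    (c := t • c) (a' := α') (b' := β') (c' := c') (by simpa using ra) (by simpa using rb)
    (by simpa using rc) (by rw [hns, Quaternion.normSq_eq_norm_mul_self, eα]; ring)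
    (by rw [hns, Quaternion.normSq_eq_norm_mul_self, eβ]; ring)
    (by rw [hns, Quaternion.normSq_eq_norm_mul_self, ec]; ring)
    (by rw [Quaternion.star_smul, smul_mul_smul_comm, Quaternion.re_smul, ← rab, smul_eq_mul]
        ring)
    (by rw [Quaternion.star_smul, smul_mul_smul_comm, Quaternion.re_smul, ← rcb, smul_eq_mul]
        ring)
    (by rw [smul_mul_smul_comm, Quaternion.re_smul, ← rac, smul_eq_mul]; ring)
    (by rw [Quaternion.star_smul, Quaternion.star_smul, smul_mul_smul_comm, smul_mul_smul_comm, Quaternion.re_smul, ← rt,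
          smul_eq_mul]
        ring)
  refine ⟨t, v, htpos, hv, hv', ?_, ?_, ?_⟩
  · rw [← va, mul_smul_comm]
  · rw [← vb, mul_smul_comm]
  · rw [← vc, mul_smul_comm]

/-- The compact factor that matches the middle coordinates. -/
theorem exists_middle {μ ν μ' ν' l : ℍ[ℝ]} {k : ℝ} (hl : l ≠ 0)
    (hμ : ‖μ'‖ * ‖l‖ = ‖μ‖) (hν : ‖ν'‖ * ‖l‖ = ‖ν‖)
    (hm : star μ' * ν' * l = k • (l * (star μ * ν))) (hk' : ‖μ'‖ * ‖μ'‖ = k * (‖μ‖ * ‖μ‖)) :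
    ∃ u : ℍ[ℝ], star u * u = 1 ∧ u * μ = μ' * l ∧ u * ν = ν' * l := by
  have hunit : ∀ u : ℍ[ℝ], ‖u‖ = 1 → star u * u = 1 := fun u hu => by
    rw [Quaternion.star_mul_self, Quaternion.normSq_eq_norm_mul_self, hu, one_mul]; rfl
  have hln := norm_pos_iff.2 hl
  -- For μ ≠ 0 the first equation forces u = μ'lμ⁻¹, and `hm` yields the second. If μ = 0, then μ' =
  -- 0 and u is read off from ν, or is 1 if ν = 0 too.
  by_cases h0 : μ = 0
  · have h0' : μ' = 0 := by
      rw [h0, norm_zero, mul_eq_zero] at hμ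
      rcases hμ with h | h
      · exact norm_eq_zero.1 h
      · exact absurd h hln.ne'
    by_cases h1 : ν = 0
    · have h1' : ν' = 0 := by
        rw [h1, norm_zero, mul_eq_zero] at hν
        rcases hν with h | h
        · exact norm_eq_zero.1 h
        · exact absurd h hln.ne'
      exact ⟨1, by simp, by simp [h0, h0'], by simp [h1, h1']⟩
    · refine ⟨ν' * l * ν⁻¹, hunit _ ?_, by simp [h0, h0'], by
        rw [mul_assoc, inv_mul_cancel₀ h1, mul_one]⟩
      rw [norm_mul, norm_mul, hν, norm_inv, mul_inv_cancel₀ (norm_ne_zero_iff.2 h1)]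
  · have h0n := norm_pos_iff.2 h0
    have h0' : μ' ≠ 0 := by
      rintro rfl
      rw [norm_zero, zero_mul] at hμ
      exact h0n.ne hμ
    have hs' : star μ' ≠ 0 := star_ne_zero.2 h0'
    refine ⟨μ' * l * μ⁻¹, hunit _ ?_, by rw [mul_assoc, inv_mul_cancel₀ h0, mul_one], ?_⟩
    · rw [norm_mul, norm_mul, hμ, norm_inv, mul_inv_cancel₀ (norm_ne_zero_iff.2 h0)]
    · refine mul_left_cancel₀ hs' ?_
      rw [← mul_assoc, ← mul_assoc (star μ') ν', hm]
      have e1 : star μ' * (μ' * l * μ⁻¹) * ν = (star μ' * μ') * l * μ⁻¹ * ν := by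
        simp only [mul_assoc]
      have e2 : star μ = ((‖μ‖ * ‖μ‖ : ℝ) : ℍ[ℝ]) * μ⁻¹ := by
        rw [← Quaternion.normSq_eq_norm_mul_self, ← Quaternion.star_mul_self, mul_assoc,
          mul_inv_cancel₀ h0, mul_one]
      rw [e1, e2, Quaternion.star_mul_self, Quaternion.normSq_eq_norm_mul_self, hk',
        Quaternion.coe_mul, Quaternion.coe_mul_eq_smul, smul_mul_assoc, smul_mul_assoc,
        smul_mul_assoc]
      congr 1
      rw [← mul_assoc, ← mul_assoc, ← Quaternion.coe_commutes]

theorem diagonal_rel {a u b : ℍ[ℝ]} (hab : star a * b = 1) (hu : star u * u = 1) :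
    (Matrix.diagonal ![a, u, b])ᴴ * H₁ * Matrix.diagonal ![a, u, b] = H₁ := by
  have hba : star b * a = 1 := by
    have := congrArg star hab
    simpa using this
  rw [Matrix.diagonal_conjTranspose]
  refine Matrix.ext fun i j => ?_
  rw [Matrix.mul_diagonal, Matrix.diagonal_mul]
  fin_cases i <;> fin_cases j <;> simp [H₁, hab, hba, hu]

/-- Normalized quadruples with the same invariants are congruent. -/
theorem normalQuad_congruent {α μ β ν α' μ' β' ν' : ℍ[ℝ]} (hz : IsNullQuad (normalQuad α μ β ν))
    (hz' : IsNullQuad (normalQuad α' μ' β' ν'))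
    (h : quadInvariants (normalQuad α μ β ν) = quadInvariants (normalQuad α' μ' β' ν')) :
    ∃ (D : Sp21) (q : Fin 4 → ℍ[ℝ]), (∀ i, q i ≠ 0) ∧
      ∀ i, mat D *ᵥ normalQuad α μ β ν i = normalQuad α' μ' β' ν' i <• q i := by
  obtain ⟨c, hc⟩ : ∃ c, c = star α + β + star μ * ν := ⟨_, rfl⟩
  obtain ⟨c', hc'⟩ : ∃ c', c' = star α' + β' + star μ' * ν' := ⟨_, rfl⟩
  rw [normalQuad_invariants _ _ _ _ c hc, normalQuad_invariants _ _ _ _ c' hc', Prod.mk.injEq] at h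
  obtain ⟨hx, ha⟩ := h
  obtain ⟨-, -, -, h21, -, h31, -, -, -, -, h32, -, h22, h33⟩ := normalQuad_herm α μ β ν _ rfl
  obtain ⟨-, -, -, h21', -, h31', -, -, -, -, h32', -, h22', h33'⟩ :=
    normalQuad_herm α' μ' β' ν' _ rfl
  have n22 : 2 * α.re + Quaternion.normSq μ = 0 := by rw [← h22, (hz.null 2).2]; rfl
  have n33 : 2 * β.re + Quaternion.normSq ν = 0 := by rw [← h33, (hz.null 3).2]; rfl
  have n22' : 2 * α'.re + Quaternion.normSq μ' = 0 := by rw [← h22', (hz'.null 2).2]; rfl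
  have n33' : 2 * β'.re + Quaternion.normSq ν' = 0 := by rw [← h33', (hz'.null 3).2]; rfl
  obtain ⟨t, v, ht, hv, hv', vα, vβ, vc⟩ := exists_similarity (α := α) (β := β) (c := c) (α' := α')
    (β' := β') (c' := c')
    (h21 ▸ hz.distinct 2 1 (by decide)) (h31 ▸ hz.distinct 3 1 (by decide))
    (hc ▸ h32 ▸ hz.distinct 3 2 (by decide)) (h21' ▸ hz'.distinct 2 1 (by decide))
    (h31' ▸ hz'.distinct 3 1 (by decide)) (hc' ▸ h32' ▸ hz'.distinct 3 2 (by decide))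
    (congrFun hx 0) (congrFun hx 1) (congrFun hx 2) (congrFun ha 0) (congrFun ha 1) (congrFun ha 2)
    (congrFun ha 3)
  -- The isometry sought is diag(sv, u, s⁻¹v). It takes (α, μ, 1) to (α', μ', 1)s⁻¹v exactly when
  -- s²vα = α'v and uμ = μ's⁻¹v, whence s² = t.
  obtain ⟨s, hs⟩ : ∃ s, s = Real.sqrt t := ⟨_, rfl⟩
  have hs0 : 0 < s := hs ▸ Real.sqrt_pos.2 ht
  have hst : t = s * s := by rw [hs, Real.mul_self_sqrt ht.le]
  have hvn := norm_of_star_mul_self hv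
  have hv0 : v ≠ 0 := by rintro rfl; simp at hv
  have hre : ∀ q q' : ℍ[ℝ], t • (v * q) = q' * v → q'.re = t * q.re := by
    intro q q' hq
    have e := congrArg (fun x : ℍ[ℝ] => (x * star v).re) hq
    simp only [smul_mul_assoc, Quaternion.re_smul, re_conj_unit hv, mul_assoc q', hv', mul_one] at e
    exact e.symm
  -- Nullity of the third vector reads |μ|² = −2 Re α, and Re α scales by t.
  have mμ : Quaternion.normSq μ' = t * Quaternion.normSq μ := by
    have := hre _ _ vα; nlinarith
  have mν : Quaternion.normSq ν' = t * Quaternion.normSq ν := by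
    have := hre _ _ vβ; nlinarith
  rw [Quaternion.normSq_eq_norm_mul_self, Quaternion.normSq_eq_norm_mul_self] at mμ mν
  have sμ : ‖μ'‖ = s * ‖μ‖ := by
    rw [← mul_self_inj_of_nonneg (norm_nonneg _) (by positivity), mμ, hst]; ring
  have sν : ‖ν'‖ = s * ‖ν‖ := by
    rw [← mul_self_inj_of_nonneg (norm_nonneg _) (by positivity), mν, hst]; ring
  -- The middle coordinates enter c only through μ̄ν = c − ᾱ − β, so this quantity is intertwined as
  -- well.
  have vm : t • (v * (star μ * ν)) = star μ' * ν' * v := by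
    have e1 : star μ * ν = c - star α - β := by rw [hc]; abel
    have e2 : star μ' * ν' = c' - star α' - β' := by rw [hc']; abel
    have e3 : t • (v * star α) = star α' * v := by
      have h1 := congrArg star vα
      rw [Quaternion.star_smul, star_mul, star_mul] at h1
      have h2 := congrArg (fun x => v * x * v) h1
      simp only [mul_smul_comm, smul_mul_assoc] at h2
      rw [mul_assoc, mul_assoc, hv, mul_one, ← mul_assoc v (star v), hv', one_mul] at h2
      exact h2
    rw [e1, e2, mul_sub, mul_sub, sub_mul, sub_mul, smul_sub, smul_sub, vc, e3, vβ]
  obtain ⟨u, hu, huμ, huν⟩ := exists_middle (μ := μ) (ν := ν) (μ' := μ') (ν' := ν')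
    (l := s⁻¹ • v) (k := t) (smul_ne_zero (inv_pos.2 hs0).ne' hv0)
    (by rw [norm_smul, hvn, Real.norm_of_nonneg (inv_pos.2 hs0).le, sμ]; field_simp)
    (by rw [norm_smul, hvn, Real.norm_of_nonneg (inv_pos.2 hs0).le, sν]; field_simp)
    (by rw [mul_smul_comm, ← vm, smul_mul_assoc, smul_comm]) mμ
  have hrel : star (s • v) * (s⁻¹ • v) = 1 := by
    rw [Quaternion.star_smul, smul_mul_smul_comm, hv]
    rw [mul_inv_cancel₀ hs0.ne', one_smul]
  have hscale : ∀ q q' : ℍ[ℝ], t • (v * q) = q' * v → s • v * q = q' * (s⁻¹ • v) := by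
    intro q q' hq
    rw [mul_smul_comm, ← hq, smul_smul, smul_mul_assoc, hst]
    congr 1
    field_simp
  refine ⟨mkSp _ (diagonal_rel hrel hu), ![s • v, s⁻¹ • v, s⁻¹ • v, s⁻¹ • v], ?_, ?_⟩
  · have p1 : s • v ≠ 0 := smul_ne_zero hs0.ne' hv0
    have p2 : s⁻¹ • v ≠ 0 := smul_ne_zero (inv_pos.2 hs0).ne' hv0
    intro i; fin_cases i
    exacts [p1, p2, p2, p2]
  · intro i
    ext1 j
    rw [mat_mkSp, Matrix.mulVec_diagonal, rsmul_apply]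
    fin_cases i
    · fin_cases j <;> simp [normalQuad]
    · fin_cases j <;> simp [normalQuad]
    · fin_cases j
      · exact hscale _ _ vα
      · exact huμ
      · simp [normalQuad]
    · fin_cases j
      · exact hscale _ _ vβ
      · exact huν
      · simp [normalQuad]

/-- Quadruples of distinct boundary points with the same invariants are congruent. -/
theorem IsNullQuad.congruent {z w : Fin 4 → V} (hz : IsNullQuad z) (hw : IsNullQuad w)
    (h : quadInvariants z = quadInvariants w) :
    ∃ k : Sp21, ∀ i, ∃ q : ℍ[ℝ], mat k *ᵥ z i = w i <• q := by
  obtain ⟨a, p, α, μ, β, ν, hp, ha⟩ := hz.exists_normal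
  obtain ⟨b, r, α', μ', β', ν', hr, hb⟩ := hw.exists_normal
  obtain ⟨D, q, hq, hD⟩ := normalQuad_congruent (hz.congr hp ha) (hw.congr hr hb) (by
    rw [← quadInvariants_congr hp ha, ← quadInvariants_congr hr hb, h])
  refine ⟨b⁻¹ * D * a, fun i => ⟨(r i)⁻¹ * (q i * p i), ?_⟩⟩
  have e : normalQuad α' μ' β' ν' i = mat b *ᵥ (w i <• (r i)⁻¹) := by
    rw [mulVec_rsmul, hb, rsmul_rsmul, mul_inv_cancel₀ (hr i), rsmul_one]
  rw [mat_mul, mat_mul, ← Matrix.mulVec_mulVec, ← Matrix.mulVec_mulVec, ha, mulVec_rsmul, hD, e,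
    mulVec_rsmul, mulVec_rsmul, mat_inv_mulVec, rsmul_rsmul, rsmul_rsmul]

end

section

/-! ### Fixed points of loxodromic elements -/

theorem norm_E_diag {r θ φ : ℝ} (h : IsLoxParam r θ φ) (i : Fin 3) :
    ‖((eig r θ φ i : ℂ) : ℍ[ℝ])‖ = ![r, 1, r⁻¹] i := by
  rw [norm_coeComplex, norm_eig h]

/-- The eigenvalue moduli along the second and third columns are 1 and 1/r, so an eigenvalue of
modulus below 1 leaves only the first coordinate. -/
theorem eigenvector_of_norm_lt {A Q : Sp21} {r θ φ : ℝ} (hp : IsLoxParam r θ φ)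
    (h : mat A * mat Q = mat Q * E r θ φ) {v : V} {q : ℍ[ℝ]} (hq : ‖q‖ < 1)
    (hv : IsEigenvector A q v) : ∃ c : ℍ[ℝ], c ≠ 0 ∧ v = col Q 0 <• c := by
  rw [E_eq_eig] at h
  have hr : 1 < r⁻¹ := (one_lt_inv₀ hp.1.1).2 hp.1.2
  have key := eigenvector_coords h hv.2
  have h1 : (mat Q⁻¹ *ᵥ v) 1 = 0 := eq_zero_of_mul_eq_mul_of_norm_ne (by
    rw [norm_E_diag hp]; simp; linarith) (key 1)
  have h2 : (mat Q⁻¹ *ᵥ v) 2 = 0 := eq_zero_of_mul_eq_mul_of_norm_ne (by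
    rw [norm_E_diag hp]; simp; linarith) (key 2)
  have e := expand_col Q v
  rw [h1, h2, rsmul_zero, rsmul_zero, add_zero, add_zero] at e
  refine ⟨_, fun h0 => hv.1 ?_, e⟩
  rw [e, h0, rsmul_zero]

theorem eigenvector_of_one_lt_norm {A Q : Sp21} {r θ φ : ℝ} (hp : IsLoxParam r θ φ)
    (h : mat A * mat Q = mat Q * E r θ φ) {v : V} {q : ℍ[ℝ]} (hq : 1 < ‖q‖)
    (hv : IsEigenvector A q v) : ∃ c : ℍ[ℝ], c ≠ 0 ∧ v = col Q 2 <• c := by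
  rw [E_eq_eig] at h
  have hr : r < 1 := hp.1.2
  have key := eigenvector_coords h hv.2
  have h1 : (mat Q⁻¹ *ᵥ v) 1 = 0 := eq_zero_of_mul_eq_mul_of_norm_ne (by
    rw [norm_E_diag hp]; simp; linarith) (key 1)
  have h2 : (mat Q⁻¹ *ᵥ v) 0 = 0 := eq_zero_of_mul_eq_mul_of_norm_ne (by
    rw [norm_E_diag hp]; simp; linarith) (key 0)
  have e := expand_col Q v
  rw [h1, h2, rsmul_zero, rsmul_zero, zero_add, zero_add] at e
  refine ⟨_, fun h0 => hv.1 ?_, e⟩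
  rw [e, h0, rsmul_zero]

theorem col_eigen {A Q : Sp21} {r θ φ : ℝ} (h : mat A * mat Q = mat Q * E r θ φ) (i : Fin 3) :
    mat A *ᵥ col Q i = col Q i <• ((eig r θ φ i : ℂ) : ℍ[ℝ]) := by
  rw [E_eq_eig] at h
  exact mulVec_col h i

theorem col_isEigenvector {A Q : Sp21} {r θ φ : ℝ} (h : mat A * mat Q = mat Q * E r θ φ)
    (i : Fin 3) : IsEigenvector A ((eig r θ φ i : ℂ) : ℍ[ℝ]) (col Q i) :=
  ⟨col_ne_zero Q i, col_eigen h i⟩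

theorem IsLoxodromic.attracting_spec {A : Sp21} (hA : IsLoxodromic A) :
    ∃ q : ℍ[ℝ], ‖q‖ < 1 ∧ IsEigenvector A q (attracting A) := by
  obtain ⟨Q, r, θ, φ, hp, hQ⟩ := hA.exists_normal_form
  refine Classical.epsilon_spec (p := fun v => ∃ q : ℍ[ℝ], ‖q‖ < 1 ∧ IsEigenvector A q v)
    ⟨col Q 0, _, ?_, col_isEigenvector hQ 0⟩
  rw [norm_E_diag hp]
  exact hp.1.2

theorem IsLoxodromic.repelling_spec {A : Sp21} (hA : IsLoxodromic A) :
    ∃ q : ℍ[ℝ], 1 < ‖q‖ ∧ IsEigenvector A q (repelling A) := by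
  obtain ⟨Q, r, θ, φ, hp, hQ⟩ := hA.exists_normal_form
  refine Classical.epsilon_spec (p := fun v => ∃ q : ℍ[ℝ], 1 < ‖q‖ ∧ IsEigenvector A q v)
    ⟨col Q 2, _, ?_, col_isEigenvector hQ 2⟩
  rw [norm_E_diag hp]
  exact (one_lt_inv₀ hp.1.1).2 hp.1.2

theorem rsmul_line {u v w : V} {c d : ℍ[ℝ]} (hd : d ≠ 0) (hv : v = u <• c) (hw : w = u <• d)
    (hc : c ≠ 0) : ∃ e : ℍ[ℝ], e ≠ 0 ∧ v = w <• e := by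
  refine ⟨d⁻¹ * c, mul_ne_zero (inv_ne_zero hd) hc, ?_⟩
  rw [hw, rsmul_rsmul, mul_inv_cancel_left₀ hd, hv]

theorem IsLoxodromic.eq_attracting {A : Sp21} (hA : IsLoxodromic A) {v : V} {q : ℍ[ℝ]}
    (hq : ‖q‖ < 1) (hv : IsEigenvector A q v) : ∃ c : ℍ[ℝ], c ≠ 0 ∧ v = attracting A <• c := by
  obtain ⟨Q, r, θ, φ, hp, hQ⟩ := hA.exists_normal_form
  obtain ⟨q', hq', hv'⟩ := hA.attracting_spec
  obtain ⟨c, hc, h⟩ := eigenvector_of_norm_lt hp hQ hq hv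
  obtain ⟨d, hd, h'⟩ := eigenvector_of_norm_lt hp hQ hq' hv'
  exact rsmul_line hd h h' hc

theorem IsLoxodromic.eq_repelling {A : Sp21} (hA : IsLoxodromic A) {v : V} {q : ℍ[ℝ]}
    (hq : 1 < ‖q‖) (hv : IsEigenvector A q v) : ∃ c : ℍ[ℝ], c ≠ 0 ∧ v = repelling A <• c := by
  obtain ⟨Q, r, θ, φ, hp, hQ⟩ := hA.exists_normal_form
  obtain ⟨q', hq', hv'⟩ := hA.repelling_spec
  obtain ⟨c, hc, h⟩ := eigenvector_of_one_lt_norm hp hQ hq hv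
  obtain ⟨d, hd, h'⟩ := eigenvector_of_one_lt_norm hp hQ hq' hv'
  exact rsmul_line hd h h' hc

theorem IsEigenvector.conj {A : Sp21} {q : ℍ[ℝ]} {v : V} (hv : IsEigenvector A q v) (h : Sp21) :
    IsEigenvector (h * A * h⁻¹) q (mat h *ᵥ v) := by
  refine ⟨mat_mulVec_ne_zero h hv.1, ?_⟩
  rw [mat_mul, mat_mul, ← Matrix.mulVec_mulVec, ← Matrix.mulVec_mulVec, mat_inv_mulVec, hv.2,
    mulVec_rsmul]

/-- The lifts are arbitrary choices, so conjugation respects them only up to right scalars. -/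
theorem fixedQuad_conj {A B : Sp21} (h : Sp21) (hA : IsLoxodromic A) (hB : IsLoxodromic B)
    (hA' : IsLoxodromic (h * A * h⁻¹)) (hB' : IsLoxodromic (h * B * h⁻¹)) :
    ∃ q : Fin 4 → ℍ[ℝ], (∀ i, q i ≠ 0) ∧
      ∀ i, mat h *ᵥ fixedQuad A B i = fixedQuad (h * A * h⁻¹) (h * B * h⁻¹) i <• q i := by
  have key : ∀ i, ∃ q : ℍ[ℝ], q ≠ 0 ∧
      mat h *ᵥ fixedQuad A B i = fixedQuad (h * A * h⁻¹) (h * B * h⁻¹) i <• q := by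
    intro i
    obtain ⟨a, ha, ha'⟩ := hA.attracting_spec
    obtain ⟨b, hb, hb'⟩ := hA.repelling_spec
    obtain ⟨c, hc, hc'⟩ := hB.attracting_spec
    obtain ⟨d, hd, hd'⟩ := hB.repelling_spec
    fin_cases i
    · exact hA'.eq_attracting ha (ha'.conj h)
    · exact hA'.eq_repelling hb (hb'.conj h)
    · exact hB'.eq_attracting hc (hc'.conj h)
    · exact hB'.eq_repelling hd (hd'.conj h)
  choose q hq hq' using key
  exact ⟨q, hq, hq'⟩

/-- Both pairs have the same invariants, hence the same reference frame. If k moves the conjugated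
quadruple there, then kh moves the original one, with the same resulting conjugates. -/
theorem projectivePoints_conj_subset {A B : Sp21} (h : Sp21) (hA : IsLoxodromic A)
    (hB : IsLoxodromic B) (hA' : IsLoxodromic (h * A * h⁻¹)) (hB' : IsLoxodromic (h * B * h⁻¹)) :
    projectivePoints (h * A * h⁻¹) (h * B * h⁻¹) ⊆ projectivePoints A B := by
  obtain ⟨q, hq, hh⟩ := fixedQuad_conj h hA hB hA' hB'
  have hinv := quadInvariants_congr hq hh
  rintro p ⟨k, hk, rfl⟩
  rw [← hinv] at hk ⊢
  refine ⟨k * h, fun i => ?_, ?_⟩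
  · obtain ⟨c, hc⟩ := hk i
    refine ⟨c * q i, ?_⟩
    rw [mat_mul, ← Matrix.mulVec_mulVec, hh, mulVec_rsmul, hc, rsmul_rsmul]
  · have e : ∀ X : Sp21, k * (h * X * h⁻¹) * k⁻¹ = k * h * X * (k * h)⁻¹ := fun X => by group
    simp only [e]

theorem pairParameters_conj {A B : Sp21} (h : Sp21) (hA : IsLoxodromic A)
    (hB : IsLoxodromic B) (hA' : IsLoxodromic (h * A * h⁻¹)) (hB' : IsLoxodromic (h * B * h⁻¹)) :
    pairParameters (h * A * h⁻¹) (h * B * h⁻¹) = pairParameters A B := by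
  obtain ⟨q, hq, hh⟩ := fixedQuad_conj h hA hB hA' hB'
  have hinv := quadInvariants_congr hq hh
  have e : ∀ X : Sp21, h⁻¹ * (h * X * h⁻¹) * h⁻¹⁻¹ = X := fun X => by group
  have hsub := projectivePoints_conj_subset h⁻¹ hA' hB' (by rwa [e]) (by rwa [e])
  rw [e, e] at hsub
  simp only [pairParameters, realTrace_conj, ← hinv,
    (projectivePoints_conj_subset h hA hB hA' hB').antisymm hsub]

/-! ### Pairs are determined by their parameters -/

theorem IsEigenvector.null {A : Sp21} {q : ℍ[ℝ]} {v : V} (hv : IsEigenvector A q v)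
    (hq : ‖q‖ ≠ 1) : herm v v = 0 := by
  rw [herm_self_eq_zero_iff]
  have h := congrArg (fun x : ℍ[ℝ] => x.re) (herm_mat A v v)
  simp only [hv.2, herm_self_rsmul] at h
  by_contra h0
  apply hq
  have : ‖q‖ ^ 2 = 1 := mul_right_cancel₀ h0 (by rw [h, one_mul])
  nlinarith [norm_nonneg q]

theorem IsLoxodromic.herm_attracting_repelling {A : Sp21} (hA : IsLoxodromic A) :
    herm (attracting A) (repelling A) ≠ 0 := by
  obtain ⟨Q, r, θ, φ, hp, hQ⟩ := hA.exists_normal_form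
  obtain ⟨q, hq, hv⟩ := hA.attracting_spec
  obtain ⟨q', hq', hv'⟩ := hA.repelling_spec
  obtain ⟨c, hc, h⟩ := eigenvector_of_norm_lt hp hQ hq hv
  obtain ⟨d, hd, h'⟩ := eigenvector_of_one_lt_norm hp hQ hq' hv'
  rw [h, h', herm_rsmul_left, herm_rsmul_right, herm_col]
  simp [H₁, hc, hd]

/-- Orthogonal null vectors are proportional, so an orthogonality between a fixed point of A and one
of B would be a common fixed boundary point. -/
theorem isNullQuad_fixedQuad {A B : Sp21} (hirr : IsIrreducible A B) (hA : IsLoxodromic A)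
    (hB : IsLoxodromic B) : IsNullQuad (fixedQuad A B) := by
  obtain ⟨a, ha, ha'⟩ := hA.attracting_spec
  obtain ⟨b, hb, hb'⟩ := hA.repelling_spec
  obtain ⟨c, hc, hc'⟩ := hB.attracting_spec
  obtain ⟨d, hd, hd'⟩ := hB.repelling_spec
  have key : ∀ {v w : V} {p q : ℍ[ℝ]}, IsEigenvector A p v → IsEigenvector B q w → ‖p‖ ≠ 1 →
      ‖q‖ ≠ 1 → herm v w ≠ 0 := by
    intro v w p q hv hw hp hq h0
    obtain ⟨e, he⟩ := (orthogonal_null hv.1 (hv.null hp) (herm_comm_eq_zero h0)).2 (hw.null hq)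
    have he0 : e ≠ 0 := by
      rintro rfl
      exact hw.1 (by rw [he, rsmul_zero])
    refine hirr.no_common_null hv.1 (hv.null hp) ⟨p, hv.2⟩ ⟨e * q * e⁻¹, ?_⟩
    have hve : v = w <• e⁻¹ := by rw [he, rsmul_rsmul, mul_inv_cancel₀ he0, rsmul_one]
    conv_lhs => rw [hve, mulVec_rsmul, hw.2, he]
    simp only [rsmul_rsmul]
  have hall : ∀ i j, i ≠ j → herm (fixedQuad A B i) (fixedQuad A B j) ≠ 0 := by
    have hAA := hA.herm_attracting_repelling
    have hBB := hB.herm_attracting_repelling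
    have h02 := key ha' hc' ha.ne hc.ne
    have h03 := key ha' hd' ha.ne hd.ne'
    have h12 := key hb' hc' hb.ne' hc.ne
    have h13 := key hb' hd' hb.ne' hd.ne'
    intro i j hij
    fin_cases i <;> fin_cases j <;> first | exact absurd rfl hij | skip
    · exact hAA
    · exact h02
    · exact h03
    · exact fun h => hAA (herm_comm_eq_zero h)
    · exact h12
    · exact h13
    · exact fun h => h02 (herm_comm_eq_zero h)
    · exact fun h => h12 (herm_comm_eq_zero h)
    · exact hBB
    · exact fun h => h03 (herm_comm_eq_zero h)
    · exact fun h => h13 (herm_comm_eq_zero h)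
    · exact fun h => hBB (herm_comm_eq_zero h)
  refine ⟨fun i => ?_, hall⟩
  fin_cases i
  · exact ⟨ha'.1, ha'.null ha.ne⟩
  · exact ⟨hb'.1, hb'.null hb.ne'⟩
  · exact ⟨hc'.1, hc'.null hc.ne⟩
  · exact ⟨hd'.1, hd'.null hd.ne'⟩

theorem IsLoxodromic.exists_polar_vector {A : Sp21} (hA : IsLoxodromic A) :
    ∃ x : V, x ≠ 0 ∧ herm x (attracting A) = 0 ∧ herm x (repelling A) = 0 := by
  obtain ⟨Q, r, θ, φ, hp, hQ⟩ := hA.exists_normal_form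
  obtain ⟨q, hq, hv⟩ := hA.attracting_spec
  obtain ⟨q', hq', hv'⟩ := hA.repelling_spec
  obtain ⟨c, hc, h⟩ := eigenvector_of_norm_lt hp hQ hq hv
  obtain ⟨d, hd, h'⟩ := eigenvector_of_one_lt_norm hp hQ hq' hv'
  refine ⟨col Q 1, col_ne_zero Q 1, ?_, ?_⟩
  · rw [h, herm_rsmul_right, herm_col]; simp [H₁]
  · rw [h', herm_rsmul_right, herm_col]; simp [H₁]

/-- The fixed points themselves with their polar vectors form a reference configuration, so the
choice operator is not applied to an empty predicate. -/
theorem refFrame_spec {A B : Sp21} (hirr : IsIrreducible A B) (hA : IsLoxodromic A)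
    (hB : IsLoxodromic B) :
    IsRefFrame (quadInvariants (fixedQuad A B)) (refFrame (quadInvariants (fixedQuad A B))).1
      (refFrame (quadInvariants (fixedQuad A B))).2 := by
  obtain ⟨x, hx, hx1, hx2⟩ := hA.exists_polar_vector
  obtain ⟨y, hy, hy1, hy2⟩ := hB.exists_polar_vector
  have hq := isNullQuad_fixedQuad hirr hA hB
  refine Classical.epsilon_spec (p := fun F : (Fin 4 → V) × (Fin 2 → V) =>
    IsRefFrame (quadInvariants (fixedQuad A B)) F.1 F.2) ⟨(fixedQuad A B, ![x, y]), ?_⟩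
  exact
    { null := hq.null
      distinct := hq.distinct
      inv := rfl
      polar_ne := fun k => by fin_cases k; exacts [hx, hy]
      polar_left := ⟨hx1, hx2⟩
      polar_right := ⟨hy1, hy2⟩ }

theorem projectivePoints_nonempty {A B : Sp21} (hirr : IsIrreducible A B) (hA : IsLoxodromic A)
    (hB : IsLoxodromic B) : (projectivePoints A B).Nonempty := by
  have hF := refFrame_spec hirr hA hB
  obtain ⟨k, hk⟩ := (isNullQuad_fixedQuad hirr hA hB).congruent ⟨hF.null, hF.distinct⟩ hF.inv.symm
  exact ⟨_, k, hk, rfl⟩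

theorem eq_of_col {T T' Q : Sp21} (h : ∀ i, mat T *ᵥ col Q i = mat T' *ᵥ col Q i) : T = T' := by
  have h1 : mat T * mat Q = mat T' * mat Q := by
    refine Matrix.ext fun i j => ?_
    have := congrFun (h j) i
    simp only [col, Matrix.mulVec_single_one] at this
    exact this
  apply mat_injective
  have := congrArg (· * mat Q⁻¹) h1
  simpa only [mul_assoc, mat_mul_inv, mul_one] using this

theorem mulVec_line {T Q : Sp21} {r θ φ : ℝ} (h : mat T * mat Q = mat Q * E r θ φ) {i : Fin 3}
    {z : V} {a : ℍ[ℝ]} (ha : a ≠ 0) (hz : z = col Q i <• a) :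
    mat T *ᵥ z = z <• (a⁻¹ * ((eig r θ φ i : ℂ) : ℍ[ℝ]) * a) := by
  rw [hz, mulVec_rsmul, col_eigen h, rsmul_rsmul, rsmul_rsmul, ← mul_assoc, ← mul_assoc,
    mul_inv_cancel₀ ha, one_mul]

/-- The eigenvalue and the projective point on an eigenline determine the action on it. -/
theorem eq_on_line {T T' : Sp21} {z : V} {a b : ℍ[ℝ]} {l : ℂ} (hz : z ≠ 0) (ha : a ≠ 0)
    (hb : b ≠ 0) (hl : 0 < l.im) (hT : mat T *ᵥ z = z <• (a⁻¹ * (l : ℍ[ℝ]) * a))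
    (hT' : mat T' *ᵥ z = z <• (b⁻¹ * (l : ℍ[ℝ]) * b)) (h : projPoint T z = projPoint T' z) :
    mat T *ᵥ z = mat T' *ᵥ z := by
  -- The vector z a⁻¹ is an eigenvector of T for l itself. Read for T', this says that ba⁻¹
  -- intertwines l with some l' in the upper half plane; so l' = l, and the two multipliers on z
  -- agree.
  have hmem : a⁻¹ ∈ projPoint T z := by
    refine ⟨l, hl, ?_⟩
    rw [mulVec_rsmul, hT, rsmul_rsmul, rsmul_rsmul, mul_assoc, mul_inv_cancel₀ ha, mul_one]
  rw [h] at hmem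
  obtain ⟨l', hl', e⟩ := hmem
  rw [mulVec_rsmul, hT', rsmul_rsmul, rsmul_rsmul] at e
  have e := rsmul_injective hz e
  have e2 : (l : ℍ[ℝ]) * (b * a⁻¹) = (b * a⁻¹) * (l' : ℍ[ℝ]) := by
    have := congrArg (b * ·) e
    simp only [← mul_assoc, mul_inv_cancel₀ hb, one_mul] at this
    simpa only [mul_assoc] using this
  obtain rfl := eq_of_conj_upper (mul_ne_zero hb (inv_ne_zero ha)) hl hl' e2
  rw [hT, hT', ← e, mul_assoc, mul_assoc, mul_assoc, inv_mul_cancel₀ ha, mul_one, mul_assoc]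

/-- A loxodromic element is determined by its fixed points, its real trace and its projective
points. -/
theorem eq_of_projPoint {T T' : Sp21} (hT : IsLoxodromic T) (hT' : IsLoxodromic T')
    (ht : realTrace T = realTrace T') {z w x : V} {p q p' q' : ℍ[ℝ]} (hp : ‖p‖ < 1) (hq : 1 < ‖q‖)
    (hp' : ‖p'‖ < 1) (hq' : 1 < ‖q'‖) (hz : IsEigenvector T p z) (hw : IsEigenvector T q w)
    (hz' : IsEigenvector T' p' z) (hw' : IsEigenvector T' q' w) (hx0 : x ≠ 0)
    (hxz : herm x z = 0) (hxw : herm x w = 0) (h1 : projPoint T z = projPoint T' z)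
    (h2 : projPoint T x = projPoint T' x) : T = T' := by
  obtain ⟨Q, r, θ, φ, hP, hQ⟩ := hT.exists_normal_form
  obtain ⟨Q', r', θ', φ', hP', hQ'⟩ := hT'.exists_normal_form
  have hE := eig_eq_of_realTrace hP hP' hQ hQ' ht
  obtain ⟨a, ha, hza⟩ := eigenvector_of_norm_lt hP hQ hp hz
  obtain ⟨c, hc, hwc⟩ := eigenvector_of_one_lt_norm hP hQ hq hw
  obtain ⟨a', ha', hza'⟩ := eigenvector_of_norm_lt hP' hQ' hp' hz'
  obtain ⟨c', hc', hwc'⟩ := eigenvector_of_one_lt_norm hP' hQ' hq' hw'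
  -- The orthogonal complement of the first and third columns is the line of the second, so x is an
  -- eigenvector of both elements.
  have polar : ∀ (Q : Sp21) (a c : ℍ[ℝ]), a ≠ 0 → c ≠ 0 → z = col Q 0 <• a → w = col Q 2 <• c →
      ∃ b : ℍ[ℝ], b ≠ 0 ∧ x = col Q 1 <• b := by
    intro Q a c ha hc hza hwc
    have e := expand_col Q x
    have k0 : (mat Q⁻¹ *ᵥ x) 0 = 0 := by
      rw [e, hwc, herm_rsmul_right, mul_eq_zero] at hxw
      have := hxw.resolve_left (by simpa using hc)
      simp only [herm_add_left, herm_rsmul_left, herm_col] at this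
      simpa [H₁] using this
    have k2 : (mat Q⁻¹ *ᵥ x) 2 = 0 := by
      rw [e, hza, herm_rsmul_right, mul_eq_zero] at hxz
      have := hxz.resolve_left (by simpa using ha)
      simp only [herm_add_left, herm_rsmul_left, herm_col] at this
      simpa [H₁] using this
    rw [k0, k2, rsmul_zero, rsmul_zero, zero_add, add_zero] at e
    exact ⟨_, fun h0 => hx0 (by rw [e, h0, rsmul_zero]), e⟩
  obtain ⟨b, hb, hxb⟩ := polar Q a c ha hc hza hwc
  obtain ⟨b', hb', hxb'⟩ := polar Q' a' c' ha' hc' hza' hwc'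
  have tz : mat T *ᵥ z = mat T' *ᵥ z := by
    refine eq_on_line hz.1 ha ha' (eig_im_pos hP 0) (mulVec_line hQ ha hza) ?_ h1
    rw [hE]
    exact mulVec_line hQ' ha' hza'
  have tx : mat T *ᵥ x = mat T' *ᵥ x := by
    refine eq_on_line hx0 hb hb' (eig_im_pos hP 1) (mulVec_line hQ hb hxb) ?_ h2
    rw [hE]
    exact mulVec_line hQ' hb' hxb'
  -- T and T' preserve the nonzero product ⟨z,w⟩ and agree on z, so they have the same multiplier on
  -- w.
  have tw : mat T *ᵥ w = mat T' *ᵥ w := by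
    have hzw : herm z w ≠ 0 := by
      rw [hza, hwc, herm_rsmul_left, herm_rsmul_right, herm_col]
      simp [H₁, ha, hc]
    have hpp : p = p' := by
      rw [hz.2, hz'.2] at tz
      exact rsmul_injective hz.1 tz
    have hp0 : p ≠ 0 := by
      rintro rfl
      have := mat_mulVec_ne_zero T hz.1
      rw [hz.2, rsmul_zero] at this
      exact this rfl
    have e1 := herm_mat T z w
    have e2 := herm_mat T' z w
    rw [hz.2, hw.2, herm_rsmul_left, herm_rsmul_right] at e1
    rw [hz'.2, hw'.2, herm_rsmul_left, herm_rsmul_right, ← hpp] at e2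
    have e3 := mul_right_cancel₀ hzw (mul_right_cancel₀ hp0 (e1.trans e2.symm))
    rw [hw.2, hw'.2, star_injective e3]
  have descend : ∀ {i : Fin 3} {v : V} {e : ℍ[ℝ]}, e ≠ 0 → v = col Q i <• e →
      mat T *ᵥ v = mat T' *ᵥ v → mat T *ᵥ col Q i = mat T' *ᵥ col Q i := by
    intro i v e he hv h
    have : col Q i = v <• e⁻¹ := by rw [hv, rsmul_rsmul, mul_inv_cancel₀ he, rsmul_one]
    rw [this, mulVec_rsmul, mulVec_rsmul, h]
  refine eq_of_col (Q := Q) fun i => ?_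
  fin_cases i
  · exact descend ha hza tz
  · exact descend hb hxb tx
  · exact descend hc hwc tw

/-! ### Conjugates of loxodromic elements and of pairs -/

theorem act_injective (h : Sp21) : Function.Injective (act h) :=
  Projectivization.map_injective _ _

theorem act_one (p : HP2) : act 1 p = p := by
  induction p using Projectivization.ind with
  | h v hv => simp only [act_mk, mat_one, Matrix.one_mulVec]

theorem act_mem_idealBoundary (A : Sp21) {p : HP2} (hp : p ∈ idealBoundary) :
    act A p ∈ idealBoundary := by
  induction p using Projectivization.ind with
  | h v hv =>
    rw [act_mk, mk_mem_idealBoundary, herm_mat]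
    exact (mk_mem_idealBoundary hv).1 hp

theorem IsLoxodromic.conj {A : Sp21} (hA : IsLoxodromic A) (h : Sp21) :
    IsLoxodromic (h * A * h⁻¹) := by
  have hinv : ∀ p, act h (act h⁻¹ p) = p := fun p => by rw [← act_mul, mul_inv_cancel, act_one]
  have hinv' : ∀ p, act h⁻¹ (act h p) = p := fun p => by rw [← act_mul, inv_mul_cancel, act_one]
  constructor
  · have : {p | p ∈ idealBoundary ∧ act (h * A * h⁻¹) p = p} =
        act h '' {p | p ∈ idealBoundary ∧ act A p = p} := by
      ext p
      constructor
      · rintro ⟨hp, hfix⟩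
        refine ⟨act h⁻¹ p, ⟨act_mem_idealBoundary _ hp, ?_⟩, hinv p⟩
        apply act_injective h
        rw [act_mul, act_mul] at hfix
        rw [hinv, hfix]
      · rintro ⟨p, ⟨hp, hfix⟩, rfl⟩
        refine ⟨act_mem_idealBoundary _ hp, ?_⟩
        rw [act_mul, act_mul, hinv', hfix]
    rw [IsHyperbolic, this, Set.ncard_image_of_injective _ (act_injective h)]
    exact hA.1
  · intro q v hv
    have := hv.conj h⁻¹
    have e : h⁻¹ * (h * A * h⁻¹) * h⁻¹⁻¹ = A := by group
    rw [e] at this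
    exact hA.2 _ _ this

theorem IsLoxodromic.inv {A : Sp21} (hA : IsLoxodromic A) : IsLoxodromic A⁻¹ := by
  constructor
  · have : {p | p ∈ idealBoundary ∧ act A⁻¹ p = p} = {p | p ∈ idealBoundary ∧ act A p = p} := by
      ext p
      refine and_congr_right fun _ => ⟨fun h => ?_, fun h => ?_⟩
      · conv_lhs => rw [← h]
        rw [← act_mul, mul_inv_cancel, act_one]
      · conv_lhs => rw [← h]
        rw [← act_mul, inv_mul_cancel, act_one]
    rw [IsHyperbolic, this]
    exact hA.1
  · intro q v hv hq
    have hq0 : q ≠ 0 := by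
      rintro rfl
      have := mat_mulVec_ne_zero A⁻¹ hv.1
      rw [hv.2, rsmul_zero] at this
      exact this rfl
    refine hA.2 q⁻¹ v ⟨hv.1, ?_⟩ ?_
    · have e : v = (mat A *ᵥ v) <• q := by rw [← mulVec_rsmul, ← hv.2, mat_mulVec_inv]
      conv_rhs => rw [e]
      rw [rsmul_rsmul, mul_inv_cancel₀ hq0, rsmul_one]
    · rw [Quaternion.inv_def, Quaternion.im_smul, Quaternion.im_star, hq]
      simp

/-- Irreducible pairs of loxodromic elements with the same parameters are conjugate. -/
theorem exists_conj_of_pairParameters {A B A' B' : Sp21} (hirr : IsIrreducible A B)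
    (hA : IsLoxodromic A) (hB : IsLoxodromic B)
    (hA' : IsLoxodromic A') (hB' : IsLoxodromic B')
    (h : pairParameters A B = pairParameters A' B') :
    ∃ k : Sp21, k * A * k⁻¹ = A' ∧ k * B * k⁻¹ = B' := by
  have htA : realTrace A = realTrace A' := congrArg PantsParameters.traceA h
  have htB : realTrace B = realTrace B' := congrArg PantsParameters.traceB h
  have hinv : quadInvariants (fixedQuad A B) = quadInvariants (fixedQuad A' B') :=
    Prod.ext (congrArg PantsParameters.crossRatios h) (congrArg PantsParameters.angles h)
  have hpp : projectivePoints A B = projectivePoints A' B' := congrArg PantsParameters.projPoints h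
  have hF := refFrame_spec hirr hA hB
  -- One common member of the two orbits provides k and k' for which the conjugated pairs have the
  -- same fixed points and the same projective points in the reference frame; these conjugates then
  -- coincide.
  obtain ⟨p, hp⟩ := projectivePoints_nonempty hirr hA hB
  have hp' := hp
  rw [hpp] at hp'
  obtain ⟨k, hk, e⟩ := hp
  obtain ⟨k', hk', e'⟩ := hp'
  rw [← hinv] at hk' e'
  generalize refFrame (quadInvariants (fixedQuad A B)) = F at *
  rw [e] at e'
  have line : ∀ {X k : Sp21} {v w : V} {q c : ℍ[ℝ]}, IsEigenvector X q v → w ≠ 0 →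
      mat k *ᵥ v = w <• c → ∃ q' : ℍ[ℝ], ‖q'‖ = ‖q‖ ∧ IsEigenvector (k * X * k⁻¹) q' w := by
    intro X k v w q c hv hw hc
    have hc0 : c ≠ 0 := by
      rintro rfl
      have := mat_mulVec_ne_zero k hv.1
      rw [hc, rsmul_zero] at this
      exact this rfl
    refine ⟨c * q * c⁻¹, ?_, hw, ?_⟩
    · rw [norm_mul, norm_mul, norm_inv, mul_comm ‖c‖, mul_assoc,
        mul_inv_cancel₀ (norm_ne_zero_iff.2 hc0), mul_one]
    · have h1 := (hv.conj k).2
      rw [hc] at h1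
      have h2 : w = (w <• c) <• c⁻¹ := by rw [rsmul_rsmul, mul_inv_cancel₀ hc0, rsmul_one]
      conv_lhs => rw [h2, mulVec_rsmul, h1]
      simp only [rsmul_rsmul]
  obtain ⟨a, ha, va⟩ := hA.attracting_spec
  obtain ⟨b, hb, vb⟩ := hA.repelling_spec
  obtain ⟨c, hc, vc⟩ := hB.attracting_spec
  obtain ⟨d, hd, vd⟩ := hB.repelling_spec
  obtain ⟨a', ha', va'⟩ := hA'.attracting_spec
  obtain ⟨b', hb', vb'⟩ := hA'.repelling_spec
  obtain ⟨c', hc', vc'⟩ := hB'.attracting_spec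
  obtain ⟨d', hd', vd'⟩ := hB'.repelling_spec
  have n := fun i => (hF.null i).1
  obtain ⟨a₁, ea, wa⟩ := line va (n 0) (hk 0).choose_spec
  obtain ⟨b₁, eb, wb⟩ := line vb (n 1) (hk 1).choose_spec
  obtain ⟨c₁, ec, wc⟩ := line vc (n 2) (hk 2).choose_spec
  obtain ⟨d₁, ed, wd⟩ := line vd (n 3) (hk 3).choose_spec
  obtain ⟨a₂, ea', wa'⟩ := line va' (n 0) (hk' 0).choose_spec
  obtain ⟨b₂, eb', wb'⟩ := line vb' (n 1) (hk' 1).choose_spec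
  obtain ⟨c₂, ec', wc'⟩ := line vc' (n 2) (hk' 2).choose_spec
  obtain ⟨d₂, ed', wd'⟩ := line vd' (n 3) (hk' 3).choose_spec
  have hAA : k * A * k⁻¹ = k' * A' * k'⁻¹ :=
    eq_of_projPoint (hA.conj k) (hA'.conj k') (by rw [realTrace_conj, realTrace_conj, htA])
      (ea ▸ ha) (eb ▸ hb) (ea' ▸ ha') (eb' ▸ hb') wa wb wa' wb' (hF.polar_ne 0) hF.polar_left.1
      hF.polar_left.2 (congrFun e' 0) (congrFun e' 1)
  have hBB : k * B * k⁻¹ = k' * B' * k'⁻¹ :=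
    eq_of_projPoint (hB.conj k) (hB'.conj k') (by rw [realTrace_conj, realTrace_conj, htB])
      (ec ▸ hc) (ed ▸ hd) (ec' ▸ hc') (ed' ▸ hd') wc wd wc' wd' (hF.polar_ne 1) hF.polar_right.1
      hF.polar_right.2 (congrFun e' 2) (congrFun e' 3)
  refine ⟨k'⁻¹ * k, ?_, ?_⟩
  · calc k'⁻¹ * k * A * (k'⁻¹ * k)⁻¹ = k'⁻¹ * (k * A * k⁻¹) * k' := by group
      _ = A' := by rw [hAA]; group
  · calc k'⁻¹ * k * B * (k'⁻¹ * k)⁻¹ = k'⁻¹ * (k * B * k⁻¹) * k' := by group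
      _ = B' := by rw [hBB]; group

end

section

/-! ### Representations determined by twist-bends -/

section Rep

variable {g : ℕ}

theorem Rep.map_mul (ρ : Rep g) (x y : SurfaceGroup g) : ρ (x * y) = ρ x * ρ y :=
  MonoidHom.map_mul (M := SurfaceGroup g) (N := Sp21) ρ x y

theorem Rep.map_one (ρ : Rep g) : ρ 1 = 1 :=
  MonoidHom.map_one (M := SurfaceGroup g) (N := Sp21) ρ

theorem Rep.map_inv (ρ : Rep g) (x : SurfaceGroup g) : ρ x⁻¹ = (ρ x)⁻¹ :=
  MonoidHom.map_inv (α := SurfaceGroup g) (β := Sp21) ρ x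

end Rep

namespace CurveSystem

variable {g : ℕ} (C : CurveSystem g)

theorem marking_rel {w : FreeGroup (GluingGen g)} (h : GluingRel C.side C.tree w) :
    C.marking (PresentedGroup.mk {w | GluingRel C.side C.tree w} w) = 1 := by
  have h' : w ∈ {w | GluingRel C.side C.tree w} := h
  rw [PresentedGroup.one_of_mem h', map_one]

theorem boundary_mul (v : Fin (2 * g - 2)) :
    C.boundary v 0 * C.boundary v 1 * C.boundary v 2 = 1 := by
  have := C.marking_rel (.pants v)
  simp only [map_mul] at this
  exact this

theorem connector_conj (j : Fin (3 * g - 3)) :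
    C.connector j * C.curve j * (C.connector j)⁻¹ *
      C.boundary (C.side (j, true)).1 (C.side (j, true)).2 = 1 := by
  have := C.marking_rel (.glue j)
  simp only [map_mul, map_inv] at this
  exact this

theorem connector_tree {j : Fin (3 * g - 3)} (hj : j ∈ C.tree) : C.connector j = 1 :=
  C.marking_rel (.tree j hj)

theorem boundary_true (j : Fin (3 * g - 3)) :
    C.boundary (C.side (j, true)).1 (C.side (j, true)).2 =
      C.connector j * (C.curve j)⁻¹ * (C.connector j)⁻¹ := by
  have := C.connector_conj j
  rw [mul_eq_one_iff_inv_eq] at this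
  rw [← this]
  group

/-- Two representations that are conjugate on the generators are conjugate. -/
theorem conjugate_of_generators {ρ ρ' : Rep g} (h : Sp21)
    (hb : ∀ v i, ρ' (C.boundary v i) = h * ρ (C.boundary v i) * h⁻¹)
    (hc : ∀ j, ρ' (C.connector j) = h * ρ (C.connector j) * h⁻¹) : Conjugate ρ ρ' := by
  refine ⟨h, fun x => ?_⟩
  let f : PresentedGroup {w | GluingRel C.side C.tree w} →* Sp21 :=
    MonoidHom.comp (N := SurfaceGroup g) (P := Sp21) ρ' C.marking.toMonoidHom
  let f' : PresentedGroup {w | GluingRel C.side C.tree w} →* Sp21 :=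
    (MulAut.conj h).toMonoidHom.comp
      (MonoidHom.comp (N := SurfaceGroup g) (P := Sp21) ρ C.marking.toMonoidHom)
  have hff : f = f' := by
    apply PresentedGroup.ext
    rintro (⟨v, i⟩ | j)
    · exact hb v i
    · exact hc j
  have : ρ' (C.marking (C.marking.symm x)) = h * ρ (C.marking (C.marking.symm x)) * h⁻¹ :=
    DFunLike.congr_fun hff (C.marking.symm x)
  rwa [MulEquiv.apply_symm_apply] at this

end CurveSystem

/-! ### Geometric representations and their twist-bends -/

variable {g : ℕ} {C : CurveSystem g}

/-- Every boundary loop lies on one side of some curve: it is the curve itself or a conjugate of its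
inverse. -/
theorem IsGeometric.boundary {ρ : Rep g} (hρ : IsGeometric C ρ) (v : Fin (2 * g - 2)) (i : Fin 3) :
    IsLoxodromic (ρ (C.boundary v i)) := by
  obtain ⟨⟨j, b⟩, hj⟩ := C.side.surjective (v, i)
  cases b
  · have := hρ.loxodromic j
    rwa [CurveSystem.curve, hj] at this
  · have := C.boundary_true j
    rw [hj] at this
    rw [this, ρ.map_mul, ρ.map_mul, ρ.map_inv, ρ.map_inv]
    exact (hρ.loxodromic j).inv.conj _

theorem pantsParameters_eq_of_conjugate {ρ ρ' : Rep g} (hρ : IsGeometric C ρ)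
    (hρ' : IsGeometric C ρ') (h : Conjugate ρ ρ') (v : Fin (2 * g - 2)) :
    pantsParameters C ρ v = pantsParameters C ρ' v := by
  obtain ⟨h, hh⟩ := h
  unfold pantsParameters
  have h0 := hρ'.boundary v 0
  have h1 := hρ'.boundary v 1
  rw [hh] at h0 h1
  rw [hh, hh, pairParameters_conj h (hρ.boundary v 0) (hρ.boundary v 1) h0 h1]

/-- Equal parameters give a conjugator on each three-holed sphere. Both ρ₀(t_j) and k_{v'} ρ(t_j)
k_v⁻¹ conjugate ρ₀(γ_j) to the inverse of the ρ₀-image of the loop on the other side, so their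
quotient commutes with ρ₀(γ_j). -/
theorem exists_hasTwistBends {ρ₀ ρ : Rep g} (hρ₀ : IsGeometric C ρ₀) (hρ : IsGeometric C ρ)
    (h : ∀ v, pantsParameters C ρ v = pantsParameters C ρ₀ v) : ∃ κ, HasTwistBends C ρ₀ ρ κ := by
  have hk : ∀ v, ∃ k : Sp21, ∀ i, k * ρ (C.boundary v i) * k⁻¹ = ρ₀ (C.boundary v i) := by
    intro v
    obtain ⟨k, h0, h1⟩ := exists_conj_of_pairParameters (hρ.irreducible v) (hρ.boundary v 0)
      (hρ.boundary v 1) (hρ₀.boundary v 0) (hρ₀.boundary v 1) (h v)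
    refine ⟨k, fun i => ?_⟩
    -- The pair determines the image of the third loop through c₁c₂c₃ = 1.
    have h2 : ∀ σ : Rep g, σ (C.boundary v 2) =
        (σ (C.boundary v 0) * σ (C.boundary v 1))⁻¹ := fun σ => by
      rw [← σ.map_mul, ← σ.map_inv, inv_eq_of_mul_eq_one_right (C.boundary_mul v)]
    fin_cases i
    · exact h0
    · exact h1
    · change k * ρ (C.boundary v 2) * k⁻¹ = ρ₀ (C.boundary v 2)
      rw [h2, h2, ← h0, ← h1]
      group
  choose k hk using hk
  have hK : ∀ j, ∃ κ, IsTwist (ρ₀ (C.curve j)) κ ((ρ₀ (C.connector j))⁻¹ *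
      (k (C.pants j true) * ρ (C.connector j) * (k (C.pants j false))⁻¹)) := by
    intro j
    apply (hρ₀.loxodromic j).exists_isTwist
    have e1 := hk (C.side (j, true)).1 (C.side (j, true)).2
    have e0 : k (C.pants j false) * ρ (C.curve j) * (k (C.pants j false))⁻¹ = ρ₀ (C.curve j) :=
      hk (C.side (j, false)).1 (C.side (j, false)).2
    rw [C.boundary_true] at e1
    simp only [Rep.map_mul, Rep.map_inv] at e1
    have e1' : k (C.pants j true) * (ρ (C.connector j) * (ρ (C.curve j))⁻¹ *
      (ρ (C.connector j))⁻¹) * (k (C.pants j true))⁻¹ =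
      ρ₀ (C.connector j) * (ρ₀ (C.curve j))⁻¹ * (ρ₀ (C.connector j))⁻¹ := e1
    have e2 := congrArg (·⁻¹) e1'
    simp only [mul_inv_rev, inv_inv] at e2
    have e3 := congrArg (fun z => (ρ₀ (C.connector j))⁻¹ * (z * (k (C.pants j true) *
      ρ (C.connector j) * (k (C.pants j false))⁻¹))) e2
    simp only [mul_assoc, inv_mul_cancel_left] at e3
    rw [mul_assoc, ← mul_assoc _ _ (k (C.pants j false))⁻¹]
    have e4 : ρ₀ (C.curve j) * ((ρ₀ (C.connector j))⁻¹ * (k (C.pants j true) *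
        (ρ (C.connector j) * (k (C.pants j false))⁻¹))) = (ρ₀ (C.connector j))⁻¹ *
        (k (C.pants j true) * (ρ (C.connector j) * (ρ (C.curve j) * (k (C.pants j false))⁻¹))) :=
      e3.symm
    rw [← e0]
    rw [← e0] at e4
    simp only [mul_assoc, inv_mul_cancel_left] at e4 ⊢
    exact e4
  choose κ hκ using hK
  exact ⟨κ, k, hk, fun j => ⟨_, hκ j, by rw [mul_inv_cancel_left]⟩⟩

theorem sgn_inv (ε : Real.Angle) : (sgn ε)⁻¹ = sgn ε := inv_eq_of_mul_eq_one_right (sgn_mul_self ε)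

theorem exists_sgn {T : Sp21} (h : mat T = 1 ∨ mat T = -1) :
    ∃ ε : Real.Angle, (ε = 0 ∨ ε = (Real.pi : Real.Angle)) ∧ T = sgn ε := by
  rcases h with h | h
  · exact ⟨0, .inl rfl, mat_injective (by rw [h, sgn, if_pos rfl, mat_one])⟩
  · refine ⟨_, .inr rfl, mat_injective ?_⟩
    rw [h, sgn, if_neg Real.Angle.pi_ne_zero, mat_negOne]

/-- Signs are central and act on a twist by adding the same angle to ψ and ξ; the rest is uniqueness
of twist parameters. -/
theorem IsTwist.shift_shift_iff {A K K' : Sp21} {κ κ' : TwistBend} (h : IsTwist A κ K)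
    (h' : IsTwist A κ' K') {ε δ : Real.Angle} (hε : ε = 0 ∨ ε = (Real.pi : Real.Angle))
    (hδ : δ = 0 ∨ δ = (Real.pi : Real.Angle)) :
    K' = sgn δ * K * sgn ε ↔ κ'.s = κ.s ∧ κ'.ψ = κ.ψ + (ε + δ) ∧ κ'.ξ = κ.ξ + (ε + δ) := by
  rw [mul_assoc, ← sgn_comm, h'.eq_iff ((h.shift hε).shift hδ)]
  constructor
  · rintro rfl
    simp [TwistBend.shift, add_assoc]
  · rintro ⟨h1, h2, h3⟩
    apply TwistBend.ext
    · exact h1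
    · rw [h2]; exact (add_assoc _ _ _).symm
    · rw [h3]; exact (add_assoc _ _ _).symm

/-- The element u_v = k'_v⁻¹ sgn(ε_v) k_v conjugates ρ to ρ' on the sphere v, and equality of the
parameters up to signs makes the connecting loops compatible with the family u. -/
theorem HasTwistBends.conjugate {ρ₀ ρ ρ' : Rep g} {κ κ' : Fin (3 * g - 3) → TwistBend}
    (hκ : HasTwistBends C ρ₀ ρ κ) (hκ' : HasTwistBends C ρ₀ ρ' κ')
    (h : SameTwistBends C κ κ') (hg : 2 ≤ g) : Conjugate ρ ρ' := by
  obtain ⟨k, hk, hK⟩ := hκ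
  obtain ⟨k', hk', hK'⟩ := hκ'
  obtain ⟨ε, hε, hsame⟩ := h
  obtain ⟨u, hu⟩ : ∃ u : Fin (2 * g - 2) → Sp21, ∀ v, u v = (k' v)⁻¹ * sgn (ε v) * k v :=
    ⟨_, fun v => rfl⟩
  have hb : ∀ v i, ρ' (C.boundary v i) = u v * ρ (C.boundary v i) * (u v)⁻¹ := by
    intro v i
    have e : ρ' (C.boundary v i) = (k' v)⁻¹ * ρ₀ (C.boundary v i) * k' v := by
      rw [← hk']; group
    have e1 : ρ₀ (C.boundary v i) = sgn (ε v) * ρ₀ (C.boundary v i) * (sgn (ε v))⁻¹ := by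
      rw [sgn_comm, mul_inv_cancel_right]
    rw [e, e1, hu, ← hk]
    group
  have hc : ∀ j, ρ' (C.connector j) =
      u (C.pants j true) * ρ (C.connector j) * (u (C.pants j false))⁻¹ := by
    intro j
    obtain ⟨K, hKt, hKe⟩ := hK j
    obtain ⟨K', hKt', hKe'⟩ := hK' j
    have e := (hKt.shift_shift_iff hKt' (hε _) (hε _)).2 (hsame j)
    have e1 : ρ' (C.connector j) = (k' (C.pants j true))⁻¹ * (ρ₀ (C.connector j) * K') *
        k' (C.pants j false) := by
      rw [← hKe']; group
    have e2 : ρ₀ (C.connector j) * K' = sgn (ε (C.pants j true)) * (ρ₀ (C.connector j) * K) *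
        (sgn (ε (C.pants j false)))⁻¹ := by
      rw [e, sgn_inv, ← mul_assoc, ← mul_assoc, ← mul_assoc, sgn_comm]
    rw [e1, e2, ← hKe, hu, hu]
    group
  -- Connecting loops of tree edges are trivial, so u agrees on adjacent spheres and is constant
  -- along the spanning tree.
  have htree : ∀ j ∈ C.tree, u (C.pants j true) = u (C.pants j false) := by
    intro j hj
    have := hc j
    rw [C.connector_tree hj, ρ.map_one, ρ'.map_one, mul_one] at this
    exact (mul_inv_eq_one.1 this.symm)
  have hconst : ∀ v w, u v = u w := by
    intro v w
    induction C.tree_connected v w with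
    | refl => rfl
    | tail _ hs ih =>
      obtain ⟨j, hj, b, rfl, rfl⟩ := hs
      rw [ih]
      cases b
      · exact (htree j hj).symm
      · exact htree j hj
  refine C.conjugate_of_generators (u ⟨0, by omega⟩) (fun v i => ?_) fun j => ?_
  · rw [hb, hconst v]
  · rw [hc, hconst (C.pants j true), hconst (C.pants j false)]

/-- The element k'_v h k_v⁻¹ commutes with the irreducible pair of ρ₀ at v and is therefore a sign;
these signs are the ε_v. -/
theorem HasTwistBends.sameTwistBends {ρ₀ ρ ρ' : Rep g} {κ κ' : Fin (3 * g - 3) → TwistBend}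
    (hρ₀ : IsGeometric C ρ₀)
    (hκ : HasTwistBends C ρ₀ ρ κ) (hκ' : HasTwistBends C ρ₀ ρ' κ')
    (h : Conjugate ρ ρ') : SameTwistBends C κ κ' := by
  obtain ⟨k, hk, hK⟩ := hκ
  obtain ⟨k', hk', hK'⟩ := hκ'
  obtain ⟨h, hh⟩ := h
  have hT : ∀ v, ∃ ε : Real.Angle, (ε = 0 ∨ ε = (Real.pi : Real.Angle)) ∧
      k' v * h * (k v)⁻¹ = sgn ε := by
    intro v
    have hcomm : ∀ i, ρ₀ (C.boundary v i) * (k' v * h * (k v)⁻¹) =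
        (k' v * h * (k v)⁻¹) * ρ₀ (C.boundary v i) := by
      intro i
      conv_lhs => rw [← hk', hh]
      rw [← hk]
      group
    exact exists_sgn ((hρ₀.irreducible v).centralizer (hρ₀.boundary v 0) (hcomm 0) (hcomm 1))
  choose ε hε hT using hT
  refine ⟨ε, hε, fun j => ?_⟩
  obtain ⟨K, hKt, hKe⟩ := hK j
  obtain ⟨K', hKt', hKe'⟩ := hK' j
  refine (hKt.shift_shift_iff hKt' (hε _) (hε _)).1 ?_
  have e1 : ρ₀ (C.connector j) * K' = sgn (ε (C.pants j true)) * (ρ₀ (C.connector j) * K) *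
      (sgn (ε (C.pants j false)))⁻¹ := by
    rw [← hKe', ← hKe, ← hT, ← hT, hh]
    group
  rw [sgn_inv, ← mul_assoc, sgn_comm] at e1
  have := congrArg ((ρ₀ (C.connector j))⁻¹ * ·) e1
  simp only [mul_assoc, inv_mul_cancel_left] at this ⊢
  exact this

end

section

/-! ### The adjoint involution and the Lie algebra of `Sp(2,1)` -/

/-- `3 × 3` quaternionic matrices. -/
abbrev Mat : Type := Matrix (Fin 3) (Fin 3) ℍ[ℝ]

/-- The adjoint with respect to the Hermitian form, as a real-linear map. -/
def dag : Mat →ₗ[ℝ] Mat where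
  toFun M := H₁ * Mᴴ * H₁
  map_add' M N := by rw [Matrix.conjTranspose_add, mul_add, add_mul]
  map_smul' r M := by
    have : (r • M)ᴴ = r • Mᴴ := by
      refine Matrix.ext fun i j => ?_
      simp [Matrix.conjTranspose_apply, Quaternion.star_smul]
    rw [this, RingHom.id_apply, Matrix.mul_smul, Matrix.smul_mul]

theorem dag_apply (M : Mat) : dag M = H₁ * Mᴴ * H₁ := rfl

theorem dag_mul (M N : Mat) : dag (M * N) = dag N * dag M := by
  rw [dag_apply, dag_apply, dag_apply, Matrix.conjTranspose_mul]
  calc H₁ * (Nᴴ * Mᴴ) * H₁ = H₁ * Nᴴ * 1 * Mᴴ * H₁ := by noncomm_ring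
    _ = _ := by rw [← H₁_mul_H₁]; noncomm_ring

theorem dag_dag (M : Mat) : dag (dag M) = M := by
  rw [dag_apply, dag_apply, Matrix.conjTranspose_mul, Matrix.conjTranspose_mul, H₁_conjTranspose,
    Matrix.conjTranspose_conjTranspose]
  calc H₁ * (H₁ * (M * H₁)) * H₁ = (H₁ * H₁) * M * (H₁ * H₁) := by noncomm_ring
    _ = M := by rw [H₁_mul_H₁, one_mul, mul_one]

theorem dag_one : dag 1 = 1 := by
  rw [dag_apply, Matrix.conjTranspose_one, mul_one, H₁_mul_H₁]

theorem mat_inv_eq_dag (A : Sp21) : mat A⁻¹ = dag (mat A) := mat_inv A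

theorem dag_mul_mat (A : Sp21) : dag (mat A) * mat A = 1 := by rw [← mat_inv_eq_dag, mat_inv_mul]

theorem mat_mul_dag (A : Sp21) : mat A * dag (mat A) = 1 := by rw [← mat_inv_eq_dag, mat_mul_inv]

theorem exists_mat_eq {M : Mat} (h : dag M * M = 1) : ∃ A : Sp21, mat A = M := by
  have h' : Mᴴ * H₁ * M = H₁ := by
    have := congrArg (H₁ * ·) h
    simp only [dag_apply, mul_one] at this
    calc Mᴴ * H₁ * M = 1 * Mᴴ * H₁ * M := by rw [one_mul]
      _ = H₁ * (H₁ * Mᴴ * H₁ * M) := by rw [← H₁_mul_H₁]; noncomm_ring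
      _ = H₁ := this
  exact ⟨mkSp M h', mat_mkSp M h'⟩

theorem mul_dag_of_dag_mul {M : Mat} (h : dag M * M = 1) : M * dag M = 1 := by
  obtain ⟨A, rfl⟩ := exists_mat_eq h
  exact mat_mul_dag A

/-- The Lie algebra of `Sp(2,1)`. -/
def lieAlg : Submodule ℝ Mat := LinearMap.ker (dag + LinearMap.id)

/-- The matrices that are self-adjoint with respect to the Hermitian form. -/
def selfAdj : Submodule ℝ Mat := LinearMap.ker (dag - LinearMap.id)

theorem mem_lieAlg {X : Mat} : X ∈ lieAlg ↔ dag X = -X := by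
  rw [lieAlg, LinearMap.mem_ker, LinearMap.add_apply, LinearMap.id_apply, add_eq_zero_iff_eq_neg]

theorem mem_selfAdj {X : Mat} : X ∈ selfAdj ↔ dag X = X := by
  rw [selfAdj, LinearMap.mem_ker, LinearMap.sub_apply, LinearMap.id_apply, sub_eq_zero]

theorem lieAlg.dag_eq (X : lieAlg) : dag (X : Mat) = -X := mem_lieAlg.1 X.2

theorem selfAdj.dag_eq (X : selfAdj) : dag (X : Mat) = X := mem_selfAdj.1 X.2

/-- Projection to the Lie algebra along the self-adjoint matrices. -/
def skewPart : Mat →ₗ[ℝ] lieAlg :=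
  LinearMap.codRestrict lieAlg ((1 / 2 : ℝ) • (LinearMap.id - dag)) fun M => by
    rw [mem_lieAlg]
    simp only [LinearMap.smul_apply, LinearMap.sub_apply, LinearMap.id_apply, map_smul, map_sub,
      dag_dag]
    rw [← smul_neg, neg_sub]

/-- Projection to the self-adjoint matrices along the Lie algebra. -/
def symPart : Mat →ₗ[ℝ] selfAdj :=
  LinearMap.codRestrict selfAdj ((1 / 2 : ℝ) • (LinearMap.id + dag)) fun M => by
    rw [mem_selfAdj]
    simp only [LinearMap.smul_apply, LinearMap.add_apply, LinearMap.id_apply, map_smul, map_add,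
      dag_dag]
    rw [add_comm]

theorem coe_skewPart (M : Mat) : (skewPart M : Mat) = (1 / 2 : ℝ) • (M - dag M) := rfl

theorem coe_symPart (M : Mat) : (symPart M : Mat) = (1 / 2 : ℝ) • (M + dag M) := rfl

theorem symPart_coe (X : selfAdj) : symPart (X : Mat) = X := by
  apply Subtype.ext
  rw [coe_symPart, selfAdj.dag_eq, ← two_smul ℝ, smul_smul]
  norm_num

theorem symPart_eq_zero_iff (M : Mat) : symPart M = 0 ↔ dag M = -M := by
  rw [← Subtype.coe_inj, coe_symPart, ZeroMemClass.coe_zero, smul_eq_zero_iff_right (by norm_num),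
    add_eq_zero_iff_neg_eq, eq_comm]

theorem skewPart_eq_zero_iff (M : Mat) : skewPart M = 0 ↔ dag M = M := by
  rw [← Subtype.coe_inj, coe_skewPart, ZeroMemClass.coe_zero, smul_eq_zero_iff_right (by norm_num),
    sub_eq_zero, eq_comm]

theorem dag_entry (M : Mat) (i j : Fin 3) :
    dag M i j = star (M (Fin.rev j) (Fin.rev i)) := by
  rw [dag_apply]
  fin_cases i <;> fin_cases j <;>
    simp [Matrix.mul_apply, Fin.sum_univ_three, H₁, Fin.rev, Matrix.vecMul, dotProduct]

theorem finrank_mat : Module.finrank ℝ Mat = 36 := by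
  rw [Module.finrank_matrix, Quaternion.finrank_eq_four]
  simp

/-- Self-adjoint matrices are given by three real numbers and three quaternions. -/
def selfAdjEquiv : selfAdj ≃ₗ[ℝ] (ℝ × ℝ × ℝ) × ℍ[ℝ] × ℍ[ℝ] × ℍ[ℝ] where
  toFun X := (((X : Mat) 0 2 |>.re, (X : Mat) 1 1 |>.re, (X : Mat) 2 0 |>.re),
    (X : Mat) 0 0, (X : Mat) 0 1, (X : Mat) 1 0)
  map_add' X Y := rfl
  map_smul' r X := rfl
  invFun p := ⟨!![p.2.1, p.2.2.1, (p.1.1 : ℍ[ℝ]); p.2.2.2, (p.1.2.1 : ℍ[ℝ]), star p.2.2.1;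
      (p.1.2.2 : ℍ[ℝ]), star p.2.2.2, star p.2.1], by
    rw [mem_selfAdj]
    refine Matrix.ext fun i j => ?_
    rw [dag_entry]
    fin_cases i <;> fin_cases j <;> simp [Fin.rev]⟩
  left_inv X := by
    have h := fun i j => congrFun (congrFun (selfAdj.dag_eq X) i) j
    simp only [dag_entry] at h
    have hre : ∀ q : ℍ[ℝ], star q = q → (q.re : ℍ[ℝ]) = q := fun q hq =>
      (Quaternion.star_eq_self.1 hq).symm
    apply Subtype.ext
    refine Matrix.ext fun i j => ?_
    fin_cases i <;> fin_cases j
    · rfl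
    · rfl
    · exact hre _ (h 0 2)
    · rfl
    · exact hre _ (h 1 1)
    · exact h 1 2
    · exact hre _ (h 2 0)
    · exact h 2 1
    · exact h 2 2
  right_inv p := by
    obtain ⟨⟨a, b, c⟩, p, q, r⟩ := p
    simp

theorem finrank_selfAdj : Module.finrank ℝ selfAdj = 15 := by
  rw [selfAdjEquiv.finrank_eq]
  simp [Module.finrank_prod, Quaternion.finrank_eq_four]

theorem finrank_lieAlg : Module.finrank ℝ lieAlg = 21 := by
  have h := LinearMap.finrank_range_add_finrank_ker symPart
  have h1 : LinearMap.ker symPart = lieAlg := by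
    ext X
    rw [LinearMap.mem_ker, symPart_eq_zero_iff, mem_lieAlg]
  have h2 : LinearMap.range symPart = ⊤ :=
    LinearMap.range_eq_top.2 fun X => ⟨X, symPart_coe X⟩
  rw [h1, h2, finrank_top, finrank_selfAdj, finrank_mat] at h
  omega

/-! ### The trace form -/

/-- The real part of the trace. -/
def reTr : Mat →ₗ[ℝ] ℝ where
  toFun M := M.trace.re
  map_add' M N := by rw [Matrix.trace_add, Quaternion.re_add]
  map_smul' r M := by rw [Matrix.trace_smul, Quaternion.re_smul]; rfl

theorem reTr_mul_comm (M N : Mat) : reTr (M * N) = reTr (N * M) := by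
  have h : ∀ p q : ℍ[ℝ], (p * q).re = (q * p).re := fun p q => by
    simp only [Quaternion.re_mul]; ring
  simp only [reTr, LinearMap.coe_mk, AddHom.coe_mk, Matrix.trace, Matrix.diag_apply,
    Matrix.mul_apply, Fin.sum_univ_three, Quaternion.re_add, h (M _ _)]
  ring

theorem reTr_dag (M : Mat) : reTr (dag M) = reTr M := by
  rw [dag_apply, reTr_mul_comm, ← mul_assoc, H₁_mul_H₁, one_mul]
  simp [reTr, Matrix.trace, Fin.sum_univ_three, Matrix.conjTranspose_apply]

theorem reTr_mul_dag (Y : lieAlg) (W : Mat) : reTr ((Y : Mat) * dag W) = -reTr ((Y : Mat) * W) := by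
  rw [← reTr_dag, dag_mul, dag_dag, lieAlg.dag_eq, mul_neg, map_neg, reTr_mul_comm]

/-- The Lie algebra and the self-adjoint matrices are orthogonal for the trace form. -/
theorem reTr_mul_skewPart (Y : lieAlg) (W : Mat) :
    reTr ((Y : Mat) * (skewPart W : Mat)) = reTr ((Y : Mat) * W) := by
  rw [coe_skewPart, Matrix.mul_smul, map_smul, mul_sub, map_sub, reTr_mul_dag, smul_eq_mul]
  ring

/-- The Lie algebra is closed under conjugate transposition, and Y paired with its conjugate
transpose gives the sum of the squared norms of its entries. -/
theorem eq_zero_of_reTr (Y : lieAlg) (h : ∀ Z : lieAlg, reTr ((Y : Mat) * (Z : Mat)) = 0) :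
    Y = 0 := by
  have hY := lieAlg.dag_eq Y
  have hmem : (Y : Mat)ᴴ ∈ lieAlg := by
    rw [mem_lieAlg, dag_apply, Matrix.conjTranspose_conjTranspose]
    have := congrArg (fun M : Mat => (-M)ᴴ) hY
    simp only [dag_apply, Matrix.conjTranspose_mul, H₁_conjTranspose, Matrix.conjTranspose_neg,
      Matrix.conjTranspose_conjTranspose, neg_neg] at this
    rw [← this, neg_neg, mul_assoc]
  have h0 := h ⟨_, hmem⟩
  have e : reTr ((Y : Mat) * (Y : Mat)ᴴ) = ∑ i, ∑ j, Quaternion.normSq ((Y : Mat) i j) := by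
    simp only [reTr, LinearMap.coe_mk, AddHom.coe_mk, Matrix.trace, Matrix.diag_apply,
      Matrix.mul_apply, Matrix.conjTranspose_apply, Fin.sum_univ_three, Quaternion.re_add,
      Quaternion.self_mul_star, Quaternion.re_coe]
  rw [e] at h0
  have hn : ∀ i j, 0 ≤ Quaternion.normSq ((Y : Mat) i j) := fun i j => Quaternion.normSq_nonneg
  rw [Finset.sum_eq_zero_iff_of_nonneg fun i _ => Finset.sum_nonneg fun j _ => hn i j] at h0
  apply Subtype.ext
  refine Matrix.ext fun i j => ?_
  have := h0 i (Finset.mem_univ i)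
  rw [Finset.sum_eq_zero_iff_of_nonneg fun j _ => hn i j] at this
  exact Quaternion.normSq_eq_zero.1 (this j (Finset.mem_univ j))

/-- Every linear form on the Lie algebra is represented by the trace form. -/
theorem exists_reTr_eq (f : Module.Dual ℝ lieAlg) :
    ∃ Y : lieAlg, ∀ Z : lieAlg, f Z = reTr ((Y : Mat) * (Z : Mat)) := by
  let B : lieAlg →ₗ[ℝ] Module.Dual ℝ lieAlg :=
    LinearMap.mk₂ ℝ (fun Y Z => reTr ((Y : Mat) * (Z : Mat)))
      (fun X Y Z => by simp [add_mul]) (fun c Y Z => by simp)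
      (fun X Y Z => by simp [mul_add]) (fun c Y Z => by simp)
  have hinj : Function.Injective B := by
    rw [injective_iff_map_eq_zero]
    intro Y hY
    exact eq_zero_of_reTr Y fun Z => DFunLike.congr_fun hY Z
  have hsurj := (LinearMap.injective_iff_surjective_of_finrank_eq_finrank
    (Subspace.dual_finrank_eq (K := ℝ) (V := lieAlg)).symm).1 hinj
  obtain ⟨Y, hY⟩ := hsurj f
  exact ⟨Y, fun Z => (DFunLike.congr_fun hY Z).symm⟩

end

section

set_option linter.unusedSimpArgs false

attribute [local instance] Matrix.linftyOpNormedRing Matrix.linftyOpNormedAlgebra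

/-! ### The relation of the surface group as a map of matrices -/

/-- Tuples of matrices, indexed by the generators of the surface group. -/
abbrev Gens (g : ℕ) : Type := Fin g ⊕ Fin g → Mat

/-- `dag` as a continuous linear map. -/
def dagL : Mat →L[ℝ] Mat := LinearMap.toContinuousLinearMap dag

@[simp] theorem dagL_apply (M : Mat) : dagL M = dag M := rfl

/-- The commutator of two matrices, with the adjoints in place of the inverses. -/
def matComm (a b : Mat) : Mat := a * b * dag a * dag b

/-- The derivative of `matComm`. -/
def dMatComm (a b α β : Mat) : Mat :=
  α * b * dag a * dag b + a * β * dag a * dag b + a * b * dag α * dag b + a * b * dag a * dag β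

variable {g : ℕ}

/-- The product of the commutators indexed by a list. -/
def relMap (l : List (Fin g)) (x : Gens g) : Mat :=
  (l.map fun i => matComm (x (.inl i)) (x (.inr i))).prod

/-- The derivative of `relMap`. -/
def dRelMap : List (Fin g) → Gens g → Gens g → Mat
  | [], _, _ => 0
  | i :: l, x, ξ => dMatComm (x (.inl i)) (x (.inr i)) (ξ (.inl i)) (ξ (.inr i)) * relMap l x +
      matComm (x (.inl i)) (x (.inr i)) * dRelMap l x ξ

theorem relMap_cons (i : Fin g) (l : List (Fin g)) (x : Gens g) :
    relMap (i :: l) x = matComm (x (.inl i)) (x (.inr i)) * relMap l x := by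
  simp [relMap]

/-- The derivative is recorded through its values only, which keeps the later algebra independent of
how the product rule assembles it. -/
theorem exists_hasStrictFDerivAt_matComm (i : Fin g) (x : Gens g) :
    ∃ D : Gens g →L[ℝ] Mat,
      HasStrictFDerivAt (fun y : Gens g => matComm (y (.inl i)) (y (.inr i))) D x ∧
      ∀ ξ, D ξ = dMatComm (x (.inl i)) (x (.inr i)) (ξ (.inl i)) (ξ (.inr i)) := by
  have ha : HasStrictFDerivAt (fun y : Gens g => y (.inl i))
      (ContinuousLinearMap.proj (R := ℝ) (φ := fun _ : Fin g ⊕ Fin g => Mat) (Sum.inl i)) x :=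
    (ContinuousLinearMap.proj (R := ℝ) (φ := fun _ : Fin g ⊕ Fin g => Mat) (Sum.inl i)).hasStrictFDerivAt
  have hb : HasStrictFDerivAt (fun y : Gens g => y (.inr i))
      (ContinuousLinearMap.proj (R := ℝ) (φ := fun _ : Fin g ⊕ Fin g => Mat) (Sum.inr i)) x :=
    (ContinuousLinearMap.proj (R := ℝ) (φ := fun _ : Fin g ⊕ Fin g => Mat) (Sum.inr i)).hasStrictFDerivAt
  have ha' := dagL.hasStrictFDerivAt.comp x ha
  have hb' := dagL.hasStrictFDerivAt.comp x hb
  refine ⟨_, ((ha.mul' hb).mul' ha').mul' hb', fun ξ => ?_⟩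
  change x (.inl i) * x (.inr i) * dag (x (.inl i)) * dag (ξ (.inr i)) +
    (x (.inl i) * x (.inr i) * dag (ξ (.inl i)) + (x (.inl i) * ξ (.inr i) +
      ξ (.inl i) * x (.inr i)) * dag (x (.inl i))) * dag (x (.inr i)) = _
  rw [dMatComm]
  noncomm_ring

theorem exists_hasStrictFDerivAt_relMap (l : List (Fin g)) (x : Gens g) :
    ∃ D : Gens g →L[ℝ] Mat, HasStrictFDerivAt (relMap l) D x ∧ ∀ ξ, D ξ = dRelMap l x ξ := by
  induction l with
  | nil => exact ⟨0, hasStrictFDerivAt_const (1 : Mat) x, fun ξ => rfl⟩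
  | cons i l ih =>
    obtain ⟨D, hD, hDξ⟩ := ih
    obtain ⟨D', hD', hDξ'⟩ := exists_hasStrictFDerivAt_matComm i x
    have e : relMap (i :: l) = fun y : Gens g => matComm (y (.inl i)) (y (.inr i)) * relMap l y :=
      funext fun y => relMap_cons i l y
    rw [e]
    refine ⟨_, hD'.mul' hD, fun ξ => ?_⟩
    change matComm (x (.inl i)) (x (.inr i)) * D ξ + D' ξ * relMap l x = _
    rw [dRelMap, hDξ, hDξ', add_comm]

/-- Unitarity of all the matrices in a tuple. -/
def IsUnitary (x : Gens g) : Prop := ∀ i, dag (x i) * x i = 1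

theorem matComm_dag_mul {a b : Mat} (ha : dag a * a = 1) (hb : dag b * b = 1) :
    dag (matComm a b) * matComm a b = 1 := by
  have ha' := mul_dag_of_dag_mul ha
  have hb' := mul_dag_of_dag_mul hb
  simp only [matComm, dag_mul, dag_dag, mul_assoc]
  simp only [← mul_assoc (dag a) a, ← mul_assoc (dag b) b, ha, hb, one_mul, ← mul_assoc a (dag a),
    ← mul_assoc b (dag b), ha', hb']

theorem relMap_dag_mul {x : Gens g} (hx : IsUnitary x) (l : List (Fin g)) :
    dag (relMap l x) * relMap l x = 1 := by
  induction l with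
  | nil => simp [relMap, dag_one]
  | cons i l ih =>
    rw [relMap_cons, dag_mul, mul_assoc, ← mul_assoc (dag (matComm _ _)),
      matComm_dag_mul (hx _) (hx _), one_mul, ih]

/-- The infinitesimal conjugation action. -/
theorem dRelMap_conj {x : Gens g} (X : lieAlg) (l : List (Fin g)) :
    dRelMap l x (fun i => (X : Mat) * x i - x i * (X : Mat)) =
      (X : Mat) * relMap l x - relMap l x * (X : Mat) := by
  induction l with
  | nil => simp [dRelMap, relMap]
  | cons i l ih =>
    rw [dRelMap, ih, relMap_cons, dMatComm]
    simp only [map_sub, dag_mul, lieAlg.dag_eq]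
    simp only [matComm]
    noncomm_ring

theorem dRelMap_eq_zero {x ξ : Gens g} {l : List (Fin g)}
    (h : ∀ i ∈ l, ξ (.inl i) = 0 ∧ ξ (.inr i) = 0) : dRelMap l x ξ = 0 := by
  induction l with
  | nil => rfl
  | cons i l ih =>
    rw [dRelMap, ih fun j hj => h j (List.mem_cons_of_mem _ hj), (h i List.mem_cons_self).1,
      (h i List.mem_cons_self).2]
    simp [dMatComm]

theorem reTr_conj {c : Mat} (hc : dag c * c = 1) {Y : Mat} (hY : Y * c = c * Y) (M : Mat) :
    reTr (Y * (c * M * dag c)) = reTr (Y * M) := by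
  calc reTr (Y * (c * M * dag c)) = reTr ((Y * c * M) * dag c) := by simp only [mul_assoc]
    _ = reTr (dag c * c * Y * M) := by rw [reTr_mul_comm, hY]; simp only [mul_assoc]
    _ = _ := by rw [hc, one_mul]

/-- Equality in the Lie algebra can be tested with the trace form. -/
theorem eq_of_reTr {M N : Mat} (hM : M ∈ lieAlg) (hN : N ∈ lieAlg)
    (h : ∀ η : lieAlg, reTr (M * (η : Mat)) = reTr (N * (η : Mat))) : M = N := by
  have := eq_zero_of_reTr (⟨M, hM⟩ - ⟨N, hN⟩) fun Z => by
    rw [Submodule.coe_sub, sub_mul, map_sub, h Z, sub_self]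
  exact sub_eq_zero.1 (congrArg Subtype.val this)

theorem conj_mem_lieAlg {c Y : Mat} (hY : Y ∈ lieAlg) : c * Y * dag c ∈ lieAlg := by
  rw [mem_lieAlg] at *
  rw [dag_mul, dag_mul, dag_dag, hY]
  noncomm_ring

/-- An element orthogonal to all variations of one commutator commutes with its entries. -/
theorem commute_of_orthogonal_matComm {a b : Mat} (ha : dag a * a = 1) (hb : dag b * b = 1)
    (Y : lieAlg) (h : ∀ η θ : lieAlg, reTr ((Y : Mat) *
      (dMatComm a b ((η : Mat) * a) ((θ : Mat) * b) * dag (matComm a b))) = 0) :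
    (Y : Mat) * a = a * (Y : Mat) ∧ (Y : Mat) * b = b * (Y : Mat) := by
  have ha' := mul_dag_of_dag_mul ha
  have hb' := mul_dag_of_dag_mul hb
  have ea : ∀ M : Mat, dag a * (a * M) = M := fun M => by rw [← mul_assoc, ha, one_mul]
  have ea' : ∀ M : Mat, a * (dag a * M) = M := fun M => by rw [← mul_assoc, ha', one_mul]
  have eb : ∀ M : Mat, dag b * (b * M) = M := fun M => by rw [← mul_assoc, hb, one_mul]
  have eb' : ∀ M : Mat, b * (dag b * M) = M := fun M => by rw [← mul_assoc, hb', one_mul]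
  -- Varying a alone: the derivative times the adjoint of the commutator is η minus the conjugate of
  -- η by a b a†, where † denotes `dag`.
  have h1 : ∀ η : lieAlg, reTr ((Y : Mat) * (η : Mat)) =
      reTr ((dag (a * b * dag a) * Y * dag (dag (a * b * dag a))) * (η : Mat)) := by
    intro η
    have := h η 0
    rw [dMatComm, matComm] at this
    simp only [ZeroMemClass.coe_zero, zero_mul, mul_zero, add_zero, map_zero, dag_mul, dag_dag,
      lieAlg.dag_eq, add_mul, mul_assoc, ea, ea', eb, eb', ha', hb', mul_one, mul_add, map_add,
      neg_mul, mul_neg, map_neg] at this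
    have e := reTr_mul_comm ((Y : Mat) * (a * (b * dag a)))
      ((η : Mat) * (a * (dag b * dag a)))
    have e2 := reTr_mul_comm (η : Mat) (a * (dag b * dag a) * ((Y : Mat) * (a * (b * dag a))))
    simp only [dag_mul, dag_dag, mul_assoc] at this e e2 ⊢
    linarith
  -- Varying b alone: the derivative is the conjugate of θ by a minus its conjugate by the
  -- commutator.
  have h2 : ∀ θ : lieAlg, reTr ((dag a * Y * dag (dag a)) * (θ : Mat)) =
      reTr ((dag (matComm a b) * Y * dag (dag (matComm a b))) * (θ : Mat)) := by
    intro θ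
    have := h 0 θ
    rw [dMatComm] at this
    rw [matComm] at this ⊢
    simp only [ZeroMemClass.coe_zero, zero_mul, mul_zero, zero_add, add_zero, map_zero, dag_mul,
      dag_dag, lieAlg.dag_eq, add_mul, mul_assoc, ea, ea', eb, eb', ha', hb', mul_one, mul_add,
      map_add, neg_mul, mul_neg, map_neg] at this
    have e := reTr_mul_comm ((Y : Mat) * a) ((θ : Mat) * dag a)
    have e2 := reTr_mul_comm (θ : Mat) (dag a * (Y * a))
    have e3 := reTr_mul_comm ((Y : Mat) * (a * (b * (dag a * dag b))))
      ((θ : Mat) * (b * (a * (dag b * dag a))))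
    have e4 := reTr_mul_comm (θ : Mat) ((b * (a * (dag b * dag a))) *
      ((Y : Mat) * (a * (b * (dag a * dag b)))))
    simp only [dag_mul, dag_dag, mul_assoc] at this e e2 e3 e4 ⊢
    linarith
  have k1 := eq_of_reTr Y.2 (conj_mem_lieAlg Y.2) h1
  have k2 := eq_of_reTr (conj_mem_lieAlg Y.2) (conj_mem_lieAlg Y.2) h2
  simp only [matComm, dag_mul, dag_dag, mul_assoc] at k1 k2
  -- For Z = a†Ya the first identity says that Z commutes with b, and the second then says that it
  -- commutes with a. Hence Y = aZa† = Z.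
  obtain ⟨Z, hZ⟩ : ∃ Z : Mat, Z = dag a * ((Y : Mat) * a) := ⟨_, rfl⟩
  have hYZ : (Y : Mat) = a * (Z * dag a) := by rw [hZ]; simp only [mul_assoc, ea', ha', mul_one]
  have k3 : Z = dag b * (Z * b) := by
    conv_lhs => rw [hZ, k1]
    rw [hZ]
    simp only [mul_assoc, ea, ea', ha, mul_one]
  have k3' : b * Z = Z * b := by
    conv_lhs => rw [k3]
    rw [eb']
  have k4 : Z = b * (a * (dag b * (Z * (b * (dag a * dag b))))) := by
    conv_lhs => rw [hZ, k2]
    rw [hZ]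
    simp only [mul_assoc, ea, ea', ha, mul_one]
  have k5 : Z = a * (Z * dag a) := by
    have := congrArg (fun M => dag b * (M * b)) k4
    simp only [mul_assoc, hb, mul_one, eb, ← k3] at this
    rw [← mul_assoc Z b, ← mul_assoc (dag b) (Z * b), ← k3] at this
    exact this
  have k6 : (Y : Mat) = Z := by rw [hYZ, ← k5]
  rw [k6]
  refine ⟨?_, k3'.symm⟩
  conv_lhs => rw [k5]
  simp only [mul_assoc, ha, mul_one]

theorem commute_dag (Y : lieAlg) {M : Mat} (h : Commute (Y : Mat) M) :
    Commute (Y : Mat) (dag M) := by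
  have := congrArg dag h.eq
  simp only [dag_mul, lieAlg.dag_eq, mul_neg, neg_mul, neg_inj] at this
  exact this.symm

/-- Converse of the preceding orthogonality statement: pairing with Y does not see conjugation by
elements commuting with Y, so the terms with η cancel, and so do those with θ. -/
theorem reTr_dMatComm_of_commute {a b : Mat} (ha : dag a * a = 1) (hb : dag b * b = 1)
    (Y η θ : lieAlg) (hYa : (Y : Mat) * a = a * (Y : Mat)) (hYb : (Y : Mat) * b = b * (Y : Mat)) :
    reTr ((Y : Mat) * (dMatComm a b ((η : Mat) * a) ((θ : Mat) * b) * dag (matComm a b))) = 0 := by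
  have ha' := mul_dag_of_dag_mul ha
  have hb' := mul_dag_of_dag_mul hb
  have ea : ∀ M : Mat, dag a * (a * M) = M := fun M => by rw [← mul_assoc, ha, one_mul]
  have ea' : ∀ M : Mat, a * (dag a * M) = M := fun M => by rw [← mul_assoc, ha', one_mul]
  have eb : ∀ M : Mat, dag b * (b * M) = M := fun M => by rw [← mul_assoc, hb, one_mul]
  have eb' : ∀ M : Mat, b * (dag b * M) = M := fun M => by rw [← mul_assoc, hb', one_mul]
  have hc : dag (a * b * dag a) * (a * b * dag a) = 1 := by
    simp only [dag_mul, dag_dag, mul_assoc, ea, eb, ha']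
  have c1 : Commute (Y : Mat) (a * b * dag a) :=
    (Commute.mul_right hYa hYb).mul_right (commute_dag Y hYa)
  have c2 : Commute (Y : Mat) (matComm a b) := c1.mul_right (commute_dag Y hYb)
  have t1 := reTr_conj hc c1 (η : Mat)
  have t2 := reTr_conj ha hYa (θ : Mat)
  have t3 := reTr_conj (matComm_dag_mul ha hb) c2 (θ : Mat)
  rw [matComm] at t3
  rw [dMatComm, matComm]
  simp only [dag_mul, dag_dag,
      lieAlg.dag_eq, add_mul, mul_assoc, ea, ea', eb, eb', ha', hb', mul_one, mul_add, map_add,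
      neg_mul, mul_neg, map_neg] at t1 t2 t3 ⊢
  linarith

/-- An element orthogonal to all variations of a product of commutators commutes with the
entries. -/
theorem commute_of_orthogonal_relMap {x : Gens g} (hx : IsUnitary x) (Y : lieAlg)
    {l : List (Fin g)} (hl : l.Nodup)
    (h : ∀ η : Fin g ⊕ Fin g → lieAlg, reTr ((Y : Mat) *
      (dRelMap l x (fun i => (η i : Mat) * x i) * dag (relMap l x))) = 0) :
    ∀ i ∈ l, (Y : Mat) * x (.inl i) = x (.inl i) * (Y : Mat) ∧
      (Y : Mat) * x (.inr i) = x (.inr i) * (Y : Mat) := by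
  induction l with
  | nil => simp
  | cons i l ih =>
    have hR := mul_dag_of_dag_mul (relMap_dag_mul hx l)
    have hc := matComm_dag_mul (hx (.inl i)) (hx (.inr i))
    -- Product rule for the logarithmic derivative: the first commutator contributes its own
    -- variation, and the remaining product contributes its variation conjugated by that commutator.
    have hE : ∀ ξ, dRelMap (i :: l) x ξ * dag (relMap (i :: l) x) =
        dMatComm (x (.inl i)) (x (.inr i)) (ξ (.inl i)) (ξ (.inr i)) *
          dag (matComm (x (.inl i)) (x (.inr i))) +
        matComm (x (.inl i)) (x (.inr i)) * (dRelMap l x ξ * dag (relMap l x)) *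
          dag (matComm (x (.inl i)) (x (.inr i))) := by
      intro ξ
      rw [dRelMap, relMap_cons, dag_mul, add_mul, mul_assoc, ← mul_assoc (relMap l x), hR, one_mul]
      simp only [mul_assoc]
    obtain ⟨hil, hl'⟩ := List.nodup_cons.1 hl
    have hi : (Y : Mat) * x (.inl i) = x (.inl i) * (Y : Mat) ∧
      (Y : Mat) * x (.inr i) = x (.inr i) * (Y : Mat) := by
      apply commute_of_orthogonal_matComm (hx _) (hx _) Y
      intro η θ
      -- Only the first pair is varied. Since the list has no repetitions, the rest of the product
      -- does not change.
      have := h (Function.update (Function.update 0 (.inl i) η) (.inr i) θ)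
      rw [hE, dRelMap_eq_zero, zero_mul, mul_zero, zero_mul, add_zero] at this
      · simpa using this
      · intro j hj
        have hji : j ≠ i := fun e => hil (e ▸ hj)
        simp [Function.update, hji]
    have hYc : (Y : Mat) * matComm (x (.inl i)) (x (.inr i)) =
        matComm (x (.inl i)) (x (.inr i)) * Y := by
      exact ((Commute.mul_right hi.1 hi.2).mul_right (commute_dag Y hi.1)).mul_right
        (commute_dag Y hi.2)
    intro j hj
    rcases List.mem_cons.1 hj with rfl | hj
    · exact hi
    · refine ih hl' (fun η => ?_) j hj
      have := h η
      rw [hE, mul_add, map_add, reTr_conj hc hYc,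
        reTr_dMatComm_of_commute (hx _) (hx _) Y _ _ hi.1 hi.2, zero_add] at this
      exact this

end

section

attribute [local instance] Matrix.linftyOpNormedRing Matrix.linftyOpNormedAlgebra

/-! ### Slices for the conjugation action -/

variable {g : ℕ}

/-- The differential of the conjugation action. -/
def orbitDeriv (x : Gens g) : lieAlg →ₗ[ℝ] Gens g where
  toFun X i := (X : Mat) * x i - x i * (X : Mat)
  map_add' X Y := by
    funext i
    simp only [Submodule.coe_add, Pi.add_apply]
    noncomm_ring
  map_smul' r X := by
    funext i
    simp only [Submodule.coe_smul, Pi.smul_apply, RingHom.id_apply, Matrix.smul_mul,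
      Matrix.mul_smul, smul_sub]

theorem orbitDeriv_apply (x : Gens g) (X : lieAlg) (i : Fin g ⊕ Fin g) :
    orbitDeriv x X i = (X : Mat) * x i - x i * (X : Mat) := rfl

/-- `symPart` as a continuous linear map. -/
def symPartL : Mat →L[ℝ] selfAdj := LinearMap.toContinuousLinearMap symPart

/-- `skewPart` as a continuous linear map. -/
def skewPartL : Mat →L[ℝ] lieAlg := LinearMap.toContinuousLinearMap skewPart

/-- No nonzero element of the Lie algebra commutes with the entries of `x`. -/
def HasTrivialInfCentralizer (x : Gens g) : Prop :=
  ∀ X : lieAlg, (∀ i, Commute (X : Mat) (x i)) → X = 0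

/-- The kernel of a left inverse of the orbit differential is a complement to the tangent space of
the orbit; it defines the slice. -/
theorem HasTrivialInfCentralizer.exists_leftInverse {x : Gens g}
    (h : HasTrivialInfCentralizer x) :
    ∃ L : Gens g →L[ℝ] lieAlg, ∀ X, L (orbitDeriv x X) = X := by
  obtain ⟨L, hL⟩ := LinearMap.exists_leftInverse_of_injective (orbitDeriv x) (by
    rw [LinearMap.ker_eq_bot']
    intro X hX
    exact h X fun i => sub_eq_zero.1 (congrFun hX i))
  exact ⟨LinearMap.toContinuousLinearMap L, fun X => LinearMap.congr_fun hL X⟩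

/-- Multiplication of a tuple of matrices by a tuple of elements of the Lie algebra. -/
def translate (x : Gens g) : (Fin g ⊕ Fin g → lieAlg) →ₗ[ℝ] Gens g where
  toFun η i := (η i : Mat) * x i
  map_add' η θ := by
    funext i
    simp only [Submodule.coe_add, Pi.add_apply, add_mul]
  map_smul' r η := by
    funext i
    simp only [Submodule.coe_smul, Pi.smul_apply, RingHom.id_apply, Matrix.smul_mul]

/-- The relation map is a submersion at tuples with trivial infinitesimal centralizer. -/
theorem exists_skewPart_dRelMap {x : Gens g} (hx : IsUnitary x)
    (hR : relMap (List.finRange g) x = 1) (hc : HasTrivialInfCentralizer x)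
    {D : Gens g →L[ℝ] Mat} (hD : ∀ ξ, D ξ = dRelMap (List.finRange g) x ξ) (Y : lieAlg) :
    ∃ η, skewPart (D (translate x η)) = Y := by
  obtain ⟨G, hG⟩ : ∃ G : (Fin g ⊕ Fin g → lieAlg) →ₗ[ℝ] lieAlg,
      G = skewPart ∘ₗ D.toLinearMap ∘ₗ translate x := ⟨_, rfl⟩
  suffices h : LinearMap.range G = ⊤ by
    obtain ⟨η, hη⟩ := LinearMap.range_eq_top.1 h Y
    exact ⟨η, by rw [← hη, hG]; rfl⟩
  by_contra hne
  -- A proper range lies in the kernel of a nonzero form. That form is pairing with some Z, and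
  -- orthogonality to all variations of the relation makes Z centralize x, so Z = 0.
  obtain ⟨f, hf0, hf⟩ := Submodule.exists_le_ker_of_lt_top _ (lt_top_iff_ne_top.2 hne)
  obtain ⟨Z, hZ⟩ := exists_reTr_eq f
  have hZ0 : Z = 0 := by
    refine hc Z fun i => ?_
    have := commute_of_orthogonal_relMap hx Z (List.nodup_finRange g) fun η => ?_
    · rcases i with i | i
      · exact (this i (List.mem_finRange i)).1
      · exact (this i (List.mem_finRange i)).2
    · rw [hR, dag_one, mul_one, ← reTr_mul_skewPart, ← hZ]
      have := LinearMap.mem_ker.1 (hf (LinearMap.mem_range_self G η))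
      rw [hG] at this
      change f (skewPart (D (translate x η))) = 0 at this
      rw [hD] at this
      exact this
  refine hf0 (LinearMap.ext fun W => ?_)
  rw [hZ, hZ0]
  simp

/-- The map whose zeros near `x₀` form a slice for the conjugation action on the space of
representations. -/
def sliceMap (x₀ : Gens g) (L : Gens g →L[ℝ] lieAlg) (x : Gens g) :
    (Fin g ⊕ Fin g → selfAdj) × lieAlg × lieAlg :=
  (fun i => symPart (dag (x i) * x i - 1), skewPart (relMap (List.finRange g) x - 1), L (x - x₀))

theorem exists_hasStrictFDerivAt_sliceMap {x₀ : Gens g} (L : Gens g →L[ℝ] lieAlg)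
    {D : Gens g →L[ℝ] Mat} (hD : HasStrictFDerivAt (relMap (List.finRange g)) D x₀) :
    ∃ D' : Gens g →L[ℝ] (Fin g ⊕ Fin g → selfAdj) × lieAlg × lieAlg,
      HasStrictFDerivAt (sliceMap x₀ L) D' x₀ ∧
      ∀ ξ, D' ξ = (fun i => symPart (dag (x₀ i) * ξ i + dag (ξ i) * x₀ i), skewPart (D ξ), L ξ) := by
  have h1 : ∀ i, ∃ Q : Gens g →L[ℝ] selfAdj,
      HasStrictFDerivAt (fun x : Gens g => symPart (dag (x i) * x i - 1)) Q x₀ ∧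
      ∀ ξ, Q ξ = symPart (dag (x₀ i) * ξ i + dag (ξ i) * x₀ i) := by
    intro i
    have ha : HasStrictFDerivAt (fun y : Gens g => y i)
        (ContinuousLinearMap.proj (R := ℝ) (φ := fun _ : Fin g ⊕ Fin g => Mat) i) x₀ :=
      (ContinuousLinearMap.proj (R := ℝ) (φ := fun _ : Fin g ⊕ Fin g => Mat) i).hasStrictFDerivAt
    have ha' := dagL.hasStrictFDerivAt.comp x₀ ha
    exact ⟨_, symPartL.hasStrictFDerivAt.comp x₀ ((ha'.mul' ha).sub_const 1), fun ξ => rfl⟩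
  choose Q hQ hQξ using h1
  have h2 := skewPartL.hasStrictFDerivAt.comp x₀ (hD.sub_const 1)
  have h3 : HasStrictFDerivAt (fun x : Gens g => L (x - x₀)) L x₀ :=
    L.hasStrictFDerivAt.comp x₀ ((hasStrictFDerivAt_id x₀).sub_const x₀)
  refine ⟨_, (hasStrictFDerivAt_pi.2 hQ).prodMk (h2.prodMk h3), fun ξ => ?_⟩
  refine Prod.ext (funext fun i => ?_) rfl
  exact hQξ i ξ

/-- The three components are solved in turn with directions that do not disturb the earlier ones:
translations by the Lie algebra are tangent to the unitary group, and orbit directions are also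
annihilated by the differential of the relation. The kernel then has dimension 2g·36 − (2g·15 + 21 +
21). -/
theorem sliceMap_submersion {x₀ : Gens g} (hx : IsUnitary x₀)
    (hR : relMap (List.finRange g) x₀ = 1) (hc : HasTrivialInfCentralizer x₀)
    {L : Gens g →L[ℝ] lieAlg} (hL : ∀ X, L (orbitDeriv x₀ X) = X) :
    ∃ D' : Gens g →L[ℝ] (Fin g ⊕ Fin g → selfAdj) × lieAlg × lieAlg,
      HasStrictFDerivAt (sliceMap x₀ L) D' x₀ ∧ D'.range = ⊤ ∧
      Module.finrank ℝ D'.ker = 42 * g - 42 := by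
  obtain ⟨D, hD, hDξ⟩ := exists_hasStrictFDerivAt_relMap (List.finRange g) x₀
  obtain ⟨D', hD', hDξ'⟩ := exists_hasStrictFDerivAt_sliceMap L hD
  have hsurj : D'.range = ⊤ := by
    rw [LinearMap.range_eq_top]
    rintro ⟨S, Y, Z⟩
    -- At a unitary x₀ the differential of x†x in the direction x₀S/2 is S, for S self-adjoint.
    obtain ⟨ξ₁, hξ₁⟩ : ∃ ξ₁ : Gens g, ∀ i, ξ₁ i = (1 / 2 : ℝ) • (x₀ i * (S i : Mat)) :=
      ⟨_, fun i => rfl⟩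
    obtain ⟨η, hη⟩ := exists_skewPart_dRelMap hx hR hc hDξ (Y - skewPart (D ξ₁))
    obtain ⟨X, hX⟩ : ∃ X : lieAlg, X = Z - L ξ₁ - L (translate x₀ η) := ⟨_, rfl⟩
    have hDX : D (orbitDeriv x₀ X) = 0 := by
      rw [hDξ]
      exact (dRelMap_conj X _).trans (by rw [hR, mul_one, one_mul, sub_self])
    refine ⟨ξ₁ + translate x₀ η + orbitDeriv x₀ X, ?_⟩
    change D' _ = _
    rw [map_add, map_add, hDξ', hDξ', hDξ', hL, hDX, hη, map_zero]
    refine Prod.ext (funext fun i => ?_) (Prod.ext ?_ ?_)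
    · have e1 : dag (x₀ i) * ξ₁ i + dag (ξ₁ i) * x₀ i = (S i : Mat) := by
        rw [hξ₁, map_smul, dag_mul, Matrix.mul_smul, Matrix.smul_mul, ← mul_assoc, mul_assoc _ _ (x₀ i),
          hx i, one_mul, mul_one, selfAdj.dag_eq, ← add_smul]
        norm_num
      have e2 : dag (x₀ i) * translate x₀ η i + dag (translate x₀ η i) * x₀ i = 0 := by
        change dag (x₀ i) * ((η i : Mat) * x₀ i) + dag ((η i : Mat) * x₀ i) * x₀ i = 0
        rw [dag_mul, lieAlg.dag_eq]
        noncomm_ring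
      have e3 : dag (x₀ i) * orbitDeriv x₀ X i + dag (orbitDeriv x₀ X i) * x₀ i = 0 := by
        rw [orbitDeriv_apply, map_sub, dag_mul, dag_mul, lieAlg.dag_eq]
        calc _ = (X : Mat) * (dag (x₀ i) * x₀ i) - (dag (x₀ i) * x₀ i) * X := by noncomm_ring
          _ = 0 := by rw [hx i, mul_one, one_mul, sub_self]
      change symPart _ + symPart _ + symPart _ = S i
      rw [e1, e2, e3, map_zero, add_zero, add_zero, symPart_coe]
    · change skewPart (D ξ₁) + (Y - skewPart (D ξ₁)) + 0 = Y
      abel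
    · change L ξ₁ + L (translate x₀ η) + X = Z
      rw [hX]
      abel
  refine ⟨D', hD', hsurj, ?_⟩
  have h := LinearMap.finrank_range_add_finrank_ker D'.toLinearMap
  have e1 : Module.finrank ℝ (LinearMap.range D'.toLinearMap) = (g + g) * 15 + (21 + 21) := by
    have : LinearMap.range D'.toLinearMap = ⊤ := hsurj
    rw [this, finrank_top, Module.finrank_prod, Module.finrank_prod, Module.finrank_pi_fintype,
      finrank_lieAlg]
    simp [finrank_selfAdj]
  have e2 : Module.finrank ℝ (Gens g) = (g + g) * 36 := by
    rw [Module.finrank_pi_fintype]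
    simp only [finrank_mat, Finset.sum_const, Finset.card_univ, Fintype.card_sum, Fintype.card_fin,
      smul_eq_mul]
  rw [e1, e2] at h
  change Module.finrank ℝ (LinearMap.ker D'.toLinearMap) = _
  omega

/-! ### The orbit map and its local inverse -/

/-- The map that brings tuples into the slice by conjugation. -/
def orbitMap (x₀ : Gens g) (L : Gens g →L[ℝ] lieAlg) (p : Mat × Gens g) :
    selfAdj × lieAlg × Gens g :=
  (symPart (dag p.1 * p.1 - 1), L ((fun i => p.1 * p.2 i * dag p.1) - x₀), p.2)

theorem orbitMap_deriv {x₀ : Gens g}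
    {L : Gens g →L[ℝ] lieAlg} (hL : ∀ X, L (orbitDeriv x₀ X) = X) :
    ∃ D : (Mat × Gens g) ≃L[ℝ] selfAdj × lieAlg × Gens g,
      HasStrictFDerivAt (orbitMap x₀ L) (D : (Mat × Gens g) →L[ℝ] selfAdj × lieAlg × Gens g)
        (1, x₀) := by
  have hfst : HasStrictFDerivAt (fun p : Mat × Gens g => p.1)
      (ContinuousLinearMap.fst ℝ Mat (Gens g)) (1, x₀) :=
    (ContinuousLinearMap.fst ℝ Mat (Gens g)).hasStrictFDerivAt
  have hsnd : HasStrictFDerivAt (fun p : Mat × Gens g => p.2)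
      (ContinuousLinearMap.snd ℝ Mat (Gens g)) (1, x₀) :=
    (ContinuousLinearMap.snd ℝ Mat (Gens g)).hasStrictFDerivAt
  have hdag := dagL.hasStrictFDerivAt.comp ((1, x₀) : Mat × Gens g) hfst
  have h1 : ∀ i, ∃ Q : Mat × Gens g →L[ℝ] Mat,
      HasStrictFDerivAt (fun p : Mat × Gens g => p.1 * p.2 i * dag p.1) Q (1, x₀) ∧
      ∀ q, Q q = q.1 * x₀ i + q.2 i + x₀ i * dag q.1 := by
    intro i
    have hi : HasStrictFDerivAt (fun p : Mat × Gens g => p.2 i)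
        ((ContinuousLinearMap.proj (R := ℝ) (φ := fun _ : Fin g ⊕ Fin g => Mat) i).comp
          (ContinuousLinearMap.snd ℝ Mat (Gens g))) (1, x₀) :=
      ((ContinuousLinearMap.proj (R := ℝ) (φ := fun _ : Fin g ⊕ Fin g => Mat) i).comp
          (ContinuousLinearMap.snd ℝ Mat (Gens g))).hasStrictFDerivAt
    refine ⟨_, (hfst.mul' hi).mul' hdag, fun q => ?_⟩
    change 1 * x₀ i * dag q.1 + (1 * q.2 i + q.1 * x₀ i) * dag 1 = _
    rw [dag_one]
    noncomm_ring
  choose Q hQ hQq using h1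
  have h2 := L.hasStrictFDerivAt.comp ((1, x₀) : Mat × Gens g)
    ((hasStrictFDerivAt_pi.2 hQ).sub_const x₀)
  have h3 := symPartL.hasStrictFDerivAt.comp ((1, x₀) : Mat × Gens g)
    ((hdag.mul' hfst).sub_const 1)
  have h4 := h3.prodMk (h2.prodMk hsnd)
  obtain ⟨D, hD, hDq⟩ : ∃ D : Mat × Gens g →L[ℝ] selfAdj × lieAlg × Gens g,
      HasStrictFDerivAt (orbitMap x₀ L) D (1, x₀) ∧
      ∀ q, D q = (symPart (dag 1 * q.1 + dag q.1 * 1), L (fun i => Q i q), q.2) :=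
    ⟨_, h4, fun q => rfl⟩
  -- On the kernel the last component gives ξ = 0, the first puts X into the Lie algebra, and then
  -- the second is L applied to the orbit direction of X, which is X. The dimensions agree since 36
  -- = 15 + 21.
  have hinj : Function.Injective D := by
    rw [injective_iff_map_eq_zero]
    rintro ⟨X, ξ⟩ h
    rw [hDq] at h
    obtain ⟨e1, e2⟩ := Prod.mk.inj h
    obtain ⟨e2, e3⟩ := Prod.mk.inj e2
    have e3' : ξ = 0 := e3
    subst e3'
    have hX : X ∈ lieAlg := by
      have e1' : symPart (dag 1 * X + dag X * 1) = 0 := e1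
      rw [symPart_eq_zero_iff, dag_one, one_mul, mul_one, map_add, dag_dag] at e1'
      rw [mem_lieAlg]
      have : (2 : ℝ) • (dag X + X) = 0 := by
        rw [two_smul]
        nth_rewrite 1 [e1']
        abel
      rw [smul_eq_zero_iff_right (by norm_num)] at this
      exact eq_neg_of_add_eq_zero_left this
    have : (fun i => Q i (X, 0)) = orbitDeriv x₀ ⟨X, hX⟩ := by
      funext i
      rw [hQq, orbitDeriv_apply]
      change X * x₀ i + 0 + x₀ i * dag X = X * x₀ i - x₀ i * X
      rw [mem_lieAlg.1 hX]
      noncomm_ring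
    rw [this, hL] at e2
    have e4 : X = 0 := congrArg Subtype.val e2
    rw [e4]
    rfl
  have hfr : Module.finrank ℝ (Mat × Gens g) = Module.finrank ℝ (selfAdj × lieAlg × Gens g) := by
    rw [Module.finrank_prod, Module.finrank_prod, Module.finrank_prod, finrank_mat,
      finrank_selfAdj, finrank_lieAlg]
    omega
  refine ⟨(LinearEquiv.ofInjectiveOfFinrankEq D.toLinearMap hinj hfr).toContinuousLinearEquiv, ?_⟩
  convert hD using 1
  exact ContinuousLinearMap.ext fun q => LinearMap.congr_fun
    (LinearEquiv.coe_ofInjectiveOfFinrankEq D.toLinearMap hinj hfr) q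

end

section

attribute [local instance] Matrix.linftyOpNormedRing Matrix.linftyOpNormedAlgebra

open Filter Topology

/-! ### Stabilizers and properness at irreducible pairs -/

/-- The Lie algebra version of the triviality of the centralizer, by the Cayley transform. -/
theorem IsIrreducible.infCentralizer {A B : Sp21} (hirr : IsIrreducible A B) (hA : IsLoxodromic A)
    (X : lieAlg) (hXA : Commute (X : Mat) (mat A)) (hXB : Commute (X : Mat) (mat B)) : X = 0 := by
  -- Scaling by t makes the norm less than 1, so that 1 − tX is invertible and the Cayley transform
  -- is defined.
  obtain ⟨t, ht⟩ : ∃ t : ℝ, t = (1 + ‖(X : Mat)‖)⁻¹ := ⟨_, rfl⟩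
  have hpos : 0 < 1 + ‖(X : Mat)‖ := by positivity
  have ht0 : 0 < t := by rw [ht]; positivity
  obtain ⟨Y, hY⟩ : ∃ Y : Mat, Y = t • (X : Mat) := ⟨_, rfl⟩
  have hYn : ‖Y‖ < 1 := by
    rw [hY, norm_smul, Real.norm_of_nonneg ht0.le, ht, inv_mul_lt_iff₀ hpos]
    linarith
  have hdY : dag Y = -Y := by rw [hY, map_smul, lieAlg.dag_eq, smul_neg]
  have hYA : Commute Y (mat A) := by rw [hY]; exact hXA.smul_left t
  have hYB : Commute Y (mat B) := by rw [hY]; exact hXB.smul_left t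
  obtain ⟨u, hu⟩ := isUnit_one_sub_of_norm_lt_one hYn
  obtain ⟨w, hw⟩ : ∃ w : Mat, w = (u⁻¹ : Matˣ).val := ⟨_, rfl⟩
  have hw1 : (1 - Y) * w = 1 := by rw [hw, ← hu, Units.mul_inv]
  have hw2 : w * (1 - Y) = 1 := by rw [hw, ← hu, Units.inv_mul]
  have hd1 : dag w * (1 + Y) = 1 := by
    have := congrArg dag hw1
    rwa [dag_mul, map_sub, dag_one, hdY, sub_neg_eq_add] at this
  have hcomm : ∀ M : Mat, Commute Y M → Commute w M := by
    intro M hM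
    have h1 : Commute (u : Mat) M := by rw [hu]; exact (Commute.one_left M).sub_left hM
    rw [hw]
    exact h1.units_inv_left
  have hwY : Commute w Y := hcomm Y (Commute.refl Y)
  have hunit : dag ((1 + Y) * w) * ((1 + Y) * w) = 1 := by
    rw [dag_mul, map_add, dag_one, hdY, ← sub_eq_add_neg]
    calc dag w * (1 - Y) * ((1 + Y) * w) = dag w * (1 + Y) * ((1 - Y) * w) := by noncomm_ring
      _ = 1 := by rw [hd1, hw1, one_mul]
  obtain ⟨T, hT⟩ := exists_mat_eq hunit
  have hTc : ∀ C : Sp21, Commute Y (mat C) → C * T = T * C := by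
    intro C hC
    apply mat_injective
    rw [mat_mul, mat_mul, hT]
    exact ((((Commute.one_left _).add_left hC).mul_left (hcomm _ hC)).eq).symm
  -- The Cayley transform lies in Sp(2,1) and centralizes the pair. The value 1 gives Y = 0; the
  -- value −1 would give 2 = 0.
  have hfin : (1 + Y) * w = 1 ∨ (1 + Y) * w = -1 := by
    rw [← hT]
    exact hirr.centralizer hA (hTc A hYA) (hTc B hYB)
  have key : (1 + Y) = ((1 + Y) * w) * (1 - Y) := by rw [mul_assoc, hw2, mul_one]
  rcases hfin with h | h
  · rw [h, one_mul] at key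
    have : (2 : ℝ) • Y = 0 := by
      rw [two_smul]
      have := congrArg (fun M => M - 1 + Y) key
      simpa using this
    rw [smul_eq_zero_iff_right (by norm_num), hY, smul_eq_zero_iff_right ht0.ne'] at this
    exact Subtype.ext this
  · rw [h, neg_mul, one_mul, neg_sub] at key
    exfalso
    have h2 : (2 : ℝ) • (1 : Mat) = 0 := by
      rw [two_smul]
      have := congrArg (fun M => M - Y + 1) key
      simpa using this
    rw [smul_eq_zero_iff_right (by norm_num)] at h2
    exact one_ne_zero h2

/-! ### Properness of conjugation -/

theorem herm_eq_zero_of_dag_mul {M : Mat} (h : dag M * M = 0) (v w : V) :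
    herm (M *ᵥ v) (M *ᵥ w) = 0 := by
  have h' : Mᴴ * H₁ * M = 0 := by
    have := congrArg (H₁ * ·) h
    simp only [dag_apply, mul_zero] at this
    calc Mᴴ * H₁ * M = 1 * Mᴴ * H₁ * M := by rw [one_mul]
      _ = H₁ * (H₁ * Mᴴ * H₁ * M) := by rw [← H₁_mul_H₁]; noncomm_ring
      _ = 0 := this
  rw [herm_mulVec, h', Matrix.zero_mulVec, dotProduct_zero]

/-- A degenerate matrix with isotropic image does not commute with an irreducible pair. -/
theorem IsIrreducible.eq_zero_of_isotropic {A B : Sp21} (hirr : IsIrreducible A B) {M : Mat}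
    (h : dag M * M = 0) (hA : mat A * M = M * mat A) (hB : mat B * M = M * mat B) : M = 0 := by
  by_contra hM
  obtain ⟨v, hv⟩ : ∃ v, M *ᵥ v ≠ 0 := by
    by_contra! hv
    refine hM (Matrix.ext fun i j => ?_)
    have := congrFun (hv (Pi.single j 1)) i
    rw [Matrix.mulVec_single_one] at this
    exact this
  -- The image of M is totally isotropic, so it is contained in a single null line; an element
  -- commuting with M preserves that line.
  have key : ∀ C : Sp21, mat C * M = M * mat C → ∃ q : ℍ[ℝ], mat C *ᵥ (M *ᵥ v) = (M *ᵥ v) <• q := by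
    intro C hC
    rw [Matrix.mulVec_mulVec, hC, ← Matrix.mulVec_mulVec]
    exact (orthogonal_null hv (herm_eq_zero_of_dag_mul h v v) (herm_eq_zero_of_dag_mul h _ v)).2
      (herm_eq_zero_of_dag_mul h _ _)
  exact hirr.no_common_null hv (herm_eq_zero_of_dag_mul h v v) (key A hA) (key B hB)

/-- The conjugation action is proper at irreducible pairs, with stabilizer `±1`. -/
theorem IsIrreducible.proper {A B : Sp21} (hirr : IsIrreducible A B) (hA : IsLoxodromic A)
    {O : Set Mat} (hO : O ∈ 𝓝 (1 : Mat)) :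
    ∀ᶠ p : (Mat × Mat) × Mat × Mat in 𝓝 ((mat A, mat B), mat A, mat B), ∀ h : Sp21,
      p.2.1 * mat h = mat h * p.1.1 → p.2.2 * mat h = mat h * p.1.2 →
      mat h ∈ O ∨ -mat h ∈ O := by
  by_contra hcon
  rw [not_eventually] at hcon
  obtain ⟨S, hS⟩ : ∃ S : Set ((Mat × Mat) × Mat × Mat), S = {p | ¬ ∀ h : Sp21,
      p.2.1 * mat h = mat h * p.1.1 → p.2.2 * mat h = mat h * p.1.2 →
      mat h ∈ O ∨ -mat h ∈ O} := ⟨_, rfl⟩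
  have hne : (𝓝 ((mat A, mat B), mat A, mat B) ⊓ 𝓟 S).NeBot := by
    rw [hS]; exact frequently_mem_iff_neBot.1 hcon
  -- An ultrafilter of counterexamples converging to the base point takes the place of a sequence
  -- with convergent subsequences.
  obtain ⟨u, hu⟩ : ∃ u : Ultrafilter ((Mat × Mat) × Mat × Mat),
      (u : Filter _) ≤ 𝓝 ((mat A, mat B), mat A, mat B) ⊓ 𝓟 S := ⟨_, Ultrafilter.of_le _⟩
  have hu1 : Tendsto id (u : Filter _) (𝓝 ((mat A, mat B), mat A, mat B)) :=
    hu.trans inf_le_left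
  have huS : ∀ᶠ p in (u : Filter _), p ∈ S := le_principal_iff.1 (hu.trans inf_le_right)
  have hex : ∀ p : (Mat × Mat) × Mat × Mat, ∃ h : Sp21, p ∈ S →
      (p.2.1 * mat h = mat h * p.1.1 ∧ p.2.2 * mat h = mat h * p.1.2 ∧
      mat h ∉ O ∧ -mat h ∉ O) := by
    intro p
    by_cases hp : p ∈ S
    · have hp' := hp
      rw [hS, Set.mem_ofPred_eq] at hp'
      push Not at hp'
      obtain ⟨h, h1, h2, h3, h4⟩ := hp'
      exact ⟨h, fun _ => ⟨h1, h2, h3, h4⟩⟩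
    · exact ⟨1, fun h => absurd h hp⟩
  choose h hh using hex
  -- Rescaling puts T = c h into the closed unit ball, where it has a limit T₀. Since c = 1 − ‖T‖,
  -- the factor c converges too.
  obtain ⟨c, hc⟩ : ∃ c : (Mat × Mat) × Mat × Mat → ℝ, ∀ p, c p = (1 + ‖mat (h p)‖)⁻¹ :=
    ⟨_, fun p => rfl⟩
  obtain ⟨T, hT⟩ : ∃ T : (Mat × Mat) × Mat × Mat → Mat, ∀ p, T p = c p • mat (h p) :=
    ⟨_, fun p => rfl⟩
  have hpos : ∀ p, 0 < 1 + ‖mat (h p)‖ := fun p => by positivity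
  have hc0 : ∀ p, 0 < c p := fun p => by rw [hc]; exact inv_pos.2 (hpos p)
  have hTc : ∀ p, c p = 1 - ‖T p‖ := by
    intro p
    rw [hT, norm_smul, Real.norm_of_nonneg (hc0 p).le, hc]
    field_simp [(hpos p).ne']
    ring
  have : ProperSpace Mat := FiniteDimensional.proper ℝ Mat
  obtain ⟨T₀, -, hT₀⟩ := (isCompact_closedBall (0 : Mat) 1).ultrafilter_le_nhds (u.map T) (by
    rw [le_principal_iff]
    refine mem_map.2 (Eventually.of_forall fun p => ?_)
    rw [mem_closedBall_zero_iff]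
    linarith [hTc p, hc0 p])
  have hlim : Tendsto T (u : Filter _) (𝓝 T₀) := hT₀
  have hclim : Tendsto c (u : Filter _) (𝓝 (1 - ‖T₀‖)) := by
    rw [funext hTc]
    exact tendsto_const_nhds.sub hlim.norm
  obtain ⟨c₀, hc₀⟩ : ∃ c₀ : ℝ, c₀ = 1 - ‖T₀‖ := ⟨_, rfl⟩
  rw [← hc₀] at hclim
  have hf11 : Tendsto (fun p : (Mat × Mat) × Mat × Mat => p.1.1) (u : Filter _) (𝓝 (mat A)) :=
    (Continuous.tendsto (f := fun p : (Mat × Mat) × Mat × Mat => p.1.1) (by fun_prop) _).comp hu1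
  have hf12 : Tendsto (fun p : (Mat × Mat) × Mat × Mat => p.1.2) (u : Filter _) (𝓝 (mat B)) :=
    (Continuous.tendsto (f := fun p : (Mat × Mat) × Mat × Mat => p.1.2) (by fun_prop) _).comp hu1
  have hf21 : Tendsto (fun p : (Mat × Mat) × Mat × Mat => p.2.1) (u : Filter _) (𝓝 (mat A)) :=
    (Continuous.tendsto (f := fun p : (Mat × Mat) × Mat × Mat => p.2.1) (by fun_prop) _).comp hu1
  have hf22 : Tendsto (fun p : (Mat × Mat) × Mat × Mat => p.2.2) (u : Filter _) (𝓝 (mat B)) :=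
    (Continuous.tendsto (f := fun p : (Mat × Mat) × Mat × Mat => p.2.2) (by fun_prop) _).comp hu1
  have hAT : mat A * T₀ = T₀ * mat A := by
    refine tendsto_nhds_unique_of_eventuallyEq (hf21.mul hlim) (hlim.mul hf11) ?_
    filter_upwards [huS] with p hp
    rw [hT, Matrix.mul_smul, (hh p hp).1, Matrix.smul_mul]
  have hBT : mat B * T₀ = T₀ * mat B := by
    refine tendsto_nhds_unique_of_eventuallyEq (hf22.mul hlim) (hlim.mul hf12) ?_
    filter_upwards [huS] with p hp
    rw [hT, Matrix.mul_smul, (hh p hp).2.1, Matrix.smul_mul]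
  have hdT : dag T₀ * T₀ = (c₀ * c₀) • (1 : Mat) := by
    refine tendsto_nhds_unique_of_eventuallyEq
      (((dagL.continuous.tendsto T₀).comp hlim).mul hlim)
      ((hclim.mul hclim).smul (tendsto_const_nhds (x := (1 : Mat)))) ?_
    refine Eventually.of_forall fun p => ?_
    change dag (T p) * T p = _
    rw [hT, map_smul, Matrix.smul_mul, Matrix.mul_smul, dag_mul_mat, smul_smul]
  by_cases hcz : c₀ = 0
  -- The conjugators escape to infinity: T₀ has isotropic image and commutes with the pair, so T₀ =
  -- 0, contradicting c₀ = 1 − ‖T₀‖ = 0.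
  · rw [hcz, mul_zero, zero_smul] at hdT
    have := hirr.eq_zero_of_isotropic hdT hAT hBT
    rw [this, norm_zero, hcz] at hc₀
    norm_num at hc₀
  -- The conjugators converge to an element of the centralizer of the pair, that is, to ±1, so they
  -- eventually enter O or −O.
  · have hunit : dag (c₀⁻¹ • T₀) * (c₀⁻¹ • T₀) = 1 := by
      rw [map_smul, Matrix.smul_mul, Matrix.mul_smul, hdT, smul_smul, smul_smul]
      have : c₀⁻¹ * c₀⁻¹ * (c₀ * c₀) = 1 := by field_simp
      rw [this, one_smul]
    obtain ⟨K, hK⟩ := exists_mat_eq hunit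
    have hKc : ∀ C : Sp21, mat C * T₀ = T₀ * mat C → C * K = K * C := by
      intro C hC
      apply mat_injective
      rw [mat_mul, mat_mul, hK, Matrix.mul_smul, hC, Matrix.smul_mul]
    have hlim' : Tendsto (fun p => mat (h p)) (u : Filter _) (𝓝 (mat K)) := by
      rw [hK]
      refine ((hclim.inv₀ hcz).smul hlim).congr fun p => ?_
      rw [hT, smul_smul, inv_mul_cancel₀ (hc0 p).ne', one_smul]
    rcases hirr.centralizer hA (hKc A hAT) (hKc B hBT) with h1 | h1
    · rw [h1] at hlim'
      obtain ⟨p, hp, hpO⟩ := (huS.and (hlim' hO)).exists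
      exact (hh p hp).2.2.1 hpO
    · have hlim2 := hlim'.neg
      rw [h1, neg_neg] at hlim2
      obtain ⟨p, hp, hpO⟩ := (huS.and (hlim2 hO)).exists
      exact (hh p hp).2.2.2 hpO

/-! ### Representations as tuples of matrices -/

/-- The topology of the unit group also controls the inverse, but on Sp(2,1) the inverse is the
adjoint, which is continuous in the matrix. -/
theorem isInducing_mat : IsInducing mat := by
  refine ⟨le_antisymm ?_ ?_⟩
  · exact continuous_iff_le_induced.1 (Units.continuous_val.comp continuous_subtype_val)
  · rw [← continuous_id_iff_le]
    let _ : TopologicalSpace Sp21 := TopologicalSpace.induced mat inferInstance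
    have hm : Continuous mat := continuous_induced_dom
    refine continuous_induced_rng.2 (Units.continuous_iff.2 ⟨hm, ?_⟩)
    have : (fun A : Sp21 => dagL (mat A)) = fun A : Sp21 => ((A : Matˣ)⁻¹ : Matˣ).val :=
      funext fun A => (mat_inv_eq_dag A).symm
    exact this ▸ dagL.continuous.comp hm

theorem continuous_mat : Continuous mat := isInducing_mat.continuous

variable {g : ℕ}

/-- The generators of the surface group. -/
def surfaceGen (i : Fin g ⊕ Fin g) : SurfaceGroup g := PresentedGroup.of i

/-- The tuple of the images of the generators. -/
def Rep.gens (ρ : Rep g) : Gens g := fun i => mat (ρ (surfaceGen i))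

theorem surfaceGroup_induction {p : SurfaceGroup g → Prop} (h1 : p 1)
    (hof : ∀ i, p (surfaceGen i)) (hmul : ∀ x y, p x → p y → p (x * y))
    (hinv : ∀ x, p x → p x⁻¹) (x : SurfaceGroup g) : p x := by
  have hx : x ∈ Subgroup.closure (Set.range (surfaceGen (g := g))) := by
    have := PresentedGroup.closure_range_of {(List.ofFn fun i : Fin g =>
      let a : FreeGroup (Fin g ⊕ Fin g) := FreeGroup.of (Sum.inl i)
      let b : FreeGroup (Fin g ⊕ Fin g) := FreeGroup.of (Sum.inr i)
      a * b * a⁻¹ * b⁻¹).prod}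
    exact this ▸ Subgroup.mem_top x
  induction hx using Subgroup.closure_induction with
  | mem x hx => obtain ⟨i, rfl⟩ := hx; exact hof i
  | one => exact h1
  | mul x y _ _ hx hy => exact hmul x y hx hy
  | inv x _ hx => exact hinv x hx

theorem Rep.isUnitary_gens (ρ : Rep g) : IsUnitary ρ.gens := fun _ => dag_mul_mat _

theorem Rep.gens_injective : Function.Injective (Rep.gens (g := g)) := by
  intro ρ ρ' h
  refine DFunLike.ext ρ ρ' fun x => ?_
  induction x using surfaceGroup_induction with
  | h1 => rw [ρ.map_one, ρ'.map_one]
  | hof i => exact mat_injective (congrFun h i)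
  | hmul x y hx hy => rw [ρ.map_mul, ρ'.map_mul, hx, hy]
  | hinv x hx => rw [ρ.map_inv, ρ'.map_inv, hx]

theorem Rep.commute_of_gens (ρ : Rep g) {X : Mat} (h : ∀ i, Commute X (ρ.gens i))
    (x : SurfaceGroup g) : Commute X (mat (ρ x)) := by
  induction x using surfaceGroup_induction with
  | h1 => rw [ρ.map_one, mat_one]; exact Commute.one_right X
  | hof i => exact h i
  | hmul x y hx hy => rw [ρ.map_mul, mat_mul]; exact hx.mul_right hy
  | hinv x hx =>
    rw [ρ.map_inv]
    exact hx.units_inv_right (u := (ρ x).1)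

theorem relMap_mat (A : Fin g ⊕ Fin g → Sp21) :
    relMap (List.finRange g) (fun i => mat (A i)) = mat ((List.ofFn fun i : Fin g =>
      A (.inl i) * A (.inr i) * (A (.inl i))⁻¹ * (A (.inr i))⁻¹).prod) := by
  rw [List.ofFn_eq_map, relMap]
  induction List.finRange g with
  | nil => rfl
  | cons i l ih =>
    rw [List.map_cons, List.prod_cons, ih, List.map_cons, List.prod_cons, mat_mul, matComm]
    simp only [mat_mul, mat_inv_eq_dag]

theorem Rep.relMap_gens (ρ : Rep g) : relMap (List.finRange g) ρ.gens = 1 := by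
  have h := PresentedGroup.one_of_mem (rels := {(List.ofFn fun i : Fin g =>
      let a : FreeGroup (Fin g ⊕ Fin g) := FreeGroup.of (Sum.inl i)
      let b : FreeGroup (Fin g ⊕ Fin g) := FreeGroup.of (Sum.inr i)
      a * b * a⁻¹ * b⁻¹).prod}) (Set.mem_singleton _)
  have h2 := congrArg ρ h
  rw [ρ.map_one] at h2
  refine (relMap_mat _).trans ?_
  rw [← mat_one, ← h2]
  congr 1
  rw [map_list_prod, List.map_ofFn]
  have : ∀ l : List (SurfaceGroup g), ρ l.prod = (l.map ρ).prod := fun l =>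
    MonoidHom.map_list_prod (M := SurfaceGroup g) (N := Sp21) ρ l
  rw [this, List.map_ofFn]
  congr 2
  funext i
  change _ = ρ (surfaceGen (.inl i) * surfaceGen (.inr i) * (surfaceGen (.inl i))⁻¹ *
    (surfaceGen (.inr i))⁻¹)
  simp only [Rep.map_mul, Rep.map_inv]

theorem exists_rep_of_gens {x : Gens g} (hx : IsUnitary x)
    (hR : relMap (List.finRange g) x = 1) : ∃ ρ : Rep g, ρ.gens = x := by
  choose A hA using fun i => exists_mat_eq (hx i)
  have hA' : x = fun i => mat (A i) := funext fun i => (hA i).symm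
  rw [hA', relMap_mat] at hR
  have hR' := mat_injective (hR.trans mat_one.symm)
  refine ⟨PresentedGroup.toGroup (f := A) ?_, ?_⟩
  · intro r hr
    rw [Set.mem_singleton_iff.1 hr, map_list_prod, List.map_ofFn, ← hR']
    congr 2
    funext i
    simp
  · rw [hA']
    funext i
    change mat (PresentedGroup.toGroup _ (PresentedGroup.of i)) = _
    rw [PresentedGroup.toGroup.of]

theorem Rep.continuous_eval (x : SurfaceGroup g) : Continuous fun ρ : Rep g => ρ x :=
  (continuous_apply x).comp continuous_induced_dom

theorem Rep.isInducing_gens : IsInducing (Rep.gens (g := g)) := by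
  refine ⟨le_antisymm ?_ ?_⟩
  · exact continuous_iff_le_induced.1
      (continuous_pi fun i => continuous_mat.comp (Rep.continuous_eval _))
  · rw [← continuous_id_iff_le]
    let _ : TopologicalSpace (Rep g) := TopologicalSpace.induced Rep.gens inferInstance
    have hm : Continuous (Rep.gens (g := g)) := continuous_induced_dom
    refine continuous_induced_rng.2 (continuous_pi fun x => ?_)
    change Continuous fun ρ : Rep g => ρ x
    induction x using surfaceGroup_induction with
    | h1 => simp only [Rep.map_one]; exact continuous_const
    | hof i => exact isInducing_mat.continuous_iff.2 ((continuous_apply i).comp hm)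
    | hmul x y hx hy => simp only [Rep.map_mul]; exact hx.mul hy
    | hinv x hx => simp only [Rep.map_inv]; exact hx.inv

/-- Conjugation of representations. -/
def Rep.conj (h : Sp21) (ρ : Rep g) : Rep g :=
  MonoidHom.comp (MulAut.conj h).toMonoidHom (N := Sp21) (M := SurfaceGroup g) ρ

theorem Rep.conj_apply (h : Sp21) (ρ : Rep g) (x : SurfaceGroup g) :
    ρ.conj h x = h * ρ x * h⁻¹ := rfl

theorem Rep.gens_conj (h : Sp21) (ρ : Rep g) :
    (ρ.conj h).gens = fun i => mat h * ρ.gens i * dag (mat h) := by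
  funext i
  rw [Rep.gens, Rep.conj_apply, mat_mul, mat_mul, mat_inv_eq_dag]
  rfl

theorem Rep.continuous_conj (h : Sp21) : Continuous (Rep.conj (g := g) h) := by
  rw [Rep.isInducing_gens.continuous_iff, continuous_pi_iff]
  intro i
  have : (fun ρ : Rep g => (Rep.gens ∘ Rep.conj h) ρ i) =
      fun ρ : Rep g => mat h * mat (ρ (surfaceGen i)) * dag (mat h) :=
    funext fun ρ => congrFun (ρ.gens_conj h) i
  rw [this]
  exact (continuous_const.mul (continuous_mat.comp (Rep.continuous_eval _))).mul continuous_const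

end

section

attribute [local instance] Matrix.linftyOpNormedRing Matrix.linftyOpNormedAlgebra

open Filter Topology

/-! ### Charts of the deformation space -/

variable {g : ℕ}

theorem Rep.eq_conj {ρ ρ' : Rep g} {h : Sp21} (hh : ∀ x, ρ' x = h * ρ x * h⁻¹) :
    ρ' = ρ.conj h := DFunLike.ext _ _ hh

/-- A continuous family of pairwise non-conjugate representations whose conjugates fill up
neighbourhoods parametrizes an open subset of the deformation space. -/
theorem isOpenEmbedding_mk {T : Type*} [TopologicalSpace T] {σ : T → Rep g} (hσ : Continuous σ)
    (hinj : ∀ t t', Conjugate (σ t) (σ t') → t = t')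
    (hopen : ∀ t, ∀ S ∈ 𝓝 t, ∀ᶠ ρ in 𝓝 (σ t), ∃ t' ∈ S, Conjugate (σ t') ρ) :
    IsOpenEmbedding fun t => Quotient.mk (conjSetoid g) (σ t) := by
  refine .of_continuous_injective_isOpenMap (continuous_quotient_mk'.comp hσ)
    (fun t t' h => hinj t t' (Quotient.exact h)) fun S hS => ?_
  refine isOpen_coinduced.2 (isOpen_iff_mem_nhds.2 ?_)
  rintro ρ ⟨t, ht, htρ⟩
  obtain ⟨h, hh⟩ : Conjugate (σ t) ρ := Quotient.exact htρ
  have hρ : ρ.conj h⁻¹ = σ t := DFunLike.ext _ _ fun x => by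
    rw [Rep.conj_apply, hh]
    group
  have hc : Tendsto (Rep.conj h⁻¹) (𝓝 ρ) (𝓝 (σ t)) := by
    rw [← hρ]
    exact (Rep.continuous_conj h⁻¹).tendsto ρ
  filter_upwards [hc.eventually (hopen t S (hS.mem_nhds ht))] with ρ' hρ'
  obtain ⟨t', ht', k, hk⟩ := hρ'
  refine ⟨t', ht', Quotient.sound ⟨h * k, fun x => ?_⟩⟩
  have := hk x
  rw [Rep.conj_apply] at this
  calc ρ' x = h * (h⁻¹ * ρ' x * h⁻¹⁻¹) * h⁻¹ := by group
    _ = h * k * σ t' x * (h * k)⁻¹ := by rw [this]; group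

/-- The images of a and b depend continuously on the representation, whose topology is that of its
generator tuple; so properness for the pair passes to representations. -/
theorem Rep.proper {ρ₀ : Rep g} {a b : SurfaceGroup g} (hirr : IsIrreducible (ρ₀ a) (ρ₀ b))
    (ha : IsLoxodromic (ρ₀ a)) {O : Set Mat} (hO : O ∈ 𝓝 (1 : Mat)) :
    ∃ W ∈ 𝓝 ρ₀.gens, ∀ (ρ : Rep g) (h : Sp21), ρ.gens ∈ W → (ρ.conj h).gens ∈ W →
      mat h ∈ O ∨ -mat h ∈ O := by
  have hF : Continuous fun p : Rep g × Rep g =>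
      ((mat (p.1 a), mat (p.1 b)), mat (p.2 a), mat (p.2 b)) := by
    have h1 : ∀ x, Continuous fun p : Rep g × Rep g => mat (p.1 x) := fun x =>
      (continuous_mat.comp (Rep.continuous_eval x)).comp continuous_fst
    have h2 : ∀ x, Continuous fun p : Rep g × Rep g => mat (p.2 x) := fun x =>
      (continuous_mat.comp (Rep.continuous_eval x)).comp continuous_snd
    exact ((h1 a).prodMk (h1 b)).prodMk ((h2 a).prodMk (h2 b))
  have hev := (hF.tendsto (ρ₀, ρ₀)).eventually (hirr.proper ha hO)
  rw [nhds_prod_eq, Filter.Eventually, mem_prod_same_iff] at hev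
  obtain ⟨U, hU, hUU⟩ := hev
  rw [Rep.isInducing_gens.nhds_eq_comap, mem_comap] at hU
  obtain ⟨W, hW, hWU⟩ := hU
  refine ⟨W, hW, fun ρ h hρ hρ' => ?_⟩
  have key : ∀ x, mat (ρ.conj h x) * mat h = mat h * mat (ρ x) := fun x => by
    rw [← mat_mul, ← mat_mul, Rep.conj_apply, inv_mul_cancel_right]
  exact hUU (Set.mk_mem_prod (hWU hρ) (hWU hρ')) h (key a) (key b)

theorem continuous_relMap (l : List (Fin g)) : Continuous (relMap l) :=
  continuous_iff_continuousAt.2 fun x =>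
    let ⟨_, hD, _⟩ := exists_hasStrictFDerivAt_relMap l x
    hD.continuousAt

theorem dag_mul_self_eq_one {M : Mat} (h : symPart (dag M * M - 1) = 0) : dag M * M = 1 := by
  rw [symPart_eq_zero_iff, map_sub, dag_mul, dag_dag, dag_one] at h
  have : (2 : ℝ) • (dag M * M - 1) = 0 := by
    rw [two_smul]
    nth_rewrite 1 [h]
    abel
  rw [smul_eq_zero_iff_right (by norm_num)] at this
  exact sub_eq_zero.1 this

/-- A unitary M with vanishing skew part is self-adjoint, so M² = 1; for u = M − 1 this reads 2u =
−u², impossible for 0 < ‖u‖ < 1. Hence near 1 the 21 skew equations already express the surface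
relation. -/
theorem eq_one_of_skewPart {M : Mat} (h : dag M * M = 1) (hM : skewPart (M - 1) = 0)
    (hn : ‖M - 1‖ < 1) : M = 1 := by
  rw [skewPart_eq_zero_iff, map_sub, dag_one, sub_left_inj] at hM
  rw [hM] at h
  obtain ⟨u, hu⟩ : ∃ u : Mat, u = M - 1 := ⟨_, rfl⟩
  have hMu : M = 1 + u := by rw [hu]; abel
  have e : (2 : ℝ) • u = -(u * u) := by
    rw [hMu] at h
    rw [two_smul, eq_neg_iff_add_eq_zero, ← sub_eq_zero.2 h]
    noncomm_ring
  have hnorm : 2 * ‖u‖ ≤ ‖u‖ * ‖u‖ := by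
    calc 2 * ‖u‖ = ‖(2 : ℝ) • u‖ := by rw [norm_smul]; norm_num
      _ = ‖u * u‖ := by rw [e, norm_neg]
      _ ≤ _ := norm_mul_le u u
  rw [← hu] at hn
  have : ‖u‖ = 0 := by nlinarith [norm_nonneg u]
  rw [hMu, norm_eq_zero.1 this, add_zero]

theorem exists_rep_of_sliceMap {x₀ x : Gens g} {L : Gens g →L[ℝ] lieAlg}
    (h : sliceMap x₀ L x = 0) (hn : ‖relMap (List.finRange g) x - 1‖ < 1) :
    ∃ ρ : Rep g, ρ.gens = x := by
  have hx : IsUnitary x := fun i => dag_mul_self_eq_one (congrFun (congrArg Prod.fst h) i)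
  exact exists_rep_of_gens hx (eq_one_of_skewPart (relMap_dag_mul hx _)
    (congrArg (fun p => p.2.1) h) hn)

theorem sliceMap_gens {x₀ : Gens g} {L : Gens g →L[ℝ] lieAlg} {ρ : Rep g}
    (h : L (ρ.gens - x₀) = 0) : sliceMap x₀ L ρ.gens = 0 := by
  refine Prod.ext (funext fun i => ?_) (Prod.ext ?_ h)
  · change symPart (dag (ρ.gens i) * ρ.gens i - 1) = 0
    rw [ρ.isUnitary_gens i, sub_self, map_zero]
  · change skewPart (relMap (List.finRange g) ρ.gens - 1) = 0
    rw [ρ.relMap_gens, sub_self, map_zero]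

theorem orbitMap_gens {x₀ : Gens g} {L : Gens g →L[ℝ] lieAlg} {ρ : Rep g} {h : Sp21}
    (hL : L ((ρ.conj h).gens - x₀) = 0) : orbitMap x₀ L (mat h, ρ.gens) = (0, 0, ρ.gens) := by
  refine Prod.ext ?_ (Prod.ext ?_ rfl)
  · change symPart (dag (mat h) * mat h - 1) = 0
    rw [dag_mul_mat, sub_self, map_zero]
  · rw [ρ.gens_conj h] at hL
    exact hL

theorem Rep.conj_one (ρ : Rep g) : ρ.conj 1 = ρ := DFunLike.ext _ _ fun x => by
  rw [Rep.conj_apply, one_mul, inv_one, mul_one]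

theorem Rep.conj_negOne_mul (ρ : Rep g) (h : Sp21) : ρ.conj (negOne * h) = ρ.conj h := by
  apply Rep.gens_injective
  rw [Rep.gens_conj, Rep.gens_conj]
  funext i
  rw [mat_mul, mat_negOne, neg_one_mul, map_neg]
  noncomm_ring

/-- Near a representation with an irreducible pair in its image, the deformation space is a
manifold of dimension `42g - 42`. -/
theorem exists_chart {ρ₀ : Rep g} {a b : SurfaceGroup g} (hirr : IsIrreducible (ρ₀ a) (ρ₀ b))
    (ha : IsLoxodromic (ρ₀ a)) :
    ∃ e : OpenPartialHomeomorph (Deformation g) (EuclideanSpace ℝ (Fin (42 * g - 42))),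
      Quotient.mk (conjSetoid g) ρ₀ ∈ e.source := by
  obtain ⟨x₀, hx₀⟩ : ∃ x₀, x₀ = ρ₀.gens := ⟨_, rfl⟩
  have hcent : HasTrivialInfCentralizer x₀ := fun X hX =>
    hirr.infCentralizer ha X (ρ₀.commute_of_gens (hx₀ ▸ hX) a) (ρ₀.commute_of_gens (hx₀ ▸ hX) b)
  obtain ⟨L, hL⟩ := hcent.exists_leftInverse
  obtain ⟨D, hD, hsurj, hker⟩ := sliceMap_submersion (hx₀ ▸ ρ₀.isUnitary_gens)
    (hx₀ ▸ ρ₀.relMap_gens) hcent hL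
  obtain ⟨Q, hQ⟩ := orbitMap_deriv hL
  have hs0 : sliceMap x₀ L x₀ = 0 := by
    have : L (ρ₀.gens - x₀) = 0 := by rw [hx₀, sub_self, map_zero]
    have := sliceMap_gens this
    rwa [← hx₀] at this
  -- Implicit function coordinates: the first component is the slice map, and the second
  -- parametrizes its zero set by the kernel of the differential.
  obtain ⟨Φ, hΦfst, hΦx₀, hΦsource⟩ : ∃ Φ : OpenPartialHomeomorph (Gens g)
      (((Fin g ⊕ Fin g → selfAdj) × lieAlg × lieAlg) × D.ker),
      (∀ x, (Φ x).1 = sliceMap x₀ L x) ∧ Φ x₀ = (0, 0) ∧ x₀ ∈ Φ.source :=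
    ⟨hD.implicitToOpenPartialHomeomorph _ _ hsurj, fun x => rfl,
      (hD.implicitToOpenPartialHomeomorph_self hsurj).trans (by rw [hs0]),
      hD.mem_implicitToOpenPartialHomeomorph_source hsurj⟩
  obtain ⟨Λ, hΛ, hΛsource⟩ : ∃ Λ : OpenPartialHomeomorph (Mat × Gens g)
      (selfAdj × lieAlg × Gens g), (∀ p, Λ p = orbitMap x₀ L p) ∧
      ((1, x₀) : Mat × Gens g) ∈ Λ.source :=
    ⟨hQ.toOpenPartialHomeomorph _, fun p => rfl, hQ.mem_toOpenPartialHomeomorph_source⟩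
  obtain ⟨O, hO, W₁, hW₁, hOW⟩ := mem_nhds_prod_iff.1 (Λ.open_source.mem_nhds hΛsource)
  obtain ⟨W₂, hW₂, hproper⟩ := Rep.proper hirr ha hO
  rw [← hx₀] at hW₂
  have hW₃ : {x : Gens g | ‖relMap (List.finRange g) x - 1‖ < 1} ∈ 𝓝 x₀ := by
    refine (isOpen_lt (((continuous_relMap _).sub continuous_const).norm) continuous_const).mem_nhds ?_
    change ‖relMap (List.finRange g) x₀ - 1‖ < 1
    rw [hx₀, ρ₀.relMap_gens, sub_self, norm_zero]
    exact one_pos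
  -- On W the local inverse of the orbit map, the properness statement and the bound on the relation
  -- are all available.
  obtain ⟨W, hWsub, hWo, hxW⟩ := mem_nhds_iff.1 (inter_mem (inter_mem hW₁ hW₂) hW₃)
  obtain ⟨𝒯, h𝒯⟩ : ∃ 𝒯 : Set D.ker, 𝒯 = {t | ((0 : (Fin g ⊕ Fin g → selfAdj) × lieAlg × lieAlg), t) ∈
    Φ.target ∧ Φ.symm (0, t) ∈ W} := ⟨_, rfl⟩
  have h𝒯o : IsOpen 𝒯 := by
    have := (Φ.isOpen_inter_preimage_symm hWo).preimage
      (f := fun t : D.ker => ((0 : (Fin g ⊕ Fin g → selfAdj) × lieAlg × lieAlg), t))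
      (continuous_const.prodMk continuous_id)
    rw [h𝒯]
    exact this
  have hmem : ∀ t : 𝒯, ((0 : (Fin g ⊕ Fin g → selfAdj) × lieAlg × lieAlg), (t : D.ker)) ∈ Φ.target ∧
      Φ.symm (0, (t : D.ker)) ∈ W := fun t => h𝒯.subset t.2
  have hzero : ∀ t : 𝒯, sliceMap x₀ L (Φ.symm (0, (t : D.ker))) = 0 := fun t => by
    rw [← hΦfst, Φ.right_inv (hmem t).1]
  -- Zeros of the slice map in W are generator tuples of representations.
  choose σ hσ using fun t : 𝒯 => exists_rep_of_sliceMap (hzero t) (hWsub (hmem t).2).2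
  have hσW : ∀ t, (σ t).gens ∈ W := fun t => by rw [hσ]; exact (hmem t).2
  have hσL : ∀ t, L ((σ t).gens - x₀) = 0 := fun t => by
    rw [hσ]; exact congrArg (fun p => p.2.2) (hzero t)
  have hcont : Continuous σ := by
    rw [Rep.isInducing_gens.continuous_iff, show Rep.gens ∘ σ = fun t : 𝒯 => Φ.symm (0, (t : D.ker)) from
      funext hσ]
    exact Φ.continuousOn_symm.comp_continuous (continuous_const.prodMk continuous_subtype_val)
      fun t => (hmem t).1
  have hinj : ∀ t t', Conjugate (σ t) (σ t') → t = t' := by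
    rintro t t' ⟨h, hh⟩
    have hh := Rep.eq_conj hh
    -- By properness the conjugator is in O up to sign, and the sign acts trivially. The orbit map
    -- takes k and 1 to the same value because both representations lie on the slice, so k = 1.
    obtain ⟨k, hk, hkO⟩ : ∃ k, σ t' = (σ t).conj k ∧ mat k ∈ O := by
      rcases hproper (σ t) h (hWsub (hσW t)).1.2 (hh ▸ (hWsub (hσW t')).1.2) with hO | hO
      · exact ⟨h, hh, hO⟩
      · exact ⟨negOne * h, by rw [Rep.conj_negOne_mul, hh], by
          rwa [mat_mul, mat_negOne, neg_one_mul]⟩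
    have e1 : Λ (mat k, (σ t).gens) = (0, 0, (σ t).gens) := by
      rw [hΛ, orbitMap_gens]
      rw [← hk]
      exact hσL t'
    have e2 : Λ (mat 1, (σ t).gens) = (0, 0, (σ t).gens) := by
      rw [hΛ, orbitMap_gens]
      rw [Rep.conj_one]
      exact hσL t
    have hsrc : ∀ M ∈ O, (M, (σ t).gens) ∈ Λ.source := fun M hM =>
      hOW (Set.mk_mem_prod hM (hWsub (hσW t)).1.1)
    have e3 := Λ.injOn (hsrc _ hkO) (hsrc _ (mem_of_mem_nhds hO)) (e1.trans e2.symm)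
    have hk1 : k = 1 := mat_injective (congrArg Prod.fst e3)
    rw [hk1, Rep.conj_one] at hk
    have e4 : Φ.symm (0, (t' : D.ker)) = Φ.symm (0, (t : D.ker)) := by rw [← hσ, ← hσ, hk]
    have e5 := Φ.symm.injOn (hmem t').1 (hmem t).1 e4
    exact (Subtype.ext (congrArg Prod.snd e5)).symm
  have hopen : ∀ t, ∀ S ∈ 𝓝 t, ∀ᶠ ρ in 𝓝 (σ t), ∃ t' ∈ S, Conjugate (σ t') ρ := by
    intro t S hS
    obtain ⟨U, hU, hUS⟩ := mem_nhds_subtype _ _ _ |>.1 hS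
    obtain ⟨x, hx⟩ : ∃ x, x = (σ t).gens := ⟨_, rfl⟩
    have hsrc : ((1, x) : Mat × Gens g) ∈ Λ.source := by
      rw [hx]
      exact hOW (Set.mk_mem_prod (mem_of_mem_nhds hO) (hWsub (hσW t)).1.1)
    have e1 : Λ (1, x) = (0, 0, x) := by
      rw [hΛ, hx, ← mat_one, orbitMap_gens]
      rw [Rep.conj_one]
      exact hσL t
    have hlift : Tendsto (fun y : Gens g => ((0, 0, y) : selfAdj × lieAlg × Gens g)) (𝓝 x)
        (𝓝 (0, 0, x)) :=
      (continuous_const.prodMk (continuous_const.prodMk continuous_id)).tendsto x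
    have htarget : ∀ᶠ y in 𝓝 x, ((0, 0, y) : selfAdj × lieAlg × Gens g) ∈ Λ.target := by
      refine hlift (Λ.open_target.mem_nhds ?_)
      rw [← e1]
      exact Λ.map_source hsrc
    -- The local inverse at (0, 0, y) supplies a conjugator, close to 1, that moves y into the
    -- slice; the conjugated tuple tends to x with y, so its slice parameter tends to t.
    have hz : Tendsto (fun y : Gens g => Λ.symm (0, 0, y)) (𝓝 x) (𝓝 (1, x)) := by
      have := Λ.tendsto_symm hsrc
      rw [e1] at this
      exact this.comp hlift
    have hw : Tendsto (fun y : Gens g => fun i => (Λ.symm (0, 0, y)).1 * y i *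
        dag (Λ.symm (0, 0, y)).1) (𝓝 x) (𝓝 x) := by
      rw [tendsto_pi_nhds]
      intro i
      have h1 : Tendsto (fun y : Gens g => (Λ.symm (0, 0, y)).1) (𝓝 x) (𝓝 1) :=
        (continuous_fst.tendsto _).comp hz
      have h2 := (dagL.continuous.tendsto 1).comp h1
      have h3 := (h1.mul ((continuous_apply i).tendsto x)).mul h2
      have e : (1 : Mat) * x i * dagL 1 = x i := by rw [dagL_apply, dag_one, one_mul, mul_one]
      rw [e] at h3
      exact h3
    have hxs : x ∈ Φ.source := by
      rw [hx, hσ]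
      exact Φ.map_target (hmem t).1
    have hΦx : Φ x = (0, (t : D.ker)) := by rw [hx, hσ, Φ.right_inv (hmem t).1]
    have hsnd : Tendsto (fun y => (Φ y).2) (𝓝 x) (𝓝 (t : D.ker)) := by
      have := (continuous_snd.tendsto _).comp (Φ.continuousAt hxs).tendsto
      rw [hΦx] at this
      exact this
    have hgens : Tendsto Rep.gens (𝓝 (σ t)) (𝓝 x) := by
      rw [hx]
      exact Rep.isInducing_gens.continuous.tendsto _
    filter_upwards [hgens htarget, hgens (hw (Φ.open_source.mem_nhds hxs)),
      hgens (hw (hsnd (inter_mem hU (h𝒯o.mem_nhds t.2))))] with ρ h1 h2 h3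
    obtain ⟨p, hp⟩ : ∃ p, p = Λ.symm (0, 0, ρ.gens) := ⟨_, rfl⟩
    have hΛp : orbitMap x₀ L p = (0, 0, ρ.gens) := by rw [← hΛ, hp]; exact Λ.right_inv h1
    have hp2 : p.2 = ρ.gens := congrArg (fun q => q.2.2) hΛp
    obtain ⟨h, hh⟩ := exists_mat_eq (dag_mul_self_eq_one (M := p.1) (congrArg Prod.fst hΛp))
    have hconj : (ρ.conj h).gens = fun i => p.1 * ρ.gens i * dag p.1 := by rw [ρ.gens_conj, hh]
    have hLw : L ((ρ.conj h).gens - x₀) = 0 := by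
      rw [hconj, ← hp2]
      exact congrArg (fun q => q.2.1) hΛp
    have h2' : (ρ.conj h).gens ∈ Φ.source := by rw [hconj, hp]; exact h2
    have h3' : (Φ (ρ.conj h).gens).2 ∈ U ∩ 𝒯 := by rw [hconj, hp]; exact h3
    obtain ⟨t', ht'⟩ : ∃ t', t' = (Φ (ρ.conj h).gens).2 := ⟨_, rfl⟩
    rw [← ht'] at h3'
    have hΦw : Φ (ρ.conj h).gens = (0, t') :=
      Prod.ext ((hΦfst _).trans (sliceMap_gens hLw)) ht'.symm
    have hσt' : σ ⟨t', h3'.2⟩ = ρ.conj h := by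
      apply Rep.gens_injective
      rw [hσ, ← hΦw]
      exact Φ.left_inv h2'
    refine ⟨⟨t', h3'.2⟩, hUS h3'.1, h⁻¹, fun y => ?_⟩
    rw [hσt', Rep.conj_apply]
    group
  have hemb := isOpenEmbedding_mk hcont hinj hopen
  have h0 : (0 : D.ker) ∈ 𝒯 := by
    rw [h𝒯]
    refine ⟨hΦx₀ ▸ Φ.map_source hΦsource, ?_⟩
    rw [← hΦx₀, Φ.left_inv hΦsource]
    exact hxW
  have hσ0 : σ ⟨0, h0⟩ = ρ₀ := by
    apply Rep.gens_injective
    rw [hσ, ← hx₀, ← hΦx₀, Φ.left_inv hΦsource]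
  have : Nonempty 𝒯 := ⟨⟨0, h0⟩⟩
  have hfr : Module.finrank ℝ D.ker =
      Module.finrank ℝ (EuclideanSpace ℝ (Fin (42 * g - 42))) := by
    rw [hker, finrank_euclideanSpace_fin]
  -- The chart inverts the parametrization and then includes the parameter set into the kernel,
  -- which is identified with Euclidean space by dimension.
  refine ⟨(hemb.toOpenPartialHomeomorph _).symm.trans
    ((h𝒯o.isOpenEmbedding_subtypeVal.toOpenPartialHomeomorph _).trans
      (ContinuousLinearEquiv.ofFinrankEq hfr).toHomeomorph.toOpenPartialHomeomorph), ?_⟩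
  have hm : Quotient.mk (conjSetoid g) ρ₀ ∈ Set.range fun t => Quotient.mk (conjSetoid g) (σ t) :=
    ⟨⟨0, h0⟩, congrArg (Quotient.mk (conjSetoid g)) hσ0⟩
  simpa using hm

end

end FN

end

/-! ### The four statements together -/

theorem theorem1p6 (g : ℕ) (hg : 2 ≤ g) (C : FN.CurveSystem g) :
    -- conjugate representations have the same parameters of `(0,3)` groups
    (∀ ρ ρ' : FN.Rep g, FN.IsGeometric C ρ → FN.IsGeometric C ρ' → FN.Conjugate ρ ρ' →
      ∀ v, FN.pantsParameters C ρ v = FN.pantsParameters C ρ' v) ∧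
    -- with the same parameters of `(0,3)` groups as a reference, there are twist-bend parameters
    (∀ ρ₀ ρ : FN.Rep g, FN.IsGeometric C ρ₀ → FN.IsGeometric C ρ →
      (∀ v, FN.pantsParameters C ρ v = FN.pantsParameters C ρ₀ v) →
      ∃ κ, FN.HasTwistBends C ρ₀ ρ κ) ∧
    -- and these determine the representation up to conjugacy, and are determined by it
    (∀ (ρ₀ ρ ρ' : FN.Rep g) (κ κ' : Fin (3 * g - 3) → FN.TwistBend),
      FN.IsGeometric C ρ₀ → FN.IsGeometric C ρ → FN.IsGeometric C ρ' →
      FN.HasTwistBends C ρ₀ ρ κ → FN.HasTwistBends C ρ₀ ρ' κ' →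
      (FN.Conjugate ρ ρ' ↔ FN.SameTwistBends C κ κ')) ∧
    -- near a geometric representation, `42g - 42` real parameters
    (∀ ρ : FN.Rep g, FN.IsGeometric C ρ →
      ∃ e : OpenPartialHomeomorph (FN.Deformation g) (EuclideanSpace ℝ (Fin (42 * g - 42))),
        Quotient.mk (FN.conjSetoid g) ρ ∈ e.source) := by
  refine ⟨fun ρ ρ' hρ hρ' h v => FN.pantsParameters_eq_of_conjugate hρ hρ' h v,
    fun ρ₀ ρ hρ₀ hρ h => FN.exists_hasTwistBends hρ₀ hρ h,
    fun ρ₀ ρ ρ' κ κ' hρ₀ _ _ hκ hκ' =>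
      ⟨hκ.sameTwistBends hρ₀ hκ', fun h => hκ.conjugate hκ' h hg⟩,
    fun ρ hρ => ?_⟩
  let v : Fin (2 * g - 2) := ⟨0, by omega⟩
  exact FN.exists_chart (hρ.irreducible v) (hρ.boundary v 0)
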